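/- Let $\zeta^{(k)}$ denote the $k$-th derivative of the Riemann zeta function. An $a$-point of $\zeta^{(k)}$ is a root $\rho$ of $\zeta^{(k)}(\rho)=a$. Sums over $a$-points count each one with its multiplicity as a zero of $\zeta^{(k)}-a$. Let $x>1$ be a real number, $k\ge 1$ an integer and $a$ a complex number. Then for every $T$ there are only finitely many $a$-points of $\zeta^{(k)}$ with $1<\operatorname{Im}\rho<T$, and, as $T\to\infty$ (with an implied constant that may depend on $x$, $k$ and $a$), $$\sum_{\substack{\zeta^{(k)}(\rho)=a\\ 1<\operatorname{Im}\rho<T}}x^{\rho}=\frac{T}{2\pi}\,\alpha_{k,a}(x)+O(\log T),$$ where, for real $y$, the coefficient $\alpha_{k,a}(y)$ is the finite sum over tuples of integers $$\alpha_{k,a}(y)=\sum_{\substack{l\ge 0\\ n_0,\dots,n_l\ge 2\\ y=n_0\cdots n_l}}\frac{(-1)^{k(l+1)}}{a^{l+1}}(\log n_0)^{k+1}(\log n_1\cdots\log n_l)^k\qquad(a\ne 0),$$ $$\alpha_{k,0}(y)=\sum_{\substack{l\ge 0\\ n_0\ge 2,\ n_1,\dots,n_l\ge 3\\ y=n_0\cdots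 n_l/2^{l+1}}}\left(\frac{-1}{(\log 2)^k}\right)^{l+1}(\log n_0)^{k+1}(\log n_1\cdots\log n_l)^k\qquad(a=0).$$ These are the coefficients of the Dirichlet series of $\zeta^{(k+1)}/(\zeta^{(k)}-a)$: for all $s$ with sufficiently large real part (depending on $k$ and $a$) one has $\zeta^{(k)}(s)\neq a$ and $$\frac{\zeta^{(k+1)}(s)}{\zeta^{(k)}(s)-a}=\sum_{d}\alpha_{k,a}(d)\,d^{-s},$$ an absolutely convergent sum over the (countably many) real $d\geq 1$ with $\alpha_{k,a}(d)\ne 0$. If $a\ne 0$ and $x\notin\mathbb{Z}$, then $\alpha_{k,a}(x)=0$; if $a=0$ and $2^nx\notin\mathbb{Z}$ for every $n\in\mathbb{N}$, then $\alpha_{k,0}(x)=0$. -/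

import Mathlib

open Filter Asymptotics

namespace ZetaDeriv

/-- The `k`-th derivative of the Riemann zeta function (meaningful away from the pole `s = 1`). -/
noncomputable def zetaD (k : ℕ) (s : ℂ) : ℂ := iteratedDeriv k riemannZeta s

/-- The `a`-points `ρ` of the `k`-th derivative of zeta with `1 < Im ρ < T`. -/
def aPoints (k : ℕ) (a : ℂ) (T : ℝ) : Set ℂ :=
  {ρ : ℂ | zetaD k ρ = a ∧ 1 < ρ.im ∧ ρ.im < T}

/-- The multiplicity of an `a`-point: the order of vanishing of `ζ^(k) - a`. -/
noncomputable def mult (k : ℕ) (a : ℂ) (ρ : ℂ) : ℕ :=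
  analyticOrderNatAt (fun s : ℂ => zetaD k s - a) ρ

/-- The sum of `x ^ ρ` over the `a`-points with `1 < Im ρ < T`, counted with multiplicity. -/
noncomputable def aPointSum (k : ℕ) (a : ℂ) (x T : ℝ) : ℂ :=
  ∑ᶠ ρ ∈ aPoints k a T, (mult k a ρ : ℂ) * (x : ℂ) ^ ρ

/-- Finite tuples `(n_0, …, n_l)` of natural numbers with `l ≥ 0`. -/
abbrev Tuple : Type := Σ l : ℕ, (Fin (l + 1) → ℕ)

/-- `(log n_0)^(k+1) (log n_1 ⋯ log n_l)^k`. -/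
noncomputable def logWeight (k : ℕ) (p : Tuple) : ℝ :=
  Real.log (p.2 0) ^ (k + 1) * (∏ i : Fin p.1, Real.log (p.2 i.succ)) ^ k

/-- Tuples with `n_0, …, n_l ≥ 2` and `x = n_0 ⋯ n_l`. -/
def factorizations (x : ℝ) : Set Tuple :=
  {p | (∀ i, 2 ≤ p.2 i) ∧ x = ∏ i, (p.2 i : ℝ)}

/-- Tuples with `n_0 ≥ 2`, `n_1, …, n_l ≥ 3` and `x = n_0 ⋯ n_l / 2^(l+1)`. -/
def dyadicFactorizations (x : ℝ) : Set Tuple :=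
  {p | 2 ≤ p.2 0 ∧ (∀ i : Fin p.1, 3 ≤ p.2 i.succ) ∧
    x = (∏ i, (p.2 i : ℝ)) / 2 ^ (p.1 + 1)}

/-- The coefficient at `x` in the case `a ≠ 0`. -/
noncomputable def coeff (k : ℕ) (a : ℂ) (x : ℝ) : ℂ :=
  ∑ᶠ p ∈ factorizations x,
    (-1 : ℂ) ^ (k * (p.1 + 1)) / a ^ (p.1 + 1) * (logWeight k p : ℂ)

/-- The coefficient at `x` in the case `a = 0`. -/
noncomputable def coeffZero (k : ℕ) (x : ℝ) : ℂ :=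
  ∑ᶠ p ∈ dyadicFactorizations x,
    (((-1 / Real.log 2 ^ k) ^ (p.1 + 1) * logWeight k p : ℝ) : ℂ)

/-- In some half-plane `Re s > σ₀`, the function `ζ^(k+1) / (ζ^(k) - a)` is the sum of the absolutely
convergent general Dirichlet series `∑_d α(d) d^(-s)`. In the uses below `α` is supported on a
countable set of real numbers `d ≥ 1`. -/
def IsLogDerivCoeff (k : ℕ) (a : ℂ) (α : ℝ → ℂ) : Prop :=
  ∃ σ₀ : ℝ, ∀ s : ℂ, σ₀ < s.re → zetaD k s ≠ a ∧
    HasSum (fun d : ℝ => α d * (d : ℂ) ^ (-s)) (zetaD (k + 1) s / (zetaD k s - a))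

end ZetaDeriv

namespace ZetaDeriv

open Complex Set Metric Topology

/-! ### Factoring out finitely many zeros -/

/-! Put `f = ζ^(k) - a`. The sum of `x ^ ρ` over the zeros of `f`, with multiplicity, is `1 / (2πi)`
times the integral of `x ^ s * f'(s) / f(s)` around a rectangle, as in Landau's formula for the
zeros of zeta. The rectangle has right edge `Re s = B`, left edge `Re s = -T`, bottom just above `Im
s = 1`, and top at a suitable height `T'` in `[T, T + 1]`. Only the right edge contributes a main
term; all else is `O(log T)`.

Right edge. For large `Re s` one has `f = f₀ * (1 - c * S)` with `S` a small Dirichlet series: `f₀ =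
-a` if `a ≠ 0`, and `f₀` is the `n = 2` term of `ζ^(k)` if `a = 0`. Expanding `1 / (1 - c * S)`
geometrically writes `f' / f` as an absolutely convergent sum over tuples `(n_0, …, n_l)`, which
yields the coefficients. A tuple of value `d` contributes an integral of `(x / d) ^ s`: it grows
linearly if `d = x`, and is otherwise bounded through a lower bound on `|log (x / d)|`
(`norm_integral_dirichlet_sub_le`, `exists_right_half_plane_of_factor`).

Left half-plane. By the functional equation the logarithmic derivative of `ζ (1 - s)` is `log s +
O(1)` for large `Re s`, away from the real axis. This property passes to all derivatives
(`LogDerivLikeLog.deriv`), along with exponential growth that makes the constant `a` negligible.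
Hence `f' / f = O(log |s|)` far to the left, where `x ^ s` decays because `x > 1`.

Top edge. In vertical strips `f` has polynomial growth (`exists_norm_zetaD_sub_le`), so a
Jensen-type argument gives `O(log T)` zeros near height `T`, and there `f' / f` is the sum of `1 /
(s - ρ)` over them up to `O(log T)` (`exists_local_zeros`). Bounding `1 / |s - ρ|` by a product of
inverse square roots in the two coordinates and averaging over `T'` finds a height where the
horizontal integral is `O(log T)`, with no additional logarithm (`exists_height`,
`norm_integral_horizontal_le`). Replacing `T'` by `T` costs `O(log T)` more zeros. The contour
argument is `LandauHypotheses.sum_zeros_isBigO`; the rest verifies its hypotheses. -/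

lemma finite_zeros_of_isCompact {U K : Set ℂ} {f : ℂ → ℂ} {c : ℂ} (hU : IsOpen U)
    (hUc : IsPreconnected U) (hf : DifferentiableOn ℂ f U) (hc : c ∈ U) (hfc : f c ≠ 0)
    (hK : IsCompact K) (hKU : K ⊆ U) : {z | z ∈ K ∧ f z = 0}.Finite := by
  by_contra hinf
  obtain ⟨z, hzK, hz⟩ := Set.Infinite.exists_accPt_of_subset_isCompact hinf hK (fun z hz => hz.1)
  refine hfc ((hf.analyticOnNhd hU).eqOn_zero_of_preconnected_of_frequently_eq_zero hUc
    (hKU hzK) ?_ hc)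
  rw [accPt_iff_frequently_nhdsNE] at hz
  exact hz.mono fun w hw => hw.2

lemma analyticOrderAt_ne_top_of_ne_zero {U : Set ℂ} {f : ℂ → ℂ} {c : ℂ} (hU : IsOpen U)
    (hUc : IsPreconnected U) (hf : DifferentiableOn ℂ f U) (hc : c ∈ U) (hfc : f c ≠ 0)
    {z : ℂ} (hz : z ∈ U) : analyticOrderAt f z ≠ ⊤ := by
  refine (hf.analyticOnNhd hU).analyticOrderAt_ne_top_of_isPreconnected hUc hc hz ?_
  rw [analyticOrderAt_eq_zero.2 (Or.inr hfc)]
  exact ENat.zero_ne_top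

/-- Iterating `dslope` at `ρ` divides by `z - ρ` as many times as the order. The identity is
algebraic, hence valid at every `z`, even outside `U`; removable singularities keep the quotient
holomorphic on `U`. -/
lemma exists_pow_mul_of_analyticOrderAt {U : Set ℂ} {f : ℂ → ℂ} (hU : IsOpen U)
    (hf : DifferentiableOn ℂ f U) {ρ : ℂ} (hρ : ρ ∈ U) (ho : analyticOrderAt f ρ ≠ ⊤) :
    ∃ g : ℂ → ℂ, DifferentiableOn ℂ g U ∧
      (∀ z, f z = (z - ρ) ^ analyticOrderNatAt f ρ * g z) ∧ g ρ ≠ 0 := by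
  have hfa : AnalyticAt ℂ f ρ := hf.analyticAt (hU.mem_nhds hρ)
  obtain ⟨p, hp⟩ := id hfa
  have hp0 : p ≠ 0 := by
    rintro rfl
    refine ho (analyticOrderAt_eq_top.2 ?_)
    exact hp.eventually_eq_zero
  set g := (Function.swap dslope ρ)^[p.order] f with hg
  have hgd : DifferentiableOn ℂ g U := by
    have key : ∀ n : ℕ, DifferentiableOn ℂ ((Function.swap dslope ρ)^[n] f) U := by
      intro n
      induction n with
      | zero => exact hf
      | succ n ih =>
        rw [Function.iterate_succ_apply']
        exact (Complex.differentiableOn_dslope (hU.mem_nhds hρ)).2 ih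
    exact key _
  have hgρ : g ρ ≠ 0 := hp.iterate_dslope_fslope_ne_zero hp0
  have heq : ∀ z, f z = (z - ρ) ^ p.order * g z := fun z => by
    simpa using hp.eq_pow_order_mul_iterate_dslope z
  have hord : analyticOrderNatAt f ρ = p.order := by
    rw [hfa.analyticOrderNatAt_eq_iff ho]
    exact ⟨g, hgd.analyticAt (hU.mem_nhds hρ), hgρ, Eventually.of_forall fun z => by
      simpa using heq z⟩
  exact ⟨g, hgd, by rwa [hord], hgρ⟩

lemma exists_factorization {U : Set ℂ} {f : ℂ → ℂ} (hU : IsOpen U)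
    (hf : DifferentiableOn ℂ f U) (Z : Finset ℂ) (hZ : ∀ ρ ∈ Z, ρ ∈ U)
    (ho : ∀ ρ ∈ Z, analyticOrderAt f ρ ≠ ⊤) :
    ∃ g : ℂ → ℂ, DifferentiableOn ℂ g U ∧
      (∀ z, f z = (∏ ρ ∈ Z, (z - ρ) ^ analyticOrderNatAt f ρ) * g z) ∧
      ∀ ρ ∈ Z, g ρ ≠ 0 := by
  induction Z using Finset.induction_on with
  | empty => exact ⟨f, hf, by simp, by simp⟩
  | insert ρ Z hρZ ih =>
    obtain ⟨g, hg, hfg, hgZ⟩ := ih (fun ρ h => hZ ρ (Finset.mem_insert_of_mem h))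
      (fun ρ h => ho ρ (Finset.mem_insert_of_mem h))
    have hρU := hZ ρ (Finset.mem_insert_self _ _)
    -- The factors already removed do not vanish at the new point, so `g` has the same order there
    -- as `f`.
    have hord : analyticOrderAt f ρ = analyticOrderAt g ρ := by
      have hP : AnalyticAt ℂ (fun z : ℂ => ∏ ρ' ∈ Z, (z - ρ') ^ analyticOrderNatAt f ρ') ρ := by
        fun_prop
      have hg' : AnalyticAt ℂ g ρ := hg.analyticAt (hU.mem_nhds hρU)
      have : f = (fun z : ℂ => ∏ ρ' ∈ Z, (z - ρ') ^ analyticOrderNatAt f ρ') * g :=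
        funext hfg
      conv_lhs => rw [this]
      rw [analyticOrderAt_mul hP hg', hP.analyticOrderAt_eq_zero.2, zero_add]
      refine Finset.prod_ne_zero_iff.2 fun ρ' hρ' => pow_ne_zero _ (sub_ne_zero.2 ?_)
      rintro rfl
      exact hρZ hρ'
    have hog : analyticOrderAt g ρ ≠ ⊤ := hord ▸ ho ρ (Finset.mem_insert_self _ _)
    obtain ⟨h, hh, hgh, hhρ⟩ := exists_pow_mul_of_analyticOrderAt hU hg hρU hog
    have hordn : analyticOrderNatAt g ρ = analyticOrderNatAt f ρ := by
      simp [analyticOrderNatAt, hord]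
    rw [hordn] at hgh
    refine ⟨h, hh, fun z => ?_, fun ρ' hρ' => ?_⟩
    · rw [Finset.prod_insert hρZ, hfg z, hgh z]; ring
    · rcases Finset.mem_insert.1 hρ' with rfl | hρ'
      · exact hhρ
      · have := hgZ ρ' hρ'
        rw [hgh] at this
        exact right_ne_zero_of_mul this

lemma logDeriv_of_factorization {f g : ℂ → ℂ} {Z : Finset ℂ} {m : ℂ → ℕ}
    (hfg : ∀ z, f z = (∏ ρ ∈ Z, (z - ρ) ^ m ρ) * g z) {s : ℂ}
    (hg : DifferentiableAt ℂ g s) (hs : ∀ ρ ∈ Z, s ≠ ρ) (hgs : g s ≠ 0) :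
    deriv f s / f s = ∑ ρ ∈ Z, (m ρ : ℂ) / (s - ρ) + deriv g s / g s := by
  have hf : f = fun z => (∏ ρ ∈ Z, (z - ρ) ^ m ρ) * g z := funext hfg
  have hfac : ∀ ρ ∈ Z, (s - ρ) ^ m ρ ≠ 0 := fun ρ hρ => pow_ne_zero _ (sub_ne_zero.2 (hs ρ hρ))
  have h1 : logDeriv f s = logDeriv (fun z => ∏ ρ ∈ Z, (z - ρ) ^ m ρ) s + logDeriv g s := by
    conv_lhs => rw [hf]
    exact logDeriv_mul s (Finset.prod_ne_zero_iff.2 hfac) hgs (by fun_prop) hg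
  rw [← logDeriv_apply, h1, ← logDeriv_apply]
  congr 1
  rw [logDeriv_prod (f := fun ρ z => (z - ρ) ^ m ρ) hfac (fun ρ _ => by fun_prop)]
  refine Finset.sum_congr rfl fun ρ hρ => ?_
  have := logDeriv_fun_pow (f := fun z : ℂ => z - ρ) (x := s) (by fun_prop) (m ρ)
  rw [this, logDeriv_apply]
  have : deriv (fun z : ℂ => z - ρ) s = 1 := by simp
  rw [this]; ring

/-! ### Contour integrals over rectangles -/

/-- The contour integral of `f` over the positively oriented boundary of `[a, b] × [c, d]`. -/
noncomputable def rectIntegral (f : ℂ → ℂ) (a b c d : ℝ) : ℂ :=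
  (∫ x : ℝ in a..b, f (x + c * I)) - (∫ x : ℝ in a..b, f (x + d * I)) +
    I * (∫ y : ℝ in c..d, f (b + y * I)) - I * ∫ y : ℝ in c..d, f (a + y * I)

/-- The boundary of the rectangle `[a, b] × [c, d]`. -/
def rectBoundary (a b c d : ℝ) : Set ℂ :=
  {z | (z.re ∈ Icc a b ∧ (z.im = c ∨ z.im = d)) ∨ (z.im ∈ Icc c d ∧ (z.re = a ∨ z.re = b))}

section

variable {a b c d : ℝ}

lemma continuousOn_horizontal {f : ℂ → ℂ} {S : Set ℂ} (hf : ContinuousOn f S) (hab : a ≤ b) {y : ℝ}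
    (h : ∀ x ∈ Icc a b, (x + y * I : ℂ) ∈ S) :
    ContinuousOn (fun x : ℝ => f (x + y * I)) (uIcc a b) := by
  rw [uIcc_of_le hab]
  exact hf.comp (by fun_prop) h

lemma continuousOn_vertical {f : ℂ → ℂ} {S : Set ℂ} (hf : ContinuousOn f S) (hcd : c ≤ d) {x : ℝ}
    (h : ∀ y ∈ Icc c d, (x + y * I : ℂ) ∈ S) :
    ContinuousOn (fun y : ℝ => f (x + y * I)) (uIcc c d) := by
  rw [uIcc_of_le hcd]
  exact hf.comp (by fun_prop) h

lemma bottom_mem (x : ℝ) (hx : x ∈ Icc a b) :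
    (x + c * I : ℂ) ∈ rectBoundary a b c d := by
  left; simpa using hx

lemma top_mem (x : ℝ) (hx : x ∈ Icc a b) :
    (x + d * I : ℂ) ∈ rectBoundary a b c d := by
  left; simpa using hx

lemma left_mem (y : ℝ) (hy : y ∈ Icc c d) :
    (a + y * I : ℂ) ∈ rectBoundary a b c d := by
  right; simpa using hy

lemma right_mem (y : ℝ) (hy : y ∈ Icc c d) :
    (b + y * I : ℂ) ∈ rectBoundary a b c d := by
  right; simpa using hy

lemma rectIntegral_congr {f g : ℂ → ℂ} (hab : a ≤ b) (hcd : c ≤ d)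
    (h : ∀ z ∈ rectBoundary a b c d, f z = g z) :
    rectIntegral f a b c d = rectIntegral g a b c d := by
  have h1 : ∫ x : ℝ in a..b, f (x + c * I) = ∫ x : ℝ in a..b, g (x + c * I) :=
    intervalIntegral.integral_congr fun x hx => h _ (bottom_mem _ (uIcc_of_le hab ▸ hx))
  have h2 : ∫ x : ℝ in a..b, f (x + d * I) = ∫ x : ℝ in a..b, g (x + d * I) :=
    intervalIntegral.integral_congr fun x hx => h _ (top_mem _ (uIcc_of_le hab ▸ hx))
  have h3 : ∫ y : ℝ in c..d, f (b + y * I) = ∫ y : ℝ in c..d, g (b + y * I) :=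
    intervalIntegral.integral_congr fun x hx => h _ (right_mem _ (uIcc_of_le hcd ▸ hx))
  have h4 : ∫ y : ℝ in c..d, f (a + y * I) = ∫ y : ℝ in c..d, g (a + y * I) :=
    intervalIntegral.integral_congr fun x hx => h _ (left_mem _ (uIcc_of_le hcd ▸ hx))
  rw [rectIntegral, rectIntegral, h1, h2, h3, h4]

lemma rectIntegral_add {f g : ℂ → ℂ} (hab : a ≤ b) (hcd : c ≤ d)
    (hf : ContinuousOn f (rectBoundary a b c d)) (hg : ContinuousOn g (rectBoundary a b c d)) :
    rectIntegral (fun z => f z + g z) a b c d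
      = rectIntegral f a b c d + rectIntegral g a b c d := by
  unfold rectIntegral
  rw [intervalIntegral.integral_add, intervalIntegral.integral_add, intervalIntegral.integral_add,
    intervalIntegral.integral_add]
  · ring
  all_goals apply ContinuousOn.intervalIntegrable
  · exact continuousOn_vertical hf hcd left_mem
  · exact continuousOn_vertical hg hcd left_mem
  · exact continuousOn_vertical hf hcd right_mem
  · exact continuousOn_vertical hg hcd right_mem
  · exact continuousOn_horizontal hf hab top_mem
  · exact continuousOn_horizontal hg hab top_mem
  · exact continuousOn_horizontal hf hab bottom_mem
  · exact continuousOn_horizontal hg hab bottom_mem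

lemma rectIntegral_const_mul (f : ℂ → ℂ) (w : ℂ) :
    rectIntegral (fun z => w * f z) a b c d = w * rectIntegral f a b c d := by
  unfold rectIntegral
  simp only [intervalIntegral.integral_const_mul]
  ring

lemma rectIntegral_sum {ι : Type*} (Z : Finset ι) {f : ι → ℂ → ℂ} (hab : a ≤ b) (hcd : c ≤ d)
    (hf : ∀ i ∈ Z, ContinuousOn (f i) (rectBoundary a b c d)) :
    rectIntegral (fun z => ∑ i ∈ Z, f i z) a b c d = ∑ i ∈ Z, rectIntegral (f i) a b c d := by
  classical
  induction Z using Finset.induction_on with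
  | empty => simp [rectIntegral]
  | insert i Z hi ih =>
    simp only [Finset.sum_insert hi]
    rw [rectIntegral_add hab hcd (hf i (Finset.mem_insert_self _ _))
      (continuousOn_finsetSum _ fun j hj => hf j (Finset.mem_insert_of_mem hj)),
      ih fun j hj => hf j (Finset.mem_insert_of_mem hj)]

lemma rectIntegral_eq_zero {f : ℂ → ℂ} (hab : a ≤ b) (hcd : c ≤ d)
    (hf : DifferentiableOn ℂ f (Icc a b ×ℂ Icc c d)) : rectIntegral f a b c d = 0 := by
  have := Complex.integral_boundary_rect_eq_zero_of_differentiableOn f ⟨a, c⟩ ⟨b, d⟩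
    (by simpa [uIcc_of_le hab, uIcc_of_le hcd] using hf)
  simpa [rectIntegral] using this

end

lemma integral_inv_horizontal {a b y : ℝ} {ρ : ℂ} (hy : y ≠ ρ.im) :
    ∫ x : ℝ in a..b, (x + y * I - ρ : ℂ)⁻¹
      = log (b + y * I - ρ) - log (a + y * I - ρ) := by
  have hmem : ∀ x : ℝ, (x + y * I - ρ : ℂ) ∈ slitPlane := fun x => by
    rw [mem_slitPlane_iff]; right; simpa [sub_eq_zero] using hy
  have hne : ∀ x : ℝ, (x + y * I - ρ : ℂ) ≠ 0 := fun x => slitPlane_ne_zero (hmem x)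
  refine intervalIntegral.integral_eq_sub_of_hasDerivAt
    (f := fun x : ℝ => log (x + y * I - ρ)) (fun x _ => ?_) ?_
  · have h : HasDerivAt (fun x : ℝ => (x + y * I - ρ : ℂ)) 1 x :=
      ((hasDerivAt_id x).ofReal_comp.add_const _).sub_const _
    simpa using h.clog_real (hmem x)
  · apply ContinuousOn.intervalIntegrable
    exact ContinuousOn.inv₀ (by fun_prop) fun x _ => hne x

lemma integral_inv_vertical_right {c d x : ℝ} {ρ : ℂ} (hx : ρ.re < x) :
    I * ∫ y : ℝ in c..d, (x + y * I - ρ : ℂ)⁻¹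
      = log (x + d * I - ρ) - log (x + c * I - ρ) := by
  have hmem : ∀ y : ℝ, (x + y * I - ρ : ℂ) ∈ slitPlane := fun y => by
    rw [mem_slitPlane_iff]; left; simpa using hx
  have hne : ∀ y : ℝ, (x + y * I - ρ : ℂ) ≠ 0 := fun x => slitPlane_ne_zero (hmem x)
  rw [← intervalIntegral.integral_const_mul]
  refine intervalIntegral.integral_eq_sub_of_hasDerivAt
    (f := fun y : ℝ => log (x + y * I - ρ)) (fun y _ => ?_) ?_
  · have h : HasDerivAt (fun y : ℝ => (x + y * I - ρ : ℂ)) (1 * I) y :=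
      (((hasDerivAt_id y).ofReal_comp.mul_const I).const_add _).sub_const _
    simpa [div_eq_mul_inv] using h.clog_real (hmem y)
  · apply ContinuousOn.intervalIntegrable
    exact continuousOn_const.mul (ContinuousOn.inv₀ (by fun_prop) fun x _ => hne x)

/-- Left of `ρ` the principal branch of `log (z - ρ)` has its cut, so `log (-(z - ρ))` serves as the
primitive. The discrepancy between the two branches produces the residue. -/
lemma integral_inv_vertical_left {c d x : ℝ} {ρ : ℂ} (hx : x < ρ.re) :
    I * ∫ y : ℝ in c..d, (x + y * I - ρ : ℂ)⁻¹
      = log (-(x + d * I - ρ)) - log (-(x + c * I - ρ)) := by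
  have hmem : ∀ y : ℝ, -(x + y * I - ρ : ℂ) ∈ slitPlane := fun y => by
    rw [mem_slitPlane_iff]; left; simpa using hx
  have hne : ∀ y : ℝ, (x + y * I - ρ : ℂ) ≠ 0 := fun x => neg_ne_zero.1 (slitPlane_ne_zero (hmem x))
  rw [← intervalIntegral.integral_const_mul]
  refine intervalIntegral.integral_eq_sub_of_hasDerivAt
    (f := fun y : ℝ => log (-(x + y * I - ρ))) (fun y _ => ?_) ?_
  · have h : HasDerivAt (fun y : ℝ => -(x + y * I - ρ : ℂ)) (-(1 * I)) y :=
      ((((hasDerivAt_id y).ofReal_comp.mul_const I).const_add _).sub_const _).neg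
    have := h.clog_real (hmem y)
    rwa [neg_div_neg_eq, one_mul, div_eq_mul_inv] at this
  · apply ContinuousOn.intervalIntegrable
    exact continuousOn_const.mul (ContinuousOn.inv₀ (by fun_prop) fun x _ => hne x)

lemma log_sub_log_neg_of_im_pos {w : ℂ} (hw : 0 < w.im) : log w - log (-w) = Real.pi * I := by
  rw [log, log, norm_neg, arg_neg_eq_arg_sub_pi_of_im_pos hw]
  push_cast; ring

lemma log_sub_log_neg_of_im_neg {w : ℂ} (hw : w.im < 0) : log w - log (-w) = -(Real.pi * I) := by
  rw [log, log, norm_neg, arg_neg_eq_arg_add_pi_of_im_neg hw]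
  push_cast; ring

lemma rectIntegral_inv {a b c d : ℝ} {ρ : ℂ} (ha : a < ρ.re) (hb : ρ.re < b) (hc : c < ρ.im)
    (hd : ρ.im < d) : rectIntegral (fun z => (z - ρ)⁻¹) a b c d = 2 * Real.pi * I := by
  unfold rectIntegral
  rw [integral_inv_horizontal hc.ne, integral_inv_horizontal hd.ne',
    integral_inv_vertical_right hb, integral_inv_vertical_left ha]
  -- All logarithms cancel at the right corners. At the left corners the change of branch leaves
  -- `πi` above and `-πi` below, with opposite orientations, hence `2πi`.
  have h1 := log_sub_log_neg_of_im_pos (w := a + d * I - ρ) (by simpa using hd)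
  have h2 := log_sub_log_neg_of_im_neg (w := a + c * I - ρ) (by simpa using hc)
  linear_combination h1 - h2

lemma not_mem_rectBoundary {a b c d : ℝ} {ρ : ℂ} (ha : a < ρ.re) (hb : ρ.re < b) (hc : c < ρ.im)
    (hd : ρ.im < d) : ρ ∉ rectBoundary a b c d := by
  rintro (⟨-, h | h⟩ | ⟨-, h | h⟩) <;> linarith

lemma rectBoundary_subset {a b c d : ℝ} (hab : a ≤ b) (hcd : c ≤ d) :
    rectBoundary a b c d ⊆ Icc a b ×ℂ Icc c d := by
  rintro z (⟨h1, h | h⟩ | ⟨h1, h | h⟩) <;> rw [mem_reProdIm, h] <;> simp [h1, hab, hcd]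

/-- The residue theorem for `φ f' / f` on a rectangle, where `φ` is entire. -/
lemma rectIntegral_mul_logDeriv {a b c d : ℝ} (hab : a ≤ b) (hcd : c ≤ d) {U : Set ℂ}
    (hU : IsOpen U) {f φ : ℂ → ℂ} (hf : DifferentiableOn ℂ f U) (hφ : Differentiable ℂ φ)
    (hRU : Icc a b ×ℂ Icc c d ⊆ U) (Z : Finset ℂ)
    (hZ : ∀ z, z ∈ Z ↔ z ∈ Icc a b ×ℂ Icc c d ∧ f z = 0)
    (hZint : ∀ ρ ∈ Z, (a < ρ.re ∧ ρ.re < b) ∧ c < ρ.im ∧ ρ.im < d)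
    (ho : ∀ ρ ∈ Z, analyticOrderAt f ρ ≠ ⊤) :
    rectIntegral (fun z => φ z * (deriv f z / f z)) a b c d
      = 2 * Real.pi * I * ∑ ρ ∈ Z, (analyticOrderNatAt f ρ : ℂ) * φ ρ := by
  obtain ⟨g, hg, hfg, hgZ⟩ := exists_factorization hU hf Z
    (fun ρ hρ => hRU ((hZ ρ).1 hρ).1) ho
  have hg0 : ∀ z ∈ Icc a b ×ℂ Icc c d, g z ≠ 0 := by
    intro z hz h0
    by_cases hzZ : z ∈ Z
    · exact hgZ z hzZ h0
    · exact hzZ ((hZ z).2 ⟨hz, by rw [hfg, h0, mul_zero]⟩)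
  have hbd : ∀ ρ ∈ Z, ρ ∉ rectBoundary a b c d := fun ρ hρ =>
    not_mem_rectBoundary (hZint ρ hρ).1.1 (hZint ρ hρ).1.2 (hZint ρ hρ).2.1 (hZint ρ hρ).2.2
  set m := fun ρ => analyticOrderNatAt f ρ
  -- Writing `φ z / (z - ρ) = φ ρ / (z - ρ) + dslope φ ρ z` separates the simple poles from a
  -- holomorphic remainder, which integrates to zero.
  set h : ℂ → ℂ := fun z => (∑ ρ ∈ Z, (m ρ : ℂ) * dslope φ ρ z) + φ z * (deriv g z / g z) with hh
  have hhd : DifferentiableOn ℂ h (Icc a b ×ℂ Icc c d) := by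
    refine DifferentiableOn.add (DifferentiableOn.fun_sum fun ρ _ => ?_) ?_
    · refine DifferentiableOn.const_mul ?_ _
      exact ((Complex.differentiableOn_dslope (univ_mem)).2 hφ.differentiableOn).mono
        (subset_univ _)
    · exact hφ.differentiableOn.mul (((hg.deriv hU).mono hRU).div (hg.mono hRU) hg0)
  have hinv : ∀ ρ ∈ Z, ContinuousOn (fun z : ℂ => ((m ρ : ℂ) * φ ρ) * (z - ρ)⁻¹)
      (rectBoundary a b c d) := fun ρ hρ =>
    continuousOn_const.mul (ContinuousOn.inv₀ (by fun_prop) fun z hz =>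
      sub_ne_zero.2 fun he => hbd ρ hρ (he ▸ hz))
  have hsub := rectBoundary_subset (a := a) (b := b) hab hcd
  rw [rectIntegral_congr hab hcd
    (g := fun z => h z + ∑ ρ ∈ Z, ((m ρ : ℂ) * φ ρ) * (z - ρ)⁻¹),
    rectIntegral_add hab hcd (hhd.continuousOn.mono hsub) (continuousOn_finsetSum _ hinv),
    rectIntegral_eq_zero hab hcd hhd, zero_add, rectIntegral_sum Z hab hcd hinv, Finset.mul_sum]
  · refine Finset.sum_congr rfl fun ρ hρ => ?_
    rw [rectIntegral_const_mul, rectIntegral_inv (hZint ρ hρ).1.1 (hZint ρ hρ).1.2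
      (hZint ρ hρ).2.1 (hZint ρ hρ).2.2]
    ring
  · intro z hz
    have hzρ : ∀ ρ ∈ Z, z ≠ ρ := fun ρ hρ he => hbd ρ hρ (he ▸ hz)
    rw [logDeriv_of_factorization hfg (hg.differentiableAt (hU.mem_nhds (hRU (hsub hz)))) hzρ
      (hg0 z (hsub hz)), hh]
    simp only [mul_add, Finset.mul_sum]
    rw [add_right_comm, ← Finset.sum_add_distrib]
    congr 1
    refine Finset.sum_congr rfl fun ρ hρ => ?_
    rw [dslope_of_ne _ (hzρ ρ hρ), slope_def_field]
    ring

/-! ### Local partial fraction decomposition of the logarithmic derivative -/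

/-- A holomorphic function without zeros on a disc of radius `R` and bounded by `exp M * ‖g c‖`
has a logarithmic derivative of size `O(M / R)` on the concentric disc of radius `R / 2`. -/
lemma norm_logDeriv_le_of_ne_zero {g : ℂ → ℂ} {c : ℂ} {R M : ℝ} (hR : 0 < R) (hM : 0 < M)
    (hg : DifferentiableOn ℂ g (ball c R)) (h0 : ∀ z ∈ ball c R, g z ≠ 0)
    (hb : ∀ z ∈ ball c R, ‖g z‖ ≤ Real.exp M * ‖g c‖) {s : ℂ} (hs : s ∈ closedBall c (R / 2)) :
    ‖deriv g s / g s‖ ≤ 24 * M / R := by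
  have hcR : c ∈ ball c R := mem_ball_self hR
  -- A primitive of `g' / g` vanishing at `c`; it is a branch of `log (g / g c)`, so the bound on
  -- `g` says `Re h ≤ M`.
  obtain ⟨h, hhc, hh⟩ := (((hg.deriv isOpen_ball).div hg h0).isExactOn_ball).with_val_at c 0
  have hexp : ∀ z ∈ ball c R, g z = g c * exp (h z) := by
    have hd : ∀ z ∈ ball c R, HasDerivAt (fun z => exp (-h z) * g z) 0 z := by
      intro z hz
      have h1 := ((hh z hz).neg.cexp).mul
        (hg.differentiableAt (isOpen_ball.mem_nhds hz)).hasDerivAt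
      refine h1.congr_deriv ?_
      have := h0 z hz
      simp only [Pi.div_apply, Pi.neg_apply]
      field_simp
      ring
    have hconst : ∀ z ∈ ball c R, exp (-h z) * g z = exp (-h c) * g c := by
      intro z hz
      refine (convex_ball c R).is_const_of_fderivWithin_eq_zero (𝕜 := ℂ)
        (f := fun z => exp (-h z) * g z)
        (fun w hw => (hd w hw).differentiableAt.differentiableWithinAt) (fun w hw => ?_) hz hcR
      rw [fderivWithin_of_isOpen isOpen_ball hw, (hd w hw).hasFDerivAt.fderiv]
      simp
    intro z hz
    have := hconst z hz
    rw [hhc, neg_zero, exp_zero, one_mul] at this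
    rw [← this, mul_right_comm, ← exp_add, neg_add_cancel, exp_zero, one_mul]
  have hre : ∀ z ∈ ball c R, (h z).re ≤ M := by
    intro z hz
    have h1 := hb z hz
    rw [hexp z hz, norm_mul, norm_exp, mul_comm] at h1
    have h2 : 0 < ‖g c‖ := norm_pos_iff.2 (h0 c hcR)
    exact Real.exp_le_exp.1 (le_of_mul_le_mul_right h1 h2)
  have hdiff : DifferentiableOn ℂ h (ball c R) := fun z hz =>
    (hh z hz).differentiableAt.differentiableWithinAt
  have hsub : ∀ z, z ∈ ball (0 : ℂ) R → c + z ∈ ball c R := fun z hz => by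
    simpa [dist_eq_norm] using hz
  -- Borel–Carathéodory on radius `3R/4` inside `R` gives `2M * (3R/4) / (R/4) = 6M`. Cauchy's
  -- estimate on circles of radius `R/4` then gives `24M / R`.
  have hbound : ∀ z ∈ closedBall c (3 * R / 4), ‖h z‖ ≤ 6 * M := by
    intro z hz
    have hz' : ‖z - c‖ ≤ 3 * R / 4 := by simpa [dist_eq_norm] using hz
    have := Complex.borelCaratheodory_zero (f := fun w => h (c + w)) (z := z - c) hM
      (hdiff.comp (by fun_prop) hsub) (fun w hw => hre _ (hsub w hw)) hR
      (by rw [mem_ball_zero_iff]; linarith) (by simpa using hhc)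
    simp only [add_sub_cancel] at this
    refine this.trans ?_
    rw [div_le_iff₀ (by linarith)]
    nlinarith
  have hsR : s ∈ ball c R := closedBall_subset_ball (by linarith) hs
  have hs' : deriv h s = deriv g s / g s := (hh s hsR).deriv
  rw [← hs']
  have hball : closedBall s (R / 4) ⊆ closedBall c (3 * R / 4) := by
    apply closedBall_subset_closedBall'
    have := mem_closedBall.1 hs
    linarith
  refine (norm_deriv_le_of_forall_mem_sphere_norm_le (C := 6 * M) (by positivity : 0 < R / 4)
    ?_ fun z hz => hbound z (hball (sphere_subset_closedBall hz))).trans (le_of_eq ?_)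
  · apply DifferentiableOn.diffContOnCl
    rw [closure_ball _ (by positivity)]
    exact hdiff.mono (hball.trans (closedBall_subset_ball (by linarith)))
  · field_simp
    norm_num

/-- Divide `f` by its zeros in the disc of radius `2r`. On the circle of radius `6r` each factor is
at least `4r`, while at the centre it is at most `2r`, so by the maximum principle the quotient
gains a factor `2` per zero over the bound for `f`. At the centre this limits the number of zeros;
on the disc of radius `2r` it allows the bound for zero-free functions to be applied to the
quotient. -/
lemma exists_local_zeros {f : ℂ → ℂ} {c : ℂ} {r M : ℝ} (hr : 0 < r) (hM : 0 < M)
    (hf : DifferentiableOn ℂ f (ball c (7 * r))) (hfc : f c ≠ 0)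
    (hb : ∀ z ∈ closedBall c (6 * r), ‖f z‖ ≤ Real.exp M * ‖f c‖) :
    ∃ Z : Finset ℂ, (∀ z, z ∈ Z ↔ z ∈ closedBall c (2 * r) ∧ f z = 0) ∧
      (∑ ρ ∈ Z, (analyticOrderNatAt f ρ : ℝ) ≤ 2 * M) ∧
      ∀ s ∈ closedBall c r, f s ≠ 0 →
        ‖deriv f s / f s - ∑ ρ ∈ Z, (analyticOrderNatAt f ρ : ℂ) / (s - ρ)‖ ≤ 12 * M / r := by
  have hc7 : c ∈ ball c (7 * r) := mem_ball_self (by positivity)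
  have hpre : IsPreconnected (ball c (7 * r)) := (convex_ball _ _).isPreconnected
  have hfin := finite_zeros_of_isCompact isOpen_ball hpre hf hc7 hfc
    (isCompact_closedBall c (2 * r)) (closedBall_subset_ball (by linarith))
  have hZ : ∀ z, z ∈ hfin.toFinset ↔ z ∈ closedBall c (2 * r) ∧ f z = 0 := fun z => by simp
  set Z := hfin.toFinset
  have hZ2 : ∀ ρ ∈ Z, ‖c - ρ‖ ≤ 2 * r := fun ρ hρ => by
    have := ((hZ ρ).1 hρ).1
    rwa [mem_closedBall, dist_comm, dist_eq_norm] at this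
  have hZU : ∀ ρ ∈ Z, ρ ∈ ball c (7 * r) := fun ρ hρ =>
    closedBall_subset_ball (by linarith) ((hZ ρ).1 hρ).1
  obtain ⟨g, hg, hfg, hgZ⟩ := exists_factorization isOpen_ball hf Z hZU
    fun ρ hρ => analyticOrderAt_ne_top_of_ne_zero isOpen_ball hpre hf hc7 hfc (hZU ρ hρ)
  set m := fun ρ => analyticOrderNatAt f ρ
  set n := ∑ ρ ∈ Z, m ρ with hn
  have hgc : g c ≠ 0 := fun h => hfc (by rw [hfg, h, mul_zero])
  have hg0 : ∀ z ∈ closedBall c (2 * r), g z ≠ 0 := by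
    intro z hz h0
    have : z ∈ Z := (hZ z).2 ⟨hz, by rw [hfg, h0, mul_zero]⟩
    exact hgZ z this h0
  have hgc' : ‖f c‖ ≤ (2 * r) ^ n * ‖g c‖ := by
    rw [hfg c, norm_mul, norm_prod, hn, ← Finset.prod_pow_eq_pow_sum]
    gcongr with ρ hρ
    rw [norm_pow]
    gcongr
    exact hZ2 ρ hρ
  have hgbound : ∀ z ∈ closedBall c (6 * r), ‖g z‖ ≤ Real.exp M * ‖g c‖ / 2 ^ n := by
    intro z hz
    have hsub : closure (ball c (6 * r)) = closedBall c (6 * r) := closure_ball _ (by positivity)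
    refine norm_le_of_forall_mem_frontier_norm_le (isBounded_ball (x := c) (r := 6 * r)) ?_ ?_
      (by rwa [hsub])
    · apply DifferentiableOn.diffContOnCl
      rw [hsub]
      exact hg.mono (closedBall_subset_ball (by linarith))
    · intro w hw
      rw [frontier_ball _ (by positivity)] at hw
      have h1 : (4 * r) ^ n * ‖g w‖ ≤ ‖f w‖ := by
        rw [hfg w, norm_mul, norm_prod, hn, ← Finset.prod_pow_eq_pow_sum]
        gcongr with ρ hρ
        rw [norm_pow]
        gcongr
        have h2 := hZ2 ρ hρ
        have h3 : ‖w - c‖ = 6 * r := by simpa [dist_eq_norm] using hw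
        have h4 := norm_sub_norm_le (w - c) (ρ - c)
        rw [sub_sub_sub_cancel_right, h3, norm_sub_rev ρ c] at h4
        linarith
      have h5 : (4 * r) ^ n * ‖g w‖ ≤ Real.exp M * ((2 * r) ^ n * ‖g c‖) :=
        h1.trans ((hb w (sphere_subset_closedBall hw)).trans (by gcongr))
      rw [le_div_iff₀ (by positivity)]
      have h6 : (4 * r) ^ n = (2 * r) ^ n * 2 ^ n := by rw [← mul_pow]; ring
      rw [h6] at h5
      have h7 : 0 < (2 * r) ^ n := by positivity
      nlinarith
  have hgcpos : 0 < ‖g c‖ := norm_pos_iff.2 hgc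
  refine ⟨Z, hZ, ?_, ?_⟩
  -- At the centre the bound reads `2 ^ n ≤ exp M`, and `log 2 > 1/2` turns this into `n ≤ 2M`.
  · have h1 := hgbound c (mem_closedBall_self (by positivity))
    rw [le_div_iff₀ (by positivity), mul_comm] at h1
    have h2 : (2 : ℝ) ^ n ≤ Real.exp M := le_of_mul_le_mul_right h1 hgcpos
    have h3 := Real.log_le_log (by positivity) h2
    rw [Real.log_exp, Real.log_pow] at h3
    have h4 := Real.log_two_gt_d9
    have h5 : (∑ ρ ∈ Z, (m ρ : ℝ)) = (n : ℝ) := by rw [hn]; push_cast; rfl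
    rw [h5]
    have h6 : (0 : ℝ) ≤ n := Nat.cast_nonneg _
    nlinarith
  · intro s hs hfs
    have hs7 : s ∈ ball c (7 * r) := closedBall_subset_ball (by linarith) hs
    have hsρ : ∀ ρ ∈ Z, s ≠ ρ := by
      rintro ρ hρ rfl
      exact hfs ((hZ s).1 hρ).2
    rw [logDeriv_of_factorization hfg (hg.differentiableAt (isOpen_ball.mem_nhds hs7)) hsρ
      (hg0 s (closedBall_subset_closedBall (by linarith) hs)), add_sub_cancel_left]
    have := norm_logDeriv_le_of_ne_zero (g := g) (c := c) (R := 2 * r) (by positivity) hM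
      (hg.mono (ball_subset_ball (by linarith))) (fun z hz => hg0 z (ball_subset_closedBall hz))
      (fun z hz => (hgbound z (ball_subset_closedBall (ball_subset_ball (by linarith) hz))).trans
        (div_le_self (by positivity) (one_le_pow₀ (by norm_num))))
      (s := s) (by simpa using hs)
    refine this.trans (le_of_eq ?_)
    field_simp
    norm_num

/-! ### Horizontal segments avoiding the zeros -/

lemma intervalIntegrable_abs_rpow (a b v : ℝ) :
    IntervalIntegrable (fun x : ℝ => |x - v| ^ (-(1 / 2) : ℝ)) MeasureTheory.volume a b := by
  have h : IntervalIntegrable (fun x : ℝ => |x| ^ (-(1 / 2) : ℝ)) MeasureTheory.volume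
      (a - v) (b - v) := by
    have hpos : ∀ c : ℝ, 0 ≤ c → IntervalIntegrable (fun x : ℝ => |x| ^ (-(1 / 2) : ℝ))
        MeasureTheory.volume 0 c := fun c hc => by
      refine (intervalIntegral.intervalIntegrable_rpow' (a := 0) (b := c)
        (by norm_num : (-1 : ℝ) < -(1 / 2))).congr ?_
      intro x hx
      rw [uIoc_of_le hc] at hx
      simp [abs_of_pos hx.1]
    have hall : ∀ c : ℝ, IntervalIntegrable (fun x : ℝ => |x| ^ (-(1 / 2) : ℝ))
        MeasureTheory.volume 0 c := fun c => by
      rcases le_total 0 c with hc | hc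
      · exact hpos c hc
      · have := (hpos (-c) (by linarith)).comp_mul_left (c := -1)
        simpa using this
    exact (hall _).symm.trans (hall _)
  simpa using h.comp_sub_right v

lemma integral_abs_rpow_le {a b v N : ℝ} (hab : a ≤ b) (ha : v - N ≤ a) (hb : b ≤ v + N) :
    ∫ x in a..b, |x - v| ^ (-(1 / 2) : ℝ) ≤ 4 * N ^ (1 / 2 : ℝ) := by
  have hN : 0 ≤ N := by linarith
  have h1 : ∫ x in a..b, |x - v| ^ (-(1 / 2) : ℝ)
      ≤ ∫ x in (v - N)..(v + N), |x - v| ^ (-(1 / 2) : ℝ) :=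
    intervalIntegral.integral_mono_interval ha hab hb
      (Eventually.of_forall fun x => by positivity) (intervalIntegrable_abs_rpow _ _ _)
  have h2 : ∫ x in (0:ℝ)..N, |x| ^ (-(1 / 2) : ℝ) = 2 * N ^ (1 / 2 : ℝ) := by
    rw [intervalIntegral.integral_congr (g := fun x : ℝ => x ^ (-(1 / 2) : ℝ)),
      integral_rpow (Or.inl (by norm_num))]
    · norm_num
      ring
    · intro x hx
      rw [uIcc_of_le hN] at hx
      simp [abs_of_nonneg hx.1]
  have h3 : ∫ x in (-N)..0, |x| ^ (-(1 / 2) : ℝ) = 2 * N ^ (1 / 2 : ℝ) := by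
    rw [← h2]
    have := intervalIntegral.integral_comp_neg (a := 0) (b := N)
      (fun x : ℝ => |x| ^ (-(1 / 2) : ℝ))
    simpa using this.symm
  refine h1.trans (le_of_eq ?_)
  rw [intervalIntegral.integral_comp_sub_right (fun x : ℝ => |x| ^ (-(1 / 2) : ℝ)) v]
  have hi : ∀ p q : ℝ, IntervalIntegrable (fun x : ℝ => |x| ^ (-(1 / 2) : ℝ))
      MeasureTheory.volume p q := fun p q => by simpa using intervalIntegrable_abs_rpow p q 0
  rw [← intervalIntegral.integral_add_adjacent_intervals (b := 0) (hi _ _) (hi _ _)]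
  simp only [sub_sub_cancel_left, add_sub_cancel_left]
  rw [h2, h3]; ring

/-- Comes from `|z|² ≥ |Re z| |Im z|`. Unlike `1 / |z|` on the real line, each inverse square root
is integrable through its singularity, and the two variables separate. -/
lemma norm_inv_le_abs_rpow_mul {z : ℂ} (hz : z.im ≠ 0) (hz' : z.re ≠ 0) :
    ‖z⁻¹‖ ≤ |z.re| ^ (-(1 / 2) : ℝ) * |z.im| ^ (-(1 / 2) : ℝ) := by
  have h1 : 0 < |z.re| := abs_pos.2 hz'
  have h2 : 0 < |z.im| := abs_pos.2 hz
  rw [← Real.mul_rpow h1.le h2.le, Real.rpow_neg (by positivity), norm_inv]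
  refine inv_anti₀ (by positivity) ?_
  rw [← Real.sqrt_eq_rpow]
  refine Real.sqrt_le_iff.2 ⟨norm_nonneg _, ?_⟩
  have := abs_re_le_norm z
  have := abs_im_le_norm z
  nlinarith

/-- A mean value argument: each term has integral at most `4 * N ^ (1/2)` over `[T, T + 1]`, so some
height is no worse than average. The heights of the zeros form a null set and can be avoided. The
bound `N - 1` ensures that the whole interval lies within `N` of every `ρ.im`. -/
lemma exists_height {Z : Finset ℂ} (m : ℂ → ℕ) {T N : ℝ} (hZ : ∀ ρ ∈ Z, |ρ.im - T| ≤ N - 1) :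
    ∃ T' ∈ Icc T (T + 1), (∀ ρ ∈ Z, ρ.im ≠ T') ∧
      ∑ ρ ∈ Z, m ρ * |T' - ρ.im| ^ (-(1 / 2) : ℝ)
        ≤ 4 * N ^ (1 / 2 : ℝ) * ∑ ρ ∈ Z, (m ρ : ℝ) := by
  set h : ℝ → ℝ := fun t => ∑ ρ ∈ Z, m ρ * |t - ρ.im| ^ (-(1 / 2) : ℝ)
  have hint : ∀ ρ : ℂ, IntervalIntegrable (fun t : ℝ => m ρ * |t - ρ.im| ^ (-(1 / 2) : ℝ))
      MeasureTheory.volume T (T + 1) := fun ρ =>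
    (intervalIntegrable_abs_rpow T (T + 1) ρ.im).const_mul _
  have hI : IntervalIntegrable h MeasureTheory.volume T (T + 1) := by
    have := IntervalIntegrable.sum (μ := MeasureTheory.volume) (a := T) (b := T + 1) Z
      (f := fun ρ t => m ρ * |t - ρ.im| ^ (-(1 / 2) : ℝ)) (fun ρ _ => hint ρ)
    convert! this using 1
    ext t; simp [h]
  have hle : ∫ t in T..(T + 1), h t ≤ 4 * N ^ (1 / 2 : ℝ) * ∑ ρ ∈ Z, (m ρ : ℝ) := by
    rw [intervalIntegral.integral_finsetSum fun ρ _ => hint ρ, Finset.mul_sum]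
    refine Finset.sum_le_sum fun ρ hρ => ?_
    rw [intervalIntegral.integral_const_mul, mul_comm]
    have := abs_le.1 (hZ ρ hρ)
    gcongr
    exact integral_abs_rpow_le (by linarith) (by linarith) (by linarith)
  set μ := MeasureTheory.volume.restrict (Ioc T (T + 1))
  have hprob : MeasureTheory.IsProbabilityMeasure μ := ⟨by simp [μ]⟩
  set S : Set ℝ := (Z.image Complex.im : Finset ℝ) ∪ (Ioc T (T + 1))ᶜ
  have hS : μ S = 0 := by
    refine MeasureTheory.measure_union_null ?_ ?_
    · exact (Finset.finite_toSet _).measure_zero μ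
    · simp [μ, MeasureTheory.Measure.restrict_apply measurableSet_Ioc.compl]
  have hIμ : MeasureTheory.Integrable h μ :=
    (intervalIntegrable_iff_integrableOn_Ioc_of_le (by linarith)).1 hI
  obtain ⟨T', hT', hT'le⟩ := MeasureTheory.exists_notMem_null_le_integral hIμ hS
  simp only [S, mem_union, not_or, mem_compl_iff, not_not] at hT'
  refine ⟨T', Ioc_subset_Icc_self hT'.2, fun ρ hρ he => hT'.1 ?_, hT'le.trans ?_⟩
  · simpa using ⟨ρ, hρ, he⟩
  · rwa [intervalIntegral.integral_of_le (by linarith)] at hle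

lemma norm_integral_horizontal_le {Z : Finset ℂ} (m : ℂ → ℕ) {G φ : ℝ → ℂ} {a b y K Φ N : ℝ}
    (hab : a ≤ b) (hZ : ∀ ρ ∈ Z, ρ.im ≠ y) (hZN : ∀ ρ ∈ Z, ρ.re - N ≤ a ∧ b ≤ ρ.re + N)
    (hK : ∀ σ ∈ Icc a b, ‖G σ - ∑ ρ ∈ Z, (m ρ : ℂ) / (σ + y * I - ρ)‖ ≤ K)
    (hφ : ∀ σ ∈ Icc a b, ‖φ σ‖ ≤ Φ) :
    ‖∫ σ in a..b, φ σ * G σ‖ ≤ Φ * (K * (b - a) +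
      4 * N ^ (1 / 2 : ℝ) * ∑ ρ ∈ Z, m ρ * |y - ρ.im| ^ (-(1 / 2) : ℝ)) := by
  have hΦ : 0 ≤ Φ := (norm_nonneg _).trans (hφ a (left_mem_Icc.2 hab))
  have hint : ∀ ρ : ℂ, IntervalIntegrable
      (fun σ : ℝ => m ρ * |y - ρ.im| ^ (-(1 / 2) : ℝ) * |σ - ρ.re| ^ (-(1 / 2) : ℝ))
      MeasureTheory.volume a b := fun ρ => (intervalIntegrable_abs_rpow a b ρ.re).const_mul _
  have hI : IntervalIntegrable (fun σ : ℝ => ∑ ρ ∈ Z,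
      m ρ * |y - ρ.im| ^ (-(1 / 2) : ℝ) * |σ - ρ.re| ^ (-(1 / 2) : ℝ))
      MeasureTheory.volume a b := by
    have := IntervalIntegrable.sum (μ := MeasureTheory.volume) (a := a) (b := b) Z
      (f := fun ρ σ => m ρ * |y - ρ.im| ^ (-(1 / 2) : ℝ) * |σ - ρ.re| ^ (-(1 / 2) : ℝ))
      (fun ρ _ => hint ρ)
    convert! this using 1
    ext t; simp
  -- At `σ = ρ.re` the real power `0 ^ (-1/2)` takes the default value `0` and the pointwise bound
  -- breaks down, so finitely many abscissas are discarded.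
  have hnull : ∀ᵐ σ : ℝ, σ ∉ (Z.image Complex.re : Finset ℝ) :=
    MeasureTheory.measure_eq_zero_iff_ae_notMem.1
      ((Finset.finite_toSet (Z.image Complex.re)).measure_zero _)
  refine (intervalIntegral.norm_integral_le_of_norm_le (g := fun σ => Φ * (K + ∑ ρ ∈ Z,
      m ρ * |y - ρ.im| ^ (-(1 / 2) : ℝ) * |σ - ρ.re| ^ (-(1 / 2) : ℝ))) hab ?_ ?_).trans ?_
  · filter_upwards [hnull] with σ hσ hσab
    have hσ' := Ioc_subset_Icc_self hσab
    rw [norm_mul]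
    gcongr
    · exact hφ σ hσ'
    · calc ‖G σ‖ ≤ ‖G σ - ∑ ρ ∈ Z, (m ρ : ℂ) / (σ + y * I - ρ)‖
            + ‖∑ ρ ∈ Z, (m ρ : ℂ) / (σ + y * I - ρ)‖ := by
              simpa using norm_add_le (G σ - ∑ ρ ∈ Z, (m ρ : ℂ) / (σ + y * I - ρ))
                (∑ ρ ∈ Z, (m ρ : ℂ) / (σ + y * I - ρ))
        _ ≤ _ := by
          refine add_le_add (hK σ hσ') ((norm_sum_le _ _).trans (Finset.sum_le_sum fun ρ hρ => ?_))
          have h1 := norm_inv_le_abs_rpow_mul (z := σ + y * I - ρ)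
            (by simpa [sub_eq_zero] using (hZ ρ hρ).symm)
            (by
              simp only [sub_re, add_re, ofReal_re, mul_re, I_re, mul_zero, ofReal_im, I_im,
                mul_one, sub_self, add_zero, ne_eq, sub_eq_zero]
              rintro rfl
              exact hσ (by simpa using ⟨ρ, hρ, rfl⟩))
          rw [div_eq_mul_inv, norm_mul, Complex.norm_natCast, mul_assoc]
          refine mul_le_mul_of_nonneg_left ?_ (Nat.cast_nonneg _)
          simpa [mul_comm] using h1
  · exact (intervalIntegrable_const.add hI).const_mul _
  · rw [intervalIntegral.integral_const_mul,
      intervalIntegral.integral_add intervalIntegrable_const hI, intervalIntegral.integral_const,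
      intervalIntegral.integral_finsetSum fun ρ _ => hint ρ, Finset.mul_sum]
    refine mul_le_mul_of_nonneg_left (add_le_add (le_of_eq ?_) (Finset.sum_le_sum fun ρ hρ => ?_))
      hΦ
    · rw [smul_eq_mul, mul_comm]
    · rw [intervalIntegral.integral_const_mul, mul_comm]
      gcongr
      exact integral_abs_rpow_le hab (hZN ρ hρ).1 (hZN ρ hρ).2

/-! ### Termwise integration of a general Dirichlet series along a vertical segment -/

lemma integral_exp_mul_I_bound {u v lam δ : ℝ} (hδ : 0 < δ) (hlam : δ ≤ |lam|) :
    ‖∫ y in u..v, exp (lam * I * y)‖ ≤ 2 / δ := by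
  have hne : (lam * I : ℂ) ≠ 0 := by
    have : lam ≠ 0 := abs_pos.1 (hδ.trans_le hlam)
    simp [this]
  rw [integral_exp_mul_complex hne, norm_div]
  have h1 : ∀ w : ℝ, ‖exp (lam * I * w)‖ = 1 := fun w => by
    rw [norm_exp]; simp
  have h2 : ‖(lam * I : ℂ)‖ = |lam| := by simp
  rw [h2]
  gcongr
  refine (norm_sub_le _ _).trans ?_
  rw [h1, h1]; norm_num

/-- On the line `Re s = B` the `i`-th term times `x ^ s` is a constant times `exp (i y log (x / N
i))`. It is constant in `y` when `N i = x`; otherwise its integral is at most `2 / δ` times its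
modulus, whatever the length of the segment. Absolute convergence permits summing these bounds. -/
lemma norm_integral_dirichlet_sub_le {ι : Type*} [Countable ι] {w : ι → ℂ} {N : ι → ℝ}
    {x B δ : ℝ} (hx : 0 < x) (hN : ∀ i, 0 < N i) (hδ : 0 < δ)
    (hsum : Summable fun i => ‖w i‖ * N i ^ (-B))
    (hsep : ∀ i, w i ≠ 0 → N i ≠ x → δ ≤ |Real.log (x / N i)|) {D : ℂ → ℂ}
    (hD : ∀ t : ℝ, HasSum (fun i => w i * (N i : ℂ) ^ (-(B + t * I : ℂ))) (D (B + t * I)))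
    (u v : ℝ) :
    ‖(∫ y in u..v, (x : ℂ) ^ (B + y * I : ℂ) * D (B + y * I))
        - (v - u) * ∑' i, if N i = x then w i else 0‖
      ≤ 2 / δ * x ^ B * ∑' i, ‖w i‖ * N i ^ (-B) := by
  set F : ι → ℝ → ℂ := fun i y =>
    w i * (N i : ℂ) ^ (-(B + y * I : ℂ)) * (x : ℂ) ^ (B + y * I : ℂ) with hF
  have hFeq : ∀ i y, F i y = (w i * ((x / N i) ^ B : ℝ)) * exp (Real.log (x / N i) * I * y) := by
    intro i y
    have hx0 : (x : ℂ) ≠ 0 := by exact_mod_cast hx.ne'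
    have hN0 : (N i : ℂ) ≠ 0 := by exact_mod_cast (hN i).ne'
    simp only [hF]
    rw [cpow_def_of_ne_zero hx0, cpow_def_of_ne_zero hN0, Real.rpow_def_of_pos (div_pos hx (hN i)),
      mul_assoc, ← exp_add, ofReal_exp, mul_assoc, ← exp_add, ← ofReal_log hx.le,
      ← ofReal_log (hN i).le, Real.log_div hx.ne' (hN i).ne']
    congr 2
    push_cast; ring
  have hnorm : ∀ i y, ‖F i y‖ = x ^ B * (‖w i‖ * N i ^ (-B)) := by
    intro i y
    simp only [hF]
    rw [norm_mul, norm_mul, norm_cpow_eq_rpow_re_of_pos hx, norm_cpow_eq_rpow_re_of_pos (hN i)]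
    simp [mul_comm]
  have hFc : ∀ i, Continuous (F i) := fun i => by
    rw [show F i = _ from funext (hFeq i)]
    fun_prop
  have hFsum := intervalIntegral.hasSum_integral_of_dominated_convergence (a := u) (b := v)
    (μ := MeasureTheory.volume) (F := F) (f := fun y => (x : ℂ) ^ (B + y * I : ℂ) * D (B + y * I))
    (fun i _ => x ^ B * (‖w i‖ * N i ^ (-B)))
    (fun i => (hFc i).aestronglyMeasurable)
    (fun i => Eventually.of_forall fun y _ => (hnorm i y).le)
    (Eventually.of_forall fun y _ => hsum.mul_left _)
    (by simp)
    (Eventually.of_forall fun y _ => by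
      have := (hD y).mul_right ((x : ℂ) ^ (B + y * I : ℂ))
      rwa [mul_comm (D _)] at this)
  have hα : Summable fun i => if N i = x then w i else 0 := by
    refine Summable.of_norm_bounded (hsum.mul_left (x ^ B)) fun i => ?_
    split_ifs with h
    · rw [h, mul_comm ‖w i‖, ← mul_assoc, ← Real.rpow_add hx]; simp
    · rw [norm_zero]
      have := hN i
      positivity
  have hdiff := hFsum.sub (hα.hasSum.mul_left ((v : ℂ) - u))
  rw [← hdiff.tsum_eq]
  refine (tsum_of_norm_bounded (hsum.hasSum.mul_left (2 / δ * x ^ B)) fun i => ?_)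
  have hpos : 0 ≤ 2 / δ * x ^ B * (‖w i‖ * N i ^ (-B)) := by
    have := hN i
    positivity
  by_cases hw : w i = 0
  · simp [hw, hF]
  · by_cases h : N i = x
    · have : ∀ y, F i y = w i := fun y => by rw [hFeq, h, div_self hx.ne']; simp
      simp only [this, h, if_true]
      simpa [h] using hpos
    · simp only [hFeq, if_neg h, mul_zero, sub_zero]
      rw [intervalIntegral.integral_const_mul, norm_mul]
      have h1 : ‖w i * (((x / N i) ^ B : ℝ) : ℂ)‖ = x ^ B * (‖w i‖ * N i ^ (-B)) := by
        rw [norm_mul, norm_real, Real.norm_of_nonneg (by have := hN i; positivity),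
          Real.div_rpow hx.le (hN i).le, Real.rpow_neg (hN i).le]
        ring
      rw [h1]
      have h2 := integral_exp_mul_I_bound (u := u) (v := v) hδ (hsep i hw h)
      have h3 : 0 ≤ x ^ B * (‖w i‖ * N i ^ (-B)) := by
        have := hN i
        positivity
      calc _ ≤ x ^ B * (‖w i‖ * N i ^ (-B)) * (2 / δ) := mul_le_mul_of_nonneg_left h2 h3
        _ = _ := by ring

/-! ### A Landau type formula for functions of polynomial growth -/

/-- Hypotheses on a function holomorphic away from `1` under which sums of `x ^ ρ` over its zeros
in the upper half-plane can be evaluated by a contour integral. -/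
structure LandauHypotheses (f : ℂ → ℂ) (A B C : ℝ) : Prop where
  diff : DifferentiableOn ℂ f {1}ᶜ
  one_le_left : 1 ≤ A
  two_le_right : 2 ≤ B
  pos : 0 < C
  left_ne_zero : ∀ s : ℂ, s.re ≤ -A → 1 ≤ s.im → f s ≠ 0
  left_logDeriv_le : ∀ s : ℂ, s.re ≤ -A → 1 ≤ s.im →
    ‖deriv f s / f s‖ ≤ C * Real.log (2 + ‖s‖)
  right_ne_zero : ∀ s : ℂ, B ≤ s.re → f s ≠ 0
  right_lower : ∃ c₀ > 0, ∀ t : ℝ, c₀ ≤ ‖f (B + t * I)‖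
  growth : ∀ E : ℝ, ∃ D : ℕ, ∀ s : ℂ, 1 ≤ s.im → |s.re| ≤ E → ‖f s‖ ≤ D * s.im ^ D

namespace LandauHypotheses

variable {f : ℂ → ℂ} {A B C : ℝ}

lemma isPreconnected_compl_one : IsPreconnected ({1}ᶜ : Set ℂ) :=
  (isConnected_compl_singleton_of_one_lt_rank (by simp) (1 : ℂ)).isPreconnected

lemma right_mem_compl (h : LandauHypotheses f A B C) : (B : ℂ) ∈ ({1}ᶜ : Set ℂ) := by
  have := h.two_le_right
  rw [mem_compl_singleton_iff]
  intro he
  have : B = 1 := by exact_mod_cast he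
  linarith

lemma re_bounds (h : LandauHypotheses f A B C) {z : ℂ} (hz : f z = 0) (hi : 1 ≤ z.im) :
    -A < z.re ∧ z.re < B := by
  constructor
  · by_contra! hle; exact h.left_ne_zero z hle hi hz
  · by_contra! hle; exact h.right_ne_zero z hle hz

lemma order_ne_top (h : LandauHypotheses f A B C) {z : ℂ} (hz : z ≠ 1) :
    analyticOrderAt f z ≠ ⊤ :=
  analyticOrderAt_ne_top_of_ne_zero isOpen_compl_singleton isPreconnected_compl_one h.diff
    h.right_mem_compl (h.right_ne_zero B (by simp)) hz

lemma ne_one_of_im {z : ℂ} (hz : 1 ≤ z.im) : z ≠ 1 := by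
  rintro rfl; norm_num at hz

lemma finite_zeros (h : LandauHypotheses f A B C) (T : ℝ) :
    {z : ℂ | f z = 0 ∧ 1 < z.im ∧ z.im < T}.Finite := by
  have hK : IsCompact (Icc (-A) B ×ℂ Icc 1 T) := isCompact_Icc.reProdIm isCompact_Icc
  refine (finite_zeros_of_isCompact isOpen_compl_singleton isPreconnected_compl_one h.diff
    h.right_mem_compl (h.right_ne_zero B (by simp)) hK ?_).subset ?_
  · intro z hz
    exact ne_one_of_im hz.2.1
  · rintro z ⟨hz, h1, h2⟩
    have := h.re_bounds hz h1.le
    exact ⟨⟨⟨this.1.le, this.2.le⟩, h1.le, h2.le⟩, hz⟩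

/-- A zero may lie on `Im z = 1` itself, so the bottom edge is moved slightly up. Only finitely many
zeros have imaginary part in `(1, 2)`, so none is lost. -/
lemma exists_bottom (h : LandauHypotheses f A B C) :
    ∃ T₀ ∈ Ioo (1 : ℝ) 2, ∀ z : ℂ, f z = 0 → 1 < z.im → T₀ < z.im := by
  have h1 : ∀ᶠ t in 𝓝[>] (1 : ℝ), ∀ z ∈ {z : ℂ | f z = 0 ∧ 1 < z.im ∧ z.im < 2}, t < z.im :=
    (eventually_all_finite (h.finite_zeros 2)).2 fun z hz =>
      mem_nhdsWithin_of_mem_nhds (Iio_mem_nhds hz.2.1)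
  have h2 : ∀ᶠ t in 𝓝[>] (1 : ℝ), t ∈ Ioo (1 : ℝ) 2 := Ioo_mem_nhdsGT (by norm_num)
  obtain ⟨t, ht1, ht2⟩ := (h1.and h2).exists
  refine ⟨t, ht2, fun z hz hi => ?_⟩
  rcases lt_or_ge z.im 2 with hlt | hge
  · exact ht1 z ⟨hz, hi, hlt⟩
  · exact ht2.2.trans_le hge

lemma log_two_add_le {s : ℂ} {T : ℝ} (hT : 3 ≤ T) (hs : |s.re| ≤ T) (hs' : |s.im| ≤ T + 1) :
    Real.log (2 + ‖s‖) ≤ 3 * Real.log T := by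
  have h1 : ‖s‖ ≤ T + (T + 1) := (norm_le_abs_re_add_abs_im s).trans (add_le_add hs hs')
  have h2 : 2 + ‖s‖ ≤ T ^ 3 := by nlinarith [sq_nonneg (T - 3)]
  calc Real.log (2 + ‖s‖) ≤ Real.log (T ^ 3) := Real.log_le_log (by positivity) h2
    _ = 3 * Real.log T := by rw [Real.log_pow]; norm_num

lemma integral_rpow_le {x a b : ℝ} (hx : 1 < x) (hb : b ≤ 0) :
    ∫ σ in a..b, x ^ σ ≤ 1 / Real.log x := by
  have hL : 0 < Real.log x := Real.log_pos hx
  have hx0 : 0 < x := by linarith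
  rw [intervalIntegral.integral_eq_sub_of_hasDerivAt (f := fun σ => x ^ σ / Real.log x)]
  · have h1 : x ^ b ≤ 1 := Real.rpow_le_one_of_one_le_of_nonpos hx.le hb
    have h2 : 0 < x ^ a := Real.rpow_pos_of_pos hx0 a
    rw [← sub_div]
    gcongr
    linarith
  · intro σ _
    have := (Real.hasStrictDerivAt_const_rpow hx0 σ).hasDerivAt.div_const (Real.log x)
    rwa [mul_div_cancel_right₀ _ hL.ne'] at this
  · exact (Continuous.rpow continuous_const continuous_id
      fun _ => Or.inl hx0.ne').intervalIntegrable
      _ _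

/-- The segment has length of order `T`, but `x ^ σ` is integrable at `-∞` because `x > 1`; only the
size `O(log T)` of the logarithmic derivative remains. -/
lemma norm_far_left_le (h : LandauHypotheses f A B C) {x : ℝ} (hx : 1 < x) {T y : ℝ}
    (hT : 3 ≤ T) (hTA : A ≤ T) (hy : 1 ≤ y) (hyT : y ≤ T + 1) :
    ‖∫ σ : ℝ in (-T)..(-A), (x : ℂ) ^ (σ + y * I : ℂ)
        * (deriv f (σ + y * I) / f (σ + y * I))‖
      ≤ C * 3 / Real.log x * Real.log T := by
  have hx0 : 0 < x := by linarith
  have hlT : 0 ≤ Real.log T := Real.log_nonneg (by linarith)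
  have hC := h.pos
  have hA := h.one_le_left
  refine (intervalIntegral.norm_integral_le_of_norm_le
    (g := fun σ => x ^ σ * (C * (3 * Real.log T))) (by linarith) ?_ ?_).trans ?_
  · refine Eventually.of_forall fun σ hσ => ?_
    rw [norm_mul, norm_cpow_eq_rpow_re_of_pos hx0]
    simp only [add_re, ofReal_re, mul_re, I_re, mul_zero, ofReal_im, I_im, mul_one, sub_self,
      add_zero]
    gcongr
    refine (h.left_logDeriv_le _ (by simpa using hσ.2) (by simpa using hy)).trans ?_
    gcongr
    refine log_two_add_le hT ?_ ?_
    · simp only [add_re, ofReal_re, mul_re, I_re, mul_zero, ofReal_im, I_im, mul_one, sub_self,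
        add_zero]
      rw [abs_le]; constructor <;> linarith [hσ.1, hσ.2]
    · simp only [add_im, ofReal_im, mul_im, ofReal_re, I_im, mul_one, I_re, mul_zero, add_zero,
        zero_add]
      rw [abs_le]; constructor <;> linarith
  · exact (((Continuous.rpow continuous_const continuous_id fun _ => Or.inl hx0.ne')).mul
      continuous_const).intervalIntegrable _ _
  · rw [intervalIntegral.integral_mul_const]
    calc _ ≤ 1 / Real.log x * (C * (3 * Real.log T)) := by
          gcongr
          exact integral_rpow_le hx (by linarith)
      _ = _ := by ring

lemma norm_left_edge_le (h : LandauHypotheses f A B C) {x : ℝ} (hx : 1 < x) {T T₀ T' : ℝ}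
    (hT : 3 ≤ T) (hTA : A ≤ T) (hT₀ : 1 ≤ T₀) (hT₀' : T₀ ≤ 2) (hT' : T' ∈ Icc T (T + 1)) :
    ‖∫ y : ℝ in T₀..T', (x : ℂ) ^ ((-T : ℝ) + y * I : ℂ)
        * (deriv f ((-T : ℝ) + y * I) / f ((-T : ℝ) + y * I))‖
      ≤ C * 3 / Real.log x * Real.log T := by
  have hx0 : 0 < x := by linarith
  have hL : 0 < Real.log x := Real.log_pos hx
  have hlT : 0 ≤ Real.log T := Real.log_nonneg (by linarith)
  have hC := h.pos
  have hT'1 := hT'.1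
  have hT'2 := hT'.2
  refine (intervalIntegral.norm_integral_le_of_norm_le_const
    (C := x ^ (-T) * (C * (3 * Real.log T))) ?_).trans ?_
  · intro y hy
    rw [uIoc_of_le (by linarith)] at hy
    rw [norm_mul, norm_cpow_eq_rpow_re_of_pos hx0]
    have hre : ((-T : ℝ) + y * I : ℂ).re = -T := by simp
    have him : ((-T : ℝ) + y * I : ℂ).im = y := by simp
    rw [hre]
    gcongr
    refine (h.left_logDeriv_le _ (by rw [hre]; linarith) (by rw [him]; linarith [hy.1])).trans ?_
    gcongr
    refine log_two_add_le hT ?_ ?_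
    · rw [hre, abs_neg, abs_of_nonneg (by linarith)]
    · rw [him, abs_of_nonneg (by linarith [hy.1])]
      linarith [hy.2]
  -- From `1 + u ≤ exp u`: the decay `x ^ (-T)` outweighs the length of the edge.
  · have h1 : T * Real.log x ≤ x ^ T := by
      rw [Real.rpow_def_of_pos hx0, mul_comm]
      linarith [Real.add_one_le_exp (Real.log x * T)]
    have h2 : |T' - T₀| ≤ T := by rw [abs_of_nonneg (by linarith)]; linarith
    have h3 : 0 < x ^ T := Real.rpow_pos_of_pos hx0 T
    have h4 : x ^ (-T) * T ≤ 1 / Real.log x := by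
      rw [Real.rpow_neg hx0.le, le_div_iff₀ hL, mul_assoc, inv_mul_le_iff₀ h3, mul_one]
      exact h1
    calc x ^ (-T) * (C * (3 * Real.log T)) * |T' - T₀|
        ≤ x ^ (-T) * (C * (3 * Real.log T)) * T := by
          gcongr
      _ = (x ^ (-T) * T) * (C * (3 * Real.log T)) := by ring
      _ ≤ 1 / Real.log x * (C * (3 * Real.log T)) := by gcongr
      _ = _ := by ring

/-- For all large `T` there is a height in `[T, T + 1]` at which the horizontal integral is
`O(log T)`, and there are `O(log T)` zeros with imaginary part in `[T, T + 1]`. -/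
lemma exists_good_height (h : LandauHypotheses f A B C) {x : ℝ} (hx : 1 < x) :
    ∃ K : ℝ, ∀ᶠ T : ℝ in atTop, ∃ T' ∈ Icc T (T + 1),
      (∀ z : ℂ, f z = 0 → z.im ≠ T') ∧
      ‖∫ σ : ℝ in (-A)..B, (x : ℂ) ^ (σ + T' * I : ℂ)
        * (deriv f (σ + T' * I) / f (σ + T' * I))‖ ≤ K * Real.log T ∧
      ∀ W : Finset ℂ, (∀ z ∈ W, f z = 0 ∧ z.im ∈ Icc T (T + 1)) →
        ∑ ρ ∈ W, (analyticOrderNatAt f ρ : ℝ) ≤ K * Real.log T := by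
  have hA := h.one_le_left
  have hB := h.two_le_right
  have hx0 : 0 < x := by linarith
  obtain ⟨c₀, hc₀, hlow⟩ := h.right_lower
  -- The disc of radius `r` about `B + iT` contains `[-A, B] × [T, T + 1]`, hence all zeros with
  -- imaginary part in `[T, T + 1]`.
  set r : ℝ := A + B + 1 with hr
  have hr0 : 0 < r := by linarith
  obtain ⟨D, hD⟩ := h.growth (B + 7 * r)
  -- On the large disc `D * (Im z) ^ D ≤ (T * c₀) * (T ^ 2) ^ D`, where `D ≤ T * c₀` for large `T`.
  -- So `f` is at most `T ^ (2 * D + 1)` times its value at the centre.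
  set K₁ : ℝ := 2 * D + 1 with hK₁
  have hK₁0 : 0 < K₁ := by positivity
  -- The zeros used lie within `2r` of `B + iT`; this `N` leaves room for both the range of heights
  -- and the segment `[-A, B]`.
  set N : ℝ := 3 * r + 2
  set K₂ : ℝ := x ^ B * (12 * K₁ / r * (B - -A)
    + 4 * N ^ (1 / 2 : ℝ) * (4 * N ^ (1 / 2 : ℝ) * (2 * K₁)))
  refine ⟨max K₂ (2 * K₁), ?_⟩
  filter_upwards [eventually_ge_atTop (7 * r + 2), eventually_ge_atTop (D / c₀),
    eventually_gt_atTop 1] with T hT1 hT2 hT3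
  have hlT : 0 < Real.log T := Real.log_pos hT3
  have hM : 0 < K₁ * Real.log T := by positivity
  set c : ℂ := B + T * I with hc
  have hcre : c.re = B := by simp [hc]
  have hcim : c.im = T := by simp [hc]
  have hball : ∀ z ∈ closedBall c (7 * r), |z.re - B| ≤ 7 * r ∧ |z.im - T| ≤ 7 * r := by
    intro z hz
    rw [mem_closedBall, dist_eq_norm] at hz
    have h1 := (abs_re_le_norm (z - c)).trans hz
    have h2 := (abs_im_le_norm (z - c)).trans hz
    rw [sub_re, hcre] at h1
    rw [sub_im, hcim] at h2
    exact ⟨h1, h2⟩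
  have him1 : ∀ z ∈ closedBall c (7 * r), 1 ≤ z.im := fun z hz => by
    have := (abs_le.1 (hball z hz).2).1
    linarith
  have hfc : f c ≠ 0 := h.right_ne_zero c hcre.ge
  have hexp : Real.exp (K₁ * Real.log T) = T ^ (2 * D + 1) := by
    rw [mul_comm, ← Real.rpow_def_of_pos (by linarith), hK₁]
    exact_mod_cast Real.rpow_natCast T (2 * D + 1)
  obtain ⟨Z, hZ, hZsum, hZld⟩ := exists_local_zeros (f := f) (c := c) (r := r) hr0 hM
    (h.diff.mono fun z hz => ne_one_of_im (him1 z (ball_subset_closedBall hz))) hfc (by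
      intro z hz
      have hz' : z ∈ closedBall c (7 * r) := closedBall_subset_closedBall (by linarith) hz
      have h1 := him1 z hz'
      have h2 := abs_le.1 (hball z hz').1
      have h3 := abs_le.1 (hball z hz').2
      refine (hD z h1 (by rw [abs_le]; constructor <;> linarith)).trans ?_
      have h4 : z.im ≤ T ^ 2 := by nlinarith
      rw [div_le_iff₀ hc₀] at hT2
      calc (D : ℝ) * z.im ^ D ≤ (T * c₀) * (T ^ 2) ^ D := by gcongr
        _ = T ^ (2 * D + 1) * c₀ := by rw [← pow_mul]; ring
        _ ≤ Real.exp (K₁ * Real.log T) * ‖f c‖ := by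
          rw [hexp]; gcongr; exact hlow T)
  have hZim : ∀ z : ℂ, f z = 0 → z.im ∈ Icc T (T + 1) → z ∈ Z := by
    intro z hz hi
    refine (hZ z).2 ⟨?_, hz⟩
    have h1 := h.re_bounds hz (by linarith [hi.1])
    rw [mem_closedBall, dist_eq_norm]
    refine (norm_le_abs_re_add_abs_im _).trans ?_
    rw [sub_re, sub_im, hcre, hcim, abs_of_nonpos (by linarith), abs_of_nonneg (by linarith [hi.1])]
    linarith [hi.2]
  have hZball : ∀ z ∈ Z, |z.re - B| ≤ 2 * r ∧ |z.im - T| ≤ 2 * r := by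
    intro z hz
    have hz := ((hZ z).1 hz).1
    rw [mem_closedBall, dist_eq_norm] at hz
    have h1 := (abs_re_le_norm (z - c)).trans hz
    have h2 := (abs_im_le_norm (z - c)).trans hz
    rw [sub_re, hcre] at h1
    rw [sub_im, hcim] at h2
    exact ⟨h1, h2⟩
  obtain ⟨T', hT', hT'Z, hT'sum⟩ := exists_height (Z := Z) (fun ρ => analyticOrderNatAt f ρ)
    (T := T) (N := N) fun ρ hρ => (hZball ρ hρ).2.trans (by simp only [N]; linarith)
  have hT'ne : ∀ z : ℂ, f z = 0 → z.im ≠ T' := fun z hz he =>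
    hT'Z z (hZim z hz (he ▸ hT')) he
  refine ⟨T', hT', hT'ne, ?_, ?_⟩
  · have hmem : ∀ σ ∈ Icc (-A) B, (σ + T' * I : ℂ) ∈ closedBall c r := by
      intro σ hσ
      rw [mem_closedBall, dist_eq_norm]
      refine (norm_le_abs_re_add_abs_im _).trans ?_
      rw [sub_re, sub_im, hcre, hcim]
      simp only [add_re, ofReal_re, mul_re, I_re, mul_zero, ofReal_im, I_im, mul_one, sub_self,
        add_zero, add_im, mul_im, zero_add]
      rw [abs_of_nonpos (by linarith [hσ.2]), abs_of_nonneg (by linarith [hT'.1])]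
      linarith [hσ.1, hT'.2]
    have key := norm_integral_horizontal_le (Z := Z) (fun ρ => analyticOrderNatAt f ρ)
      (G := fun σ => deriv f (σ + T' * I) / f (σ + T' * I))
      (φ := fun σ => (x : ℂ) ^ (σ + T' * I : ℂ)) (a := -A) (b := B) (y := T')
      (K := 12 * (K₁ * Real.log T) / r) (Φ := x ^ B) (N := N) (by linarith) hT'Z
      (fun ρ hρ => by
        have := abs_le.1 (hZball ρ hρ).1
        constructor <;> simp only [N] <;> linarith)
      (fun σ hσ => hZld _ (hmem σ hσ) fun h0 => hT'ne _ h0 (by simp))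
      (fun σ hσ => by
        rw [norm_cpow_eq_rpow_re_of_pos hx0]
        exact Real.rpow_le_rpow_of_exponent_le hx.le (by simpa using hσ.2))
    refine key.trans (le_trans ?_ (mul_le_mul_of_nonneg_right (le_max_left _ _) hlT.le))
    have hNn : 0 ≤ N ^ (1 / 2 : ℝ) := Real.rpow_nonneg (by simp only [N]; linarith) _
    calc _ ≤ x ^ B * (12 * (K₁ * Real.log T) / r * (B - -A)
        + 4 * N ^ (1 / 2 : ℝ) * (4 * N ^ (1 / 2 : ℝ) * (2 * (K₁ * Real.log T)))) := by
          gcongr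
          exact hT'sum.trans (by gcongr)
      _ = K₂ * Real.log T := by simp only [K₂]; ring
  · intro W hW
    refine le_trans ?_ (mul_le_mul_of_nonneg_right (le_max_right _ _) hlT.le)
    rw [mul_assoc]
    refine le_trans (Finset.sum_le_sum_of_subset_of_nonneg
      (fun z hz => hZim z (hW z hz).1 (hW z hz).2) fun _ _ _ => Nat.cast_nonneg _) hZsum

end LandauHypotheses

/-! ### The contour integral and the resulting Landau formula -/

namespace LandauHypotheses

variable {f : ℂ → ℂ} {A B C : ℝ}

lemma continuousAt_integrand (h : LandauHypotheses f A B C) {x : ℝ} (hx : 1 < x) {z : ℂ}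
    (hz : f z ≠ 0) (hi : 1 ≤ z.im) :
    ContinuousAt (fun z : ℂ => (x : ℂ) ^ z * (deriv f z / f z)) z := by
  have hz1 : {1}ᶜ ∈ 𝓝 z := isOpen_compl_singleton.mem_nhds (ne_one_of_im hi)
  have hx0 : (x : ℂ) ≠ 0 := by exact_mod_cast (by linarith : x ≠ 0)
  refine ContinuousAt.mul ?_ (ContinuousAt.div ?_ ?_ hz)
  · exact (continuousAt_const_cpow hx0)
  · exact ((h.diff.deriv isOpen_compl_singleton).differentiableAt hz1).continuousAt
  · exact (h.diff.differentiableAt hz1).continuousAt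

lemma horizontal_split (h : LandauHypotheses f A B C) {x : ℝ} (hx : 1 < x) {T y : ℝ}
    (hy : 1 ≤ y) (hf : ∀ z : ℂ, f z = 0 → z.im ≠ y) :
    ∫ σ : ℝ in (-T)..B, (x : ℂ) ^ (σ + y * I : ℂ) * (deriv f (σ + y * I) / f (σ + y * I))
      = (∫ σ : ℝ in (-T)..(-A), (x : ℂ) ^ (σ + y * I : ℂ)
          * (deriv f (σ + y * I) / f (σ + y * I)))
        + ∫ σ : ℝ in (-A)..B, (x : ℂ) ^ (σ + y * I : ℂ)
          * (deriv f (σ + y * I) / f (σ + y * I)) := by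
  have hc : Continuous fun σ : ℝ => (x : ℂ) ^ (σ + y * I : ℂ)
      * (deriv f (σ + y * I) / f (σ + y * I)) := by
    rw [continuous_iff_continuousAt]
    intro σ
    refine (h.continuousAt_integrand hx (z := σ + y * I) (fun h0 => hf _ h0 (by simp))
      (by simpa using hy)).comp (f := fun σ : ℝ => (σ + y * I : ℂ)) ?_
    fun_prop
  exact (intervalIntegral.integral_add_adjacent_intervals (hc.intervalIntegrable _ _)
    (hc.intervalIntegrable _ _)).symm

/-- The zeros up to a good height `T'`, summed by the residue theorem. -/
lemma rectIntegral_eq_sum (h : LandauHypotheses f A B C) {x : ℝ} (hx : 1 < x) {T T₀ T' : ℝ}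
    (hTA : A ≤ T) (hT₀ : 1 < T₀) (hT₀' : ∀ z : ℂ, f z = 0 → 1 < z.im → T₀ < z.im)
    (hTT : T₀ ≤ T') (hT' : ∀ z : ℂ, f z = 0 → z.im ≠ T') :
    rectIntegral (fun z => (x : ℂ) ^ z * (deriv f z / f z)) (-T) B T₀ T'
      = 2 * Real.pi * I * ∑ ρ ∈ (h.finite_zeros T').toFinset,
        (analyticOrderNatAt f ρ : ℂ) * (x : ℂ) ^ ρ := by
  have hA := h.one_le_left
  have hB := h.two_le_right
  have hx0 : (x : ℂ) ≠ 0 := by exact_mod_cast (by linarith : x ≠ 0)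
  refine rectIntegral_mul_logDeriv (φ := fun z => (x : ℂ) ^ z) (by linarith) hTT
    isOpen_compl_singleton h.diff (fun z => ?_) ?_ _ ?_ ?_ ?_
  · exact (hasStrictDerivAt_const_cpow (Or.inl hx0)).hasDerivAt.differentiableAt
  · intro z hz
    exact ne_one_of_im (hT₀.le.trans hz.2.1)
  · intro z
    rw [Finite.mem_toFinset]
    constructor
    · rintro ⟨h0, h1, h2⟩
      have := h.re_bounds h0 h1.le
      exact ⟨⟨⟨by linarith, this.2.le⟩, (hT₀' z h0 h1).le, h2.le⟩, h0⟩
    · rintro ⟨⟨-, h1, h2⟩, h0⟩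
      exact ⟨h0, hT₀.trans_le h1, lt_of_le_of_ne h2 (hT' z h0)⟩
  · intro z hz
    rw [Finite.mem_toFinset] at hz
    obtain ⟨h0, h1, h2⟩ := hz
    have := h.re_bounds h0 h1.le
    exact ⟨⟨by linarith, this.2⟩, hT₀' z h0 h1, h2⟩
  · intro z hz
    rw [Finite.mem_toFinset] at hz
    exact h.order_ne_top (ne_one_of_im hz.2.1.le)

/-- The left edge recedes to `Re s = -T`: an edge at fixed abscissa would only be bounded by `O(T
log T)`. The right edge gives `(T' - T₀)` times the total weight of the indices with `N i = x`, up
to `O(1)`. The index `i` is arbitrary, so several indices may share one value of `N`. -/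
theorem sum_zeros_isBigO (h : LandauHypotheses f A B C) {x : ℝ} (hx : 1 < x) {ι : Type*}
    [Countable ι] {w : ι → ℂ} {N : ι → ℝ} {δ : ℝ} (hN : ∀ i, 0 < N i) (hδ : 0 < δ)
    (hsum : Summable fun i => ‖w i‖ * N i ^ (-B))
    (hsep : ∀ i, w i ≠ 0 → N i ≠ x → δ ≤ |Real.log (x / N i)|)
    (hD : ∀ t : ℝ, HasSum (fun i => w i * (N i : ℂ) ^ (-(B + t * I : ℂ)))
      (deriv f (B + t * I) / f (B + t * I))) :
    (fun T : ℝ => (∑ᶠ ρ ∈ {z : ℂ | f z = 0 ∧ 1 < z.im ∧ z.im < T},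
        (analyticOrderNatAt f ρ : ℂ) * (x : ℂ) ^ ρ)
        - ((T / (2 * Real.pi) : ℝ) : ℂ) * ∑' i, if N i = x then w i else 0)
      =O[atTop] fun T : ℝ => Real.log T := by
  have hx0 : 0 < x := by linarith
  obtain ⟨T₀, hT₀, hT₀z⟩ := h.exists_bottom
  obtain ⟨K, hK⟩ := h.exists_good_height hx
  set α : ℂ := ∑' i, if N i = x then w i else 0 with hα
  set g : ℂ → ℂ := fun z => (x : ℂ) ^ z * (deriv f z / f z) with hg
  set E₁ : ℝ := ‖∫ σ : ℝ in (-A)..B, g (σ + T₀ * I)‖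
  set E₂ : ℝ := 2 / δ * x ^ B * ∑' i, ‖w i‖ * N i ^ (-B)
  set L : ℝ := C * 3 / Real.log x
  have hE₁ : 0 ≤ E₁ := norm_nonneg _
  have hE₂ : 0 ≤ E₂ := mul_nonneg (by positivity) (tsum_nonneg fun i => by have := hN i; positivity)
  have hT₀z' : ∀ z : ℂ, f z = 0 → z.im ≠ T₀ := fun z hz he =>
    (hT₀z z hz (he ▸ hT₀.1)).ne' he
  refine IsBigO.of_bound (x ^ B * K + ((L + E₁) + (L + K) + E₂ + L) + 3 * ‖α‖) ?_
  filter_upwards [hK, eventually_ge_atTop (A + 3), eventually_ge_atTop (Real.exp 1)] with T hKT hTA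
    hTe
  obtain ⟨T', hT', hT'z, hmid, hcount⟩ := hKT
  have hA := h.one_le_left
  have hB := h.two_le_right
  have hlT : 1 ≤ Real.log T := by
    rw [Real.le_log_iff_exp_le (by linarith)]; exact hTe
  have hlT0 : 0 < Real.log T := by linarith
  have hT'1 := hT'.1
  have hT'2 := hT'.2
  have hT₀1 := hT₀.1
  have hT₀2 := hT₀.2
  set S : ℝ → ℂ := fun T => ∑ ρ ∈ (h.finite_zeros T).toFinset,
    (analyticOrderNatAt f ρ : ℂ) * (x : ℂ) ^ ρ with hS
  have hfin : (∑ᶠ ρ ∈ {z : ℂ | f z = 0 ∧ 1 < z.im ∧ z.im < T},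
      (analyticOrderNatAt f ρ : ℂ) * (x : ℂ) ^ ρ) = S T := by
    rw [finsum_mem_eq_finite_toFinset_sum _ (h.finite_zeros T)]
  have hrect := h.rectIntegral_eq_sum hx (T := T) (by linarith) hT₀.1 hT₀z
    (by linarith : T₀ ≤ T') hT'z
  rw [← hg, rectIntegral] at hrect
  have hbot : ‖∫ σ : ℝ in (-T)..B, g (σ + T₀ * I)‖ ≤ (L + E₁) * Real.log T := by
    rw [hg, h.horizontal_split hx hT₀.1.le hT₀z']
    refine (norm_add_le _ _).trans ?_
    have h1 := h.norm_far_left_le hx (T := T) (y := T₀) (by linarith) (by linarith) hT₀.1.le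
      (by linarith)
    have h2 : E₁ ≤ E₁ * Real.log T := le_mul_of_one_le_right hE₁ hlT
    rw [add_mul]
    exact add_le_add h1 h2
  have htop : ‖∫ σ : ℝ in (-T)..B, g (σ + T' * I)‖ ≤ (L + K) * Real.log T := by
    rw [hg, h.horizontal_split hx (by linarith) hT'z]
    refine (norm_add_le _ _).trans ?_
    have h1 := h.norm_far_left_le hx (T := T) (y := T') (by linarith) (by linarith) (by linarith)
      hT'2
    rw [add_mul]
    exact add_le_add h1 hmid
  have hleft := h.norm_left_edge_le hx (T := T) (T₀ := T₀) (T' := T') (by linarith) (by linarith)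
    hT₀.1.le hT₀.2.le hT'
  have hright := norm_integral_dirichlet_sub_le hx0 hN hδ hsum hsep
    (D := fun z => deriv f z / f z) hD T₀ T'
  have hright' : ‖(∫ y : ℝ in T₀..T', g (B + y * I)) - (T' - T₀) * α‖ ≤ E₂ * Real.log T :=
    hright.trans (le_mul_of_one_le_right hE₂ hlT)
  have hpi : (Real.pi : ℂ) ≠ 0 := by exact_mod_cast Real.pi_ne_zero
  have hmain : ‖2 * Real.pi * I * S T' - I * ((T' - T₀) * α)‖
      ≤ ((L + E₁) + (L + K) + E₂ + L) * Real.log T := by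
    rw [← hrect]
    have : ∀ b t r l m : ℂ, b - t + I * r - I * l - I * m = b - t + I * (r - m) - I * l := by
      intros; ring
    rw [this]
    refine (norm_sub_le _ _).trans ?_
    rw [norm_mul, norm_I, one_mul, add_mul]
    refine add_le_add ((norm_add_le _ _).trans ?_) hleft
    rw [norm_mul, norm_I, one_mul, add_mul]
    refine add_le_add ((norm_sub_le _ _).trans ?_) hright'
    rw [add_mul]
    exact add_le_add hbot htop
  have hS' : ‖S T' - ((T' - T₀ : ℝ) / (2 * Real.pi)) * α‖
      ≤ ((L + E₁) + (L + K) + E₂ + L) * Real.log T := by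
    refine le_trans ?_ hmain
    have : 2 * Real.pi * I * S T' - I * ((T' - T₀) * α)
        = (2 * Real.pi * I) * (S T' - ((T' - T₀ : ℝ) / (2 * Real.pi)) * α) := by
      push_cast; field_simp
    rw [this, norm_mul]
    refine le_mul_of_one_le_left (norm_nonneg _) ?_
    simp only [norm_mul, Complex.norm_ofNat, norm_real, norm_I, mul_one, Real.norm_eq_abs,
      abs_of_pos Real.pi_pos]
    linarith [Real.pi_gt_three]
  -- The extra zeros lie in `[T, T + 1]`; their number is `O(log T)` and each has `|x ^ ρ| ≤ x ^ B`.
  have hdiff : ‖S T' - S T‖ ≤ x ^ B * K * Real.log T := by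
    have hsub : (h.finite_zeros T).toFinset ⊆ (h.finite_zeros T').toFinset := by
      intro z hz
      rw [Finite.mem_toFinset] at hz ⊢
      exact ⟨hz.1, hz.2.1, hz.2.2.trans_le hT'1⟩
    simp only [hS]
    rw [← Finset.sum_sdiff hsub, add_sub_cancel_right]
    set W := (h.finite_zeros T').toFinset \ (h.finite_zeros T).toFinset
    have hW : ∀ z ∈ W, f z = 0 ∧ z.im ∈ Icc T (T + 1) := by
      intro z hz
      simp only [W, Finset.mem_sdiff, Finite.mem_toFinset, mem_ofPred_eq, not_and, not_lt] at hz
      exact ⟨hz.1.1, hz.2 hz.1.1 hz.1.2.1, by linarith [hz.1.2.2]⟩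
    calc ‖∑ ρ ∈ W, (analyticOrderNatAt f ρ : ℂ) * (x : ℂ) ^ ρ‖
        ≤ ∑ ρ ∈ W, (analyticOrderNatAt f ρ : ℝ) * x ^ B := by
          refine (norm_sum_le _ _).trans (Finset.sum_le_sum fun ρ hρ => ?_)
          rw [norm_mul, Complex.norm_natCast, norm_cpow_eq_rpow_re_of_pos hx0]
          gcongr
          · exact hx.le
          · exact (h.re_bounds (hW ρ hρ).1 (by linarith [(hW ρ hρ).2.1])).2.le
      _ = x ^ B * ∑ ρ ∈ W, (analyticOrderNatAt f ρ : ℝ) := by rw [← Finset.sum_mul, mul_comm]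
      _ ≤ x ^ B * (K * Real.log T) := by gcongr; exact hcount W hW
      _ = _ := by ring
  have hlin : ‖((T' - T₀ : ℝ) / (2 * Real.pi) : ℂ) * α - ((T / (2 * Real.pi) : ℝ) : ℂ) * α‖
      ≤ 3 * ‖α‖ * Real.log T := by
    have : ((T' - T₀ : ℝ) / (2 * Real.pi) : ℂ) * α - ((T / (2 * Real.pi) : ℝ) : ℂ) * α
        = (((T' - T₀ - T) / (2 * Real.pi) : ℝ) : ℂ) * α := by
      push_cast; ring
    rw [this, norm_mul, norm_real, Real.norm_eq_abs]
    -- `T' - T` lies in `[0, 1]` and `T₀` in `(1, 2)`.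
    have h1 : |(T' - T₀ - T) / (2 * Real.pi)| ≤ 3 := by
      rw [abs_div, abs_of_pos (by positivity : (0 : ℝ) < 2 * Real.pi),
        div_le_iff₀ (by positivity), abs_le]
      constructor <;> nlinarith [Real.pi_gt_three]
    calc _ ≤ 3 * ‖α‖ := by gcongr
      _ ≤ _ := le_mul_of_one_le_right (by positivity) hlT
  simp only [mem_ofPred_eq] at hfin
  rw [hfin, Real.norm_of_nonneg hlT0.le]
  have hdec : S T - ((T / (2 * Real.pi) : ℝ) : ℂ) * α = -(S T' - S T)
      + (S T' - ((T' - T₀ : ℝ) / (2 * Real.pi)) * α)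
      + (((T' - T₀ : ℝ) / (2 * Real.pi) : ℂ) * α - ((T / (2 * Real.pi) : ℝ) : ℂ) * α) := by ring
  rw [hdec]
  refine (norm_add₃_le).trans ?_
  rw [norm_neg, add_mul, add_mul]
  exact add_le_add (add_le_add hdiff hS') hlin

end LandauHypotheses

/-! ### Sums over tuples -/

lemma hasSum_pi_prod {b : ℕ → ℂ} (hb : Summable fun n => ‖b n‖) (l : ℕ) :
    (Summable fun v : Fin l → ℕ => ‖∏ i, b (v i)‖) ∧
      HasSum (fun v : Fin l → ℕ => ∏ i, b (v i)) ((∑' n, b n) ^ l) := by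
  induction l with
  | zero => exact ⟨(hasSum_fintype _).summable, by simp⟩
  | succ l ih =>
    have h1 : Summable fun x : ℕ × (Fin l → ℕ) => ‖b x.1 * ∏ i, b (x.2 i)‖ := by
      simpa only [norm_mul] using hb.mul_of_nonneg ih.1 (fun _ => norm_nonneg _)
        (fun _ => norm_nonneg _)
    have h2 := (hb.of_norm.hasSum.mul ih.2 h1.of_norm)
    have he : ∀ x : ℕ × (Fin l → ℕ), ∏ i, b ((Fin.consEquiv fun _ : Fin (l + 1) => ℕ) x i)
        = b x.1 * ∏ i, b (x.2 i) := fun x => by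
      rw [Fin.prod_univ_succ]; simp [Fin.consEquiv]
    constructor
    · rw [← (Fin.consEquiv fun _ : Fin (l + 1) => ℕ).summable_iff]
      refine h1.congr fun x => ?_
      simp only [Function.comp, he]
    · rw [← (Fin.consEquiv fun _ : Fin (l + 1) => ℕ).hasSum_iff, pow_succ']
      refine h2.congr_fun fun x => ?_
      simp only [Function.comp, he]

lemma tsum_norm_pi_prod {b : ℕ → ℂ} (hb : Summable fun n => ‖b n‖) (l : ℕ) :
    HasSum (fun v : Fin l → ℕ => ‖∏ i, b (v i)‖) ((∑' n, ‖b n‖) ^ l) := by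
  have h := (hasSum_pi_prod (b := fun n => (‖b n‖ : ℂ)) (by simpa using hb) l).2
  have := (Complex.hasSum_ofReal (f := fun v : Fin l → ℕ => ∏ i, ‖b (v i)‖)
    (x := (∑' n, ‖b n‖) ^ l)).1 (by push_cast; exact h)
  simpa only [norm_prod] using this

/-- The summand attached to a tuple in the expansion of `c * A / (1 - c * S)`. -/
noncomputable def tupleTerm (a b : ℕ → ℂ) (c : ℂ) (p : Tuple) : ℂ :=
  c ^ (p.1 + 1) * (a (p.2 0) * ∏ i : Fin p.1, b (p.2 i.succ))

/-- Expand `c * A / (1 - c * S)` as the sum of `c ^ (l + 1) * A * S ^ l`, then each `A * S ^ l` as a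
sum over `l + 1` indices, the one coming from `A` first. The hypothesis is the convergence of the
same expansion with absolute values. -/
lemma hasSum_tupleTerm {a b : ℕ → ℂ} {c : ℂ} (ha : Summable fun n => ‖a n‖)
    (hb : Summable fun n => ‖b n‖) (hlt : ‖c‖ * ∑' n, ‖b n‖ < 1) :
    (Summable fun p => ‖tupleTerm a b c p‖) ∧
      HasSum (tupleTerm a b c) (c * (∑' n, a n) / (1 - c * ∑' n, b n)) := by
  have hnn : ∀ l, HasSum (fun v : Fin (l + 1) → ℕ => ‖tupleTerm a b c ⟨l, v⟩‖)
      (‖c‖ ^ (l + 1) * ((∑' n, ‖a n‖) * (∑' n, ‖b n‖) ^ l)) := by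
    intro l
    rw [← (Fin.consEquiv fun _ : Fin (l + 1) => ℕ).hasSum_iff]
    have h1 : Summable fun x : ℕ × (Fin l → ℕ) => ‖a x.1‖ * ‖∏ i, b (x.2 i)‖ :=
      ha.mul_of_nonneg (hasSum_pi_prod hb l).1 (fun _ => norm_nonneg _) (fun _ => norm_nonneg _)
    have h2 := (ha.hasSum.mul (tsum_norm_pi_prod hb l) h1).mul_left (‖c‖ ^ (l + 1))
    refine h2.congr_fun fun x => ?_
    simp [tupleTerm, Fin.consEquiv]
  have hvv : ∀ l, HasSum (fun v : Fin (l + 1) → ℕ => tupleTerm a b c ⟨l, v⟩)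
      (c ^ (l + 1) * ((∑' n, a n) * (∑' n, b n) ^ l)) := by
    intro l
    rw [← (Fin.consEquiv fun _ : Fin (l + 1) => ℕ).hasSum_iff]
    have h1 : Summable fun x : ℕ × (Fin l → ℕ) => ‖a x.1 * ∏ i, b (x.2 i)‖ := by
      simpa only [norm_mul] using ha.mul_of_nonneg (hasSum_pi_prod hb l).1
        (fun _ => norm_nonneg _) (fun _ => norm_nonneg _)
    have h2 := (ha.of_norm.hasSum.mul (hasSum_pi_prod hb l).2 h1.of_norm).mul_left (c ^ (l + 1))
    refine h2.congr_fun fun x => ?_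
    simp [tupleTerm, Fin.consEquiv]
  have hS : ‖c * ∑' n, b n‖ < 1 := by
    rw [norm_mul]
    refine lt_of_le_of_lt ?_ hlt
    gcongr
    exact norm_tsum_le_tsum_norm hb
  have hsum : Summable fun p => ‖tupleTerm a b c p‖ := by
    rw [summable_sigma_of_nonneg fun _ => norm_nonneg _]
    refine ⟨fun l => (hnn l).summable, ?_⟩
    simp only [(hnn _).tsum_eq]
    have hB0 : 0 ≤ ∑' n, ‖b n‖ := tsum_nonneg fun _ => norm_nonneg _
    refine ((summable_geometric_of_lt_one (mul_nonneg (norm_nonneg c) hB0) hlt).mul_left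
      (‖c‖ * ∑' n, ‖a n‖)).congr fun l => ?_
    rw [mul_pow]; ring
  refine ⟨hsum, ?_⟩
  refine HasSum.sigma_of_hasSum (g := fun l => c ^ (l + 1) * ((∑' n, a n) * (∑' n, b n) ^ l))
    ?_ hvv hsum.of_norm
  have := (hasSum_geometric_of_norm_lt_one hS).mul_left (c * ∑' n, a n)
  rw [← div_eq_mul_inv] at this
  refine this.congr_fun fun l => ?_
  rw [mul_pow]; ring

/-! ### Dirichlet series of the derivatives of zeta -/

lemma logMul_iterate_one (k n : ℕ) :
    (LSeries.logMul^[k] 1) n = (Real.log n : ℂ) ^ k := by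
  induction k with
  | zero => simp
  | succ k ih =>
    rw [Function.iterate_succ_apply', LSeries.logMul, ih, pow_succ', ← Complex.natCast_log]

lemma hasSum_zetaD (k : ℕ) {s : ℂ} (hs : 1 < s.re) :
    HasSum (fun n : ℕ => (Real.log n : ℂ) ^ k * (n : ℂ) ^ (-s)) ((-1) ^ k * zetaD k s) := by
  have habs : LSeries.abscissaOfAbsConv 1 < s.re := by
    rw [LSeries.abscissaOfAbsConv_one]; exact_mod_cast hs
  have heq : zetaD k s = (-1) ^ k * LSeries (LSeries.logMul^[k] 1) s := by
    rw [← LSeries_iteratedDeriv k habs, zetaD]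
    refine Filter.EventuallyEq.iteratedDeriv_eq k ?_
    filter_upwards [(isOpen_lt continuous_const continuous_re).mem_nhds hs] with z hz
    exact (LSeries_one_eq_riemannZeta hz).symm
  have hsum : LSeriesSummable (LSeries.logMul^[k] 1) s :=
    LSeriesSummable_of_abscissaOfAbsConv_lt_re (by
      rw [LSeries.absicssaOfAbsConv_logPowMul]; exact habs)
  rw [heq, ← mul_assoc, ← mul_pow, neg_mul_neg, one_mul, one_pow, one_mul]
  refine hsum.hasSum.congr_fun fun n => ?_
  -- Needed at `n = 0`, where the L-series term is `0` by convention: `0 ^ (-s)` vanishes only for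
  -- `s ≠ 0`.
  have hs0 : s ≠ 0 := by rintro rfl; norm_num at hs
  rcases eq_or_ne n 0 with rfl | hn
  · simp [hs0]
  · rw [LSeries.term_of_ne_zero hn, logMul_iterate_one, cpow_neg, div_eq_mul_inv]

/-- The terms `(log n) ^ k * (n / q) ^ (-s)` with `n ≥ m`. -/
noncomputable def logTerm (q m k : ℕ) (s : ℂ) (n : ℕ) : ℂ :=
  if m ≤ n then (Real.log n : ℂ) ^ k * ((n / q : ℝ) : ℂ) ^ (-s) else 0

lemma hasSum_logTerm_two {q k : ℕ} (hq : 0 < q) (hk : 1 ≤ k) {s : ℂ} (hs : 1 < s.re) :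
    HasSum (logTerm q 2 k s) ((q : ℂ) ^ s * ((-1) ^ k * zetaD k s)) := by
  refine ((hasSum_zetaD k hs).mul_left ((q : ℂ) ^ s)).congr_fun fun n => ?_
  have hq0 : (q : ℂ) ≠ 0 := by exact_mod_cast hq.ne'
  have hs0 : s ≠ 0 := by rintro rfl; norm_num at hs
  unfold logTerm
  split_ifs with h
  · rw [ofReal_div, div_cpow_ofReal_nonneg n.cast_nonneg q.cast_nonneg, ofReal_natCast,
      ofReal_natCast, cpow_neg (q : ℂ), div_inv_eq_mul]
    ring
  -- `Real.log` is `0` at `0` (by default) and at `1`, so `k ≥ 1` removes both terms.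
  · interval_cases n <;> simp [show k ≠ 0 by omega]

lemma hasSum_logTerm_three {k : ℕ} (hk : 1 ≤ k) {s : ℂ} (hs : 1 < s.re) :
    HasSum (logTerm 2 3 k s) ((2 : ℂ) ^ s * ((-1) ^ k * zetaD k s) - (Real.log 2 : ℂ) ^ k) := by
  have h1 := hasSum_logTerm_two (q := 2) (by norm_num) hk hs
  have h2 : HasSum (fun n : ℕ => if n = 2 then (Real.log 2 : ℂ) ^ k else 0)
      ((Real.log 2 : ℂ) ^ k) := hasSum_ite_eq 2 _
  refine (h1.sub h2).congr_fun fun n => ?_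
  unfold logTerm
  rcases lt_trichotomy n 2 with h | rfl | h
  · rw [if_neg (by omega), if_neg (by omega), if_neg (by omega), sub_zero]
  · simp
  · rw [if_pos (by omega), if_pos (by omega), if_neg (by omega), sub_zero]

lemma norm_logTerm {q m : ℕ} (hq : 0 < q) (hm : 0 < m) (k : ℕ) (s : ℂ) (n : ℕ) :
    ‖logTerm q m k s n‖ = if m ≤ n then Real.log n ^ k * (n / q : ℝ) ^ (-s.re) else 0 := by
  unfold logTerm
  split_ifs with h
  · have hn : 0 < n := by omega
    rw [norm_mul, norm_pow, norm_real, Real.norm_of_nonneg (Real.log_natCast_nonneg n),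
      norm_cpow_eq_rpow_re_of_pos (by positivity), neg_re]
  · simp

lemma norm_logTerm_le {q m : ℕ} (hq : 0 < q) (hqm : q ≤ m) (k : ℕ) {s : ℂ} {σ : ℝ} (hσ : σ ≤ s.re)
    (n : ℕ) : ‖logTerm q m k s n‖ ≤ ‖logTerm q m k σ n‖ := by
  rw [norm_logTerm hq (by omega), norm_logTerm hq (by omega)]
  split_ifs with h
  · have h1 : (1 : ℝ) ≤ n / q := by
      rw [one_le_div (by positivity)]; exact_mod_cast hqm.trans h
    have := Real.log_natCast_nonneg n
    rw [ofReal_re]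
    gcongr
  · exact le_rfl

lemma summable_logTerm {q m k : ℕ} (hq : 0 < q) (hm : 2 ≤ m) (hk : 1 ≤ k) {s : ℂ}
    (hs : 1 < s.re) : Summable fun n => ‖logTerm q m k s n‖ := by
  refine Summable.of_nonneg_of_le (fun _ => norm_nonneg _) (fun n => ?_)
    (hasSum_logTerm_two hq hk hs).summable.norm
  unfold logTerm
  by_cases h : m ≤ n
  · rw [if_pos h, if_pos (by omega)]
  · rw [if_neg h, norm_zero]; positivity

/-- Dominated convergence: every `n ≥ m` satisfies `n / q > 1`, so each term tends to zero. This is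
where `q < m` is needed; for `a = 0` it requires the `n = 2` term to have been factored out first.
-/
lemma tendsto_tsum_logTerm {q m k : ℕ} (hq : 0 < q) (hqm : q < m) (hm : 2 ≤ m) (hk : 1 ≤ k) :
    Tendsto (fun σ : ℝ => ∑' n, ‖logTerm q m k σ n‖) atTop (𝓝 0) := by
  have h := tendsto_tsum_of_dominated_convergence (𝓕 := atTop)
    (f := fun (σ : ℝ) n => ‖logTerm q m k σ n‖) (g := fun _ => (0 : ℝ))
    (bound := fun n => ‖logTerm q m k (2 : ℝ) n‖)
    (summable_logTerm hq hm hk (by norm_num)) ?_ ?_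
  · simpa using h
  · intro n
    simp only [norm_logTerm hq (show 0 < m by omega), ofReal_re]
    split_ifs with h
    · have h1 : (1 : ℝ) < n / q := by
        rw [one_lt_div (by positivity)]; exact_mod_cast hqm.trans_le h
      have h2 : Tendsto (fun σ : ℝ => (n / q : ℝ) ^ (-σ)) atTop (𝓝 0) :=
        (tendsto_rpow_atBot_of_base_gt_one _ h1).comp tendsto_neg_atTop_atBot
      simpa using h2.const_mul (Real.log n ^ k)
    · exact tendsto_const_nhds
  · filter_upwards [eventually_ge_atTop 2] with σ hσ n
    rw [norm_norm]
    exact norm_logTerm_le hq hqm.le k (by simpa using hσ) n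

/-! ### Generalized factorizations -/

/-- Tuples with `n_0 ≥ 2` and `n_1, …, n_l ≥ m`. -/
def admissible (m : ℕ) : Set Tuple := {p | 2 ≤ p.2 0 ∧ ∀ i : Fin p.1, m ≤ p.2 i.succ}

/-- The number `n_0 ⋯ n_l / q ^ (l + 1)` attached to a tuple. -/
noncomputable def tupleValue (q : ℕ) (p : Tuple) : ℝ := ∏ i, ((p.2 i : ℝ) / q)

/-- The coefficient of a tuple in the Dirichlet series of `ζ^(k+1) / (ζ^(k) - a)`. -/
noncomputable def tupleWeight (k : ℕ) (c : ℂ) (p : Tuple) : ℂ :=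
  c ^ (p.1 + 1) * (logWeight k p : ℂ)

lemma ofReal_prod_cpow {ι : Type*} (Z : Finset ι) {y : ι → ℝ} (hy : ∀ i ∈ Z, 0 ≤ y i) (s : ℂ) :
    ((∏ i ∈ Z, y i : ℝ) : ℂ) ^ s = ∏ i ∈ Z, (y i : ℂ) ^ s := by
  classical
  induction Z using Finset.induction_on with
  | empty => simp
  | insert i Z hi ih =>
    have hZ : ∀ j ∈ Z, 0 ≤ y j := fun j hj => hy j (Finset.mem_insert_of_mem hj)
    rw [Finset.prod_insert hi, Finset.prod_insert hi, ofReal_mul,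
      mul_cpow_ofReal_nonneg (hy i (Finset.mem_insert_self _ _)) (Finset.prod_nonneg hZ), ih hZ]

lemma tupleTerm_of_admissible {q m k : ℕ} {c s : ℂ} {p : Tuple} (hp : p ∈ admissible m) :
    tupleTerm (logTerm q 2 (k + 1) s) (logTerm q m k s) c p
      = tupleWeight k c p * (tupleValue q p : ℂ) ^ (-s) := by
  have h1 : ∀ i : Fin p.1, logTerm q m k s (p.2 i.succ)
      = (Real.log (p.2 i.succ) : ℂ) ^ k * ((p.2 i.succ / q : ℝ) : ℂ) ^ (-s) := fun i => by
    rw [logTerm, if_pos (hp.2 i)]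
  rw [tupleTerm, tupleWeight, tupleValue, ofReal_prod_cpow _ (fun i _ => by positivity),
    Fin.prod_univ_succ, logTerm, if_pos hp.1, Finset.prod_congr rfl (fun i _ => h1 i),
    Finset.prod_mul_distrib, Finset.prod_pow, logWeight]
  push_cast
  ring

lemma tupleTerm_of_not_admissible {q m k : ℕ} {c s : ℂ} {p : Tuple} (hp : p ∉ admissible m) :
    tupleTerm (logTerm q 2 (k + 1) s) (logTerm q m k s) c p = 0 := by
  rw [admissible, mem_ofPred_eq, not_and_or] at hp
  rcases hp with hp | hp
  · simp [tupleTerm, logTerm, hp]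
  · push Not at hp
    obtain ⟨i, hi⟩ := hp
    have : ∏ i : Fin p.1, logTerm q m k s (p.2 i.succ) = 0 :=
      Finset.prod_eq_zero (Finset.mem_univ i) (by rw [logTerm, if_neg (by omega)])
    rw [tupleTerm, this, mul_zero, mul_zero]

lemma tupleValue_pos {q m : ℕ} (hq : 0 < q) (hm : 0 < m) {p : Tuple} (hp : p ∈ admissible m) :
    0 < tupleValue q p := by
  refine Finset.prod_pos fun i _ => ?_
  have : 0 < p.2 i := by
    refine Fin.cases ?_ (fun j => ?_) i
    · have := hp.1; omega
    · have := hp.2 j; omega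
  positivity

/-- All factors `n_i / q` are at least `1`, and those with `i ≥ 1` are at least `m / q > 1`. A bound
on the product therefore bounds the length of the tuple, and then each entry. -/
lemma finite_admissible_le {q m : ℕ} (hq : 0 < q) (hq2 : q ≤ 2) (hqm : q < m) (Y : ℝ) :
    {p | p ∈ admissible m ∧ tupleValue q p ≤ Y}.Finite := by
  have hq' : (0 : ℝ) < q := by exact_mod_cast hq
  have hr : (1 : ℝ) < m / q := by rw [one_lt_div hq']; exact_mod_cast hqm
  obtain ⟨L, hL⟩ := pow_unbounded_of_one_lt Y hr
  obtain ⟨M, hM⟩ := exists_nat_ge (Y * q)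
  have hfin : (⋃ l ∈ Finset.range L, Sigma.mk (β := fun l : ℕ => (Fin (l + 1) → ℕ)) l ''
      {v | ∀ i, v i ∈ Iic M}).Finite :=
    (Finset.finite_toSet (Finset.range L)).biUnion fun l _ =>
      (Set.Finite.pi' fun _ => finite_Iic M).image _
  refine hfin.subset ?_
  rintro ⟨l, v⟩ ⟨⟨h0, hs⟩, hY⟩
  have h0' : (1 : ℝ) ≤ v 0 / q := by
    rw [one_le_div hq']; exact_mod_cast hq2.trans h0
  have hs' : ∀ i : Fin l, (m / q : ℝ) ≤ v i.succ / q := fun i => by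
    gcongr; exact hs i
  have hone : ∀ i, (1 : ℝ) ≤ v i / q := by
    intro i
    refine Fin.cases h0' (fun j => hr.le.trans (hs' j)) i
  have hl : (m / q : ℝ) ^ l ≤ Y := by
    refine le_trans ?_ hY
    rw [tupleValue, Fin.prod_univ_succ]
    have h2 : (m / q : ℝ) ^ l ≤ ∏ i : Fin l, (v i.succ / q : ℝ) := by
      simpa only [Finset.prod_const, Finset.card_univ, Fintype.card_fin] using
        Finset.prod_le_prod (s := Finset.univ) (fun _ _ => by positivity) (fun i _ => hs' i)
    exact h2.trans (le_mul_of_one_le_left (Finset.prod_nonneg fun _ _ => by positivity) h0')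
  simp only [mem_iUnion, Finset.mem_range]
  refine ⟨l, ?_, v, fun i => ?_, rfl⟩
  · by_contra! hLl
    exact absurd (hL.trans_le (pow_le_pow_right₀ hr.le hLl)) (not_lt.2 hl)
  · have h1 : (v i / q : ℝ) ≤ Y := by
      refine le_trans ?_ hY
      rw [tupleValue, ← Finset.mul_prod_erase _ _ (Finset.mem_univ i)]
      exact le_mul_of_one_le_right (by linarith [hone i])
        (Finset.one_le_prod fun j _ => hone j)
    rw [div_le_iff₀ hq'] at h1
    have : (v i : ℝ) ≤ M := h1.trans hM
    exact_mod_cast this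

lemma finite_fiber {q m : ℕ} (hq : 0 < q) (hq2 : q ≤ 2) (hqm : q < m) (y : ℝ) :
    {p | p ∈ admissible m ∧ tupleValue q p = y}.Finite :=
  (finite_admissible_le hq hq2 hqm y).subset fun _ hp => ⟨hp.1, hp.2.le⟩

/-- Only finitely many tuples have value at most `x + 1`, and larger values are separated from `x`
by `log ((x + 1) / x)`. -/
lemma exists_separation {q m : ℕ} (hq : 0 < q) (hq2 : q ≤ 2) (hqm : q < m) {x : ℝ} (hx : 1 < x) :
    ∃ δ > 0, ∀ p ∈ admissible m, tupleValue q p ≠ x → δ ≤ |Real.log (x / tupleValue q p)| := by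
  have hx0 : 0 < x := by linarith
  have h1 : ∀ᶠ δ in 𝓝[>] (0 : ℝ), ∀ p ∈ {p | p ∈ admissible m ∧ tupleValue q p ≤ x + 1},
      tupleValue q p ≠ x → δ < |Real.log (x / tupleValue q p)| := by
    refine (eventually_all_finite (finite_admissible_le hq hq2 hqm (x + 1))).2 fun p hp => ?_
    by_cases h : tupleValue q p = x
    · exact Eventually.of_forall fun _ h' => absurd h h'
    · have hpos := tupleValue_pos hq (by omega) hp.1
      have : 0 < |Real.log (x / tupleValue q p)| := by
        refine abs_pos.2 (Real.log_ne_zero_of_pos_of_ne_one (by positivity) ?_)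
        rw [Ne, div_eq_one_iff_eq hpos.ne']
        exact fun h' => h h'.symm
      filter_upwards [mem_nhdsWithin_of_mem_nhds (Iio_mem_nhds this)] with δ hδ _ using hδ
  have hl : 0 < Real.log ((x + 1) / x) := Real.log_pos (by rw [one_lt_div hx0]; linarith)
  have h2 : ∀ᶠ δ in 𝓝[>] (0 : ℝ), δ < Real.log ((x + 1) / x) :=
    mem_nhdsWithin_of_mem_nhds (Iio_mem_nhds hl)
  obtain ⟨δ, ⟨hδ1, hδ2⟩, hδ0⟩ := ((h1.and h2).and self_mem_nhdsWithin).exists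
  refine ⟨δ, hδ0, fun p hp hne => ?_⟩
  rcases le_or_gt (tupleValue q p) (x + 1) with h | h
  · exact (hδ1 p ⟨hp, h⟩ hne).le
  · refine hδ2.le.trans (le_trans ?_ (neg_le_abs _))
    rw [← Real.log_inv, inv_div]
    gcongr

/-- The sum of the weights of the admissible tuples of value `y`. -/
noncomputable def fiberCoeff (q m k : ℕ) (c : ℂ) (y : ℝ) : ℂ :=
  ∑ᶠ p ∈ {p | p ∈ admissible m ∧ tupleValue q p = y}, tupleWeight k c p

lemma tsum_ite_tupleWeight {q m k : ℕ} (hq : 0 < q) (hq2 : q ≤ 2) (hqm : q < m) (c : ℂ) (y : ℝ) :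
    ∑' p : admissible m, (if tupleValue q p = y then tupleWeight k c p else 0)
      = fiberCoeff q m k c y := by
  rw [fiberCoeff, finsum_mem_eq_finite_toFinset_sum _ (finite_fiber hq hq2 hqm y),
    tsum_subtype (admissible m) (fun p => if tupleValue q p = y then tupleWeight k c p else 0),
    tsum_eq_sum (s := (finite_fiber hq hq2 hqm y).toFinset)]
  · refine Finset.sum_congr rfl fun p hp => ?_
    rw [Finite.mem_toFinset] at hp
    rw [indicator_of_mem hp.1, if_pos hp.2]
  · intro p hp
    rw [Finite.mem_toFinset, mem_ofPred_eq, not_and] at hp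
    by_cases h : p ∈ admissible m
    · rw [indicator_of_mem h, if_neg (hp h)]
    · rw [indicator_of_notMem h]

/-- Regroups the absolutely convergent sum over tuples by their value; the index runs over all real
`d`, almost all with empty fibre. -/
lemma hasSum_fiberCoeff {q m k : ℕ} (hq : 0 < q) (hq2 : q ≤ 2) (hqm : q < m) {c s v : ℂ}
    (h : HasSum (tupleTerm (logTerm q 2 (k + 1) s) (logTerm q m k s) c) v) :
    HasSum (fun d : ℝ => fiberCoeff q m k c d * (d : ℂ) ^ (-s)) v := by
  refine (h.tsum_fiberwise (tupleValue q)).congr_fun fun d => ?_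
  rw [tsum_subtype (tupleValue q ⁻¹' {d}), ← tsum_ite_tupleWeight hq hq2 hqm,
    tsum_subtype (admissible m) (fun p => if tupleValue q p = d then tupleWeight k c p else 0),
    ← tsum_mul_right]
  refine tsum_congr fun p => ?_
  by_cases hp : p ∈ admissible m
  · by_cases hd : p ∈ tupleValue q ⁻¹' {d}
    · rw [indicator_of_mem hp, if_pos (show tupleValue q p = d from hd), indicator_of_mem hd,
        tupleTerm_of_admissible hp,
        show tupleValue q p = d from hd]
    · rw [indicator_of_mem hp, if_neg (show ¬tupleValue q p = d from hd), indicator_of_notMem hd,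
        zero_mul]
  · rw [indicator_of_notMem hp, zero_mul]
    by_cases hd : p ∈ tupleValue q ⁻¹' {d}
    · rw [indicator_of_mem hd, tupleTerm_of_not_admissible hp]
    · rw [indicator_of_notMem hd]

/-- Common to both cases of the theorem: `(q, m) = (1, 2)` for `a ≠ 0` and `(2, 3)` for `a = 0`.
Choose `B` with `|c| * ∑ |terms| < 1/2`; then `1 - c * S` has modulus at least `1/2` and the
geometric expansion applies. The lower bound on `f₀` is asked only on vertical lines since `2 ^
(-s)` decays to the right. -/
lemma exists_right_half_plane_of_factor {q m k : ℕ} {c a : ℂ} (hq : 0 < q) (hqm : q < m)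
    (hm : 2 ≤ m) (hk : 1 ≤ k) {f₀ : ℂ → ℂ}
    (hden : ∀ s : ℂ, 1 < s.re → zetaD k s - a = f₀ s * (1 - c * ∑' n, logTerm q m k s n))
    (hnum : ∀ s : ℂ, 1 < s.re →
      zetaD (k + 1) s = f₀ s * (c * ∑' n, logTerm q 2 (k + 1) s n))
    (hlow : ∀ σ : ℝ, ∃ c₀ > 0, ∀ s : ℂ, s.re = σ → c₀ ≤ ‖f₀ s‖) :
    ∃ B : ℝ, 2 ≤ B ∧ (∀ s : ℂ, B ≤ s.re → zetaD k s ≠ a) ∧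
      (∃ c₀ > 0, ∀ t : ℝ, c₀ ≤ ‖zetaD k (B + t * I) - a‖) ∧
      ∀ s : ℂ, B ≤ s.re →
        (Summable fun p => ‖tupleTerm (logTerm q 2 (k + 1) s) (logTerm q m k s) c p‖) ∧
        HasSum (tupleTerm (logTerm q 2 (k + 1) s) (logTerm q m k s) c)
          (zetaD (k + 1) s / (zetaD k s - a)) := by
  have ht := (tendsto_tsum_logTerm hq hqm hm hk).const_mul ‖c‖
  rw [mul_zero] at ht
  obtain ⟨B, hB1, hB2⟩ := ((ht.eventually (gt_mem_nhds (by norm_num : (0 : ℝ) < 1 / 2))).and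
    (eventually_ge_atTop 2)).exists
  have hsmall : ∀ s : ℂ, B ≤ s.re → ‖c‖ * ∑' n, ‖logTerm q m k s n‖ < 1 / 2 := by
    intro s hs
    refine lt_of_le_of_lt (mul_le_mul_of_nonneg_left ?_ (norm_nonneg _)) hB1
    exact Summable.tsum_le_tsum (norm_logTerm_le hq hqm.le k hs)
      (summable_logTerm hq hm hk (by linarith))
      (summable_logTerm hq hm hk (by rw [ofReal_re]; linarith))
  have hhalf : ∀ s : ℂ, B ≤ s.re → 1 / 2 ≤ ‖1 - c * ∑' n, logTerm q m k s n‖ := by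
    intro s hs
    have h1 : ‖c * ∑' n, logTerm q m k s n‖ ≤ 1 / 2 := by
      rw [norm_mul]
      refine le_trans (mul_le_mul_of_nonneg_left ?_ (norm_nonneg _)) (hsmall s hs).le
      exact norm_tsum_le_tsum_norm (summable_logTerm hq hm hk (by linarith))
    have h2 := norm_sub_norm_le (1 : ℂ) (c * ∑' n, logTerm q m k s n)
    rw [norm_one] at h2
    linarith
  have hf₀ : ∀ s, f₀ s ≠ 0 := fun s => by
    obtain ⟨c₀, hc₀, h⟩ := hlow s.re
    exact norm_pos_iff.1 (hc₀.trans_le (h s rfl))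
  have h1ne : ∀ s : ℂ, B ≤ s.re → 1 - c * ∑' n, logTerm q m k s n ≠ 0 := fun s hs => by
    have := hhalf s hs
    exact norm_pos_iff.1 (by linarith)
  refine ⟨B, hB2, fun s hs => ?_, ?_, fun s hs => ?_⟩
  · rw [← sub_ne_zero, hden s (by linarith)]
    exact mul_ne_zero (hf₀ s) (h1ne s hs)
  · obtain ⟨c₀, hc₀, h⟩ := hlow B
    refine ⟨c₀ * (1 / 2), by positivity, fun t => ?_⟩
    have hre : (B + t * I : ℂ).re = B := by simp
    rw [hden _ (by rw [hre]; linarith), norm_mul]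
    exact mul_le_mul (h _ hre) (hhalf _ hre.ge) (by norm_num) (norm_nonneg _)
  · have h := hasSum_tupleTerm (c := c) (summable_logTerm (s := s) hq le_rfl (by omega : 1 ≤ k + 1)
      (by linarith)) (summable_logTerm (s := s) hq hm hk (by linarith))
      ((hsmall s hs).trans (by norm_num))
    refine ⟨h.1, ?_⟩
    rw [hden s (by linarith), hnum s (by linarith), mul_div_mul_left _ _ (hf₀ s)]
    exact h.2

lemma neg_one_pow_mul_self (k : ℕ) : (-1 : ℂ) ^ k * (-1) ^ k = 1 := by
  rw [← mul_pow]; simp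

lemma exists_right_half_plane_of_ne_zero {k : ℕ} (hk : 1 ≤ k) {a : ℂ} (ha : a ≠ 0) :
    ∃ B : ℝ, 2 ≤ B ∧ (∀ s : ℂ, B ≤ s.re → zetaD k s ≠ a) ∧
      (∃ c₀ > 0, ∀ t : ℝ, c₀ ≤ ‖zetaD k (B + t * I) - a‖) ∧
      ∀ s : ℂ, B ≤ s.re →
        (Summable fun p => ‖tupleTerm (logTerm 1 2 (k + 1) s) (logTerm 1 2 k s)
          ((-1) ^ k / a) p‖) ∧
        HasSum (tupleTerm (logTerm 1 2 (k + 1) s) (logTerm 1 2 k s) ((-1) ^ k / a))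
          (zetaD (k + 1) s / (zetaD k s - a)) := by
  refine exists_right_half_plane_of_factor (f₀ := fun _ => -a) one_pos (by norm_num) le_rfl hk
    (fun s hs => ?_) (fun s hs => ?_) fun σ => ⟨‖a‖, norm_pos_iff.2 ha, fun s _ => by simp⟩
  · rw [(hasSum_logTerm_two one_pos hk hs).tsum_eq, Nat.cast_one, one_cpow, one_mul]
    field_simp
    linear_combination (-zetaD k s) * neg_one_pow_mul_self k
  · rw [(hasSum_logTerm_two one_pos (by omega) hs).tsum_eq, Nat.cast_one, one_cpow, one_mul,
      pow_succ]
    field_simp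
    linear_combination (-zetaD (k + 1) s) * neg_one_pow_mul_self k

lemma exists_right_half_plane_zero {k : ℕ} (hk : 1 ≤ k) :
    ∃ B : ℝ, 2 ≤ B ∧ (∀ s : ℂ, B ≤ s.re → zetaD k s ≠ 0) ∧
      (∃ c₀ > 0, ∀ t : ℝ, c₀ ≤ ‖zetaD k (B + t * I) - 0‖) ∧
      ∀ s : ℂ, B ≤ s.re →
        (Summable fun p => ‖tupleTerm (logTerm 2 2 (k + 1) s) (logTerm 2 3 k s)
          (-1 / (Real.log 2 : ℂ) ^ k) p‖) ∧
        HasSum (tupleTerm (logTerm 2 2 (k + 1) s) (logTerm 2 3 k s) (-1 / (Real.log 2 : ℂ) ^ k))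
          (zetaD (k + 1) s / (zetaD k s - 0)) := by
  have hl : (Real.log 2 : ℂ) ≠ 0 := by
    exact_mod_cast (Real.log_pos (by norm_num : (1 : ℝ) < 2)).ne'
  have h2 : ∀ s : ℂ, (2 : ℂ) ^ s ≠ 0 := fun s => by simp [cpow_eq_zero_iff]
  refine exists_right_half_plane_of_factor
    (f₀ := fun s => (-1) ^ k * ((2 : ℂ) ^ s)⁻¹ * (Real.log 2 : ℂ) ^ k) two_pos (by norm_num)
    (by norm_num) hk (fun s hs => ?_) (fun s hs => ?_) fun σ => ?_
  · rw [(hasSum_logTerm_three hk hs).tsum_eq]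
    have := h2 s
    field_simp
    linear_combination (-zetaD k s * (2 : ℂ) ^ s) * neg_one_pow_mul_self k
  · rw [(hasSum_logTerm_two two_pos (by omega) hs).tsum_eq, pow_succ]
    have := h2 s
    push_cast
    field_simp
    linear_combination (-zetaD (k + 1) s) * neg_one_pow_mul_self k
  · refine ⟨((2 : ℝ) ^ σ)⁻¹ * Real.log 2 ^ k, ?_, fun s hs => ?_⟩
    · have := Real.log_pos (by norm_num : (1 : ℝ) < 2)
      positivity
    · have h3 : ‖(2 : ℂ) ^ s‖ = (2 : ℝ) ^ s.re := by
        have := norm_cpow_eq_rpow_re_of_pos (by norm_num : (0 : ℝ) < 2) s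
        simpa using this
      rw [norm_mul, norm_mul, norm_pow, norm_pow, norm_neg, norm_one, one_pow, one_mul, norm_inv,
        h3, hs, norm_real, Real.norm_of_nonneg (Real.log_nonneg (by norm_num))]

/-! ### The coefficients of the statement -/

lemma factorizations_eq (y : ℝ) :
    factorizations y = {p | p ∈ admissible 2 ∧ tupleValue 1 p = y} := by
  ext p
  simp only [factorizations, admissible, tupleValue, mem_ofPred_eq, Nat.cast_one, div_one,
    Fin.forall_fin_succ, eq_comm (a := y)]

lemma dyadicFactorizations_eq (y : ℝ) :
    dyadicFactorizations y = {p | p ∈ admissible 3 ∧ tupleValue 2 p = y} := by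
  ext p
  simp only [dyadicFactorizations, admissible, tupleValue, mem_ofPred_eq, Finset.prod_div_distrib,
    Finset.prod_const, Finset.card_univ, Fintype.card_fin, eq_comm (a := y), and_assoc,
    Nat.cast_ofNat]

lemma coeff_eq (k : ℕ) (a : ℂ) : coeff k a = fiberCoeff 1 2 k ((-1) ^ k / a) := by
  funext y
  rw [coeff, fiberCoeff, factorizations_eq]
  refine finsum_mem_congr rfl fun p _ => ?_
  rw [tupleWeight, div_pow, pow_mul]

lemma coeffZero_eq (k : ℕ) :
    coeffZero k = fiberCoeff 2 3 k (-1 / (Real.log 2 : ℂ) ^ k) := by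
  funext y
  rw [coeffZero, fiberCoeff, dyadicFactorizations_eq]
  refine finsum_mem_congr rfl fun p _ => ?_
  rw [tupleWeight]
  push_cast
  rfl

lemma coeff_eq_zero_of_not_int (k : ℕ) (a : ℂ) {x : ℝ} (hx : ¬ ∃ m : ℤ, (m : ℝ) = x) :
    coeff k a x = 0 := by
  have : factorizations x = ∅ := by
    rw [eq_empty_iff_forall_notMem]
    rintro p ⟨-, hp⟩
    exact hx ⟨∏ i, (p.2 i : ℤ), by rw [hp]; push_cast; rfl⟩
  rw [coeff, this, finsum_mem_empty]

lemma coeffZero_eq_zero_of_not_dyadic (k : ℕ) {x : ℝ}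
    (hx : ∀ n : ℕ, ¬ ∃ m : ℤ, (m : ℝ) = 2 ^ n * x) : coeffZero k x = 0 := by
  have : dyadicFactorizations x = ∅ := by
    rw [eq_empty_iff_forall_notMem]
    rintro p ⟨-, -, hp⟩
    refine hx (p.1 + 1) ⟨∏ i, (p.2 i : ℤ), ?_⟩
    rw [hp, mul_div_cancel₀ _ (by positivity)]
    push_cast; rfl
  rw [coeffZero, this, finsum_mem_empty]

/-! ### The logarithmic derivative of the Gamma function -/

/-- `GammaSeq s n` is the integral of `(1 - x / n) ^ n * x ^ (s - 1)` over `[0, n]`, and `(1 - x /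
n) ^ n ≤ exp (-x)`. The bound is uniform in `n`, as needed for dominated convergence. -/
lemma norm_GammaSeq_le {s : ℂ} (hs : 0 < s.re) {n : ℕ} (hn : n ≠ 0) :
    ‖GammaSeq s n‖ ≤ Real.Gamma s.re := by
  rw [GammaSeq_eq_approx_Gamma_integral hs hn, Real.Gamma_eq_integral hs,
    intervalIntegral.integral_of_le n.cast_nonneg]
  have hint := Real.GammaIntegral_convergent hs
  have hsub : Ioc (0 : ℝ) n ⊆ Ioi 0 := Ioc_subset_Ioi_self
  refine (MeasureTheory.norm_integral_le_of_norm_le (hint.mono_set hsub) ?_).trans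
    (MeasureTheory.setIntegral_mono_set hint ?_ hsub.eventuallyLE)
  · refine (MeasureTheory.ae_restrict_mem measurableSet_Ioc).mono fun x hx => ?_
    have h1 : 0 ≤ 1 - x / n := by
      rw [sub_nonneg]; exact div_le_one_of_le₀ hx.2 n.cast_nonneg
    rw [norm_mul, norm_cpow_eq_rpow_re_of_pos hx.1, norm_real, Real.norm_of_nonneg (by positivity),
      sub_re, one_re]
    exact mul_le_mul_of_nonneg_right (Real.one_sub_div_pow_le_exp_neg hx.2)
      (Real.rpow_nonneg hx.1.le _)
  · refine (MeasureTheory.ae_restrict_mem measurableSet_Ioi).mono fun x hx => ?_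
    have : 0 < x := hx
    simp only [Pi.zero_apply]
    positivity

lemma add_natCast_ne_zero {s : ℂ} (hs : 0 < s.re) (j : ℕ) : s + j ≠ 0 := by
  intro h
  have := congrArg Complex.re h
  simp only [add_re, natCast_re, zero_re] at this
  have : (0 : ℝ) ≤ j := j.cast_nonneg
  linarith

lemma logDeriv_GammaSeq {s : ℂ} (hs : 0 < s.re) {n : ℕ} (hn : n ≠ 0) :
    DifferentiableAt ℂ (fun z => GammaSeq z n) s ∧ GammaSeq s n ≠ 0 ∧
      logDeriv (fun z => GammaSeq z n) s
        = log n - ∑ j ∈ Finset.range (n + 1), (s + j)⁻¹ := by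
  have hn' : (n : ℂ) ≠ 0 := by exact_mod_cast hn
  have hfac : (n.factorial : ℂ) ≠ 0 := by exact_mod_cast n.factorial_ne_zero
  have hd1 : HasDerivAt (fun z : ℂ => (n : ℂ) ^ z) ((n : ℂ) ^ s * log n) s :=
    (hasStrictDerivAt_const_cpow (Or.inl hn')).hasDerivAt
  have h1 : (n : ℂ) ^ s ≠ 0 := by simp [cpow_eq_zero_iff, hn']
  have hp : ∏ j ∈ Finset.range (n + 1), (s + j) ≠ 0 :=
    Finset.prod_ne_zero_iff.2 fun j _ => add_natCast_ne_zero hs j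
  have hdp : DifferentiableAt ℂ (fun z : ℂ => ∏ j ∈ Finset.range (n + 1), (z + j)) s := by
    fun_prop
  have hd2 : DifferentiableAt ℂ (fun z : ℂ => (n : ℂ) ^ z * n.factorial) s :=
    hd1.differentiableAt.mul_const _
  refine ⟨hd2.div hdp hp, div_ne_zero (mul_ne_zero h1 hfac) hp, ?_⟩
  have h2 := logDeriv_div (f := fun z : ℂ => (n : ℂ) ^ z * n.factorial) s
    (mul_ne_zero h1 hfac) hp hd2 hdp
  refine Eq.trans h2 ?_
  congr 1
  · rw [logDeriv_mul_const _ _ hfac, logDeriv_apply, hd1.deriv, mul_div_cancel_left₀ _ h1]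
  · rw [logDeriv_prod (f := fun (j : ℕ) (z : ℂ) => z + j) (fun j _ => add_natCast_ne_zero hs j)
      (fun j _ => by fun_prop)]
    refine Finset.sum_congr rfl fun j _ => ?_
    simp [logDeriv_apply]

/-- Cauchy's integral for the derivative passes to the limit: pointwise convergence on the circle
together with the uniform bound suffices. -/
lemma tendsto_deriv_GammaSeq {s : ℂ} (hs : 2 ≤ s.re) :
    Tendsto (fun n : ℕ => deriv (fun z => GammaSeq z n) s) atTop (𝓝 (deriv Gamma s)) := by
  have hre : ∀ z ∈ closedBall s 1, 1 ≤ z.re ∧ z.re ≤ s.re + 1 := by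
    intro z hz
    rw [mem_closedBall, dist_eq_norm] at hz
    have := abs_le.1 ((abs_re_le_norm (z - s)).trans hz)
    rw [sub_re] at this
    constructor <;> linarith
  obtain ⟨M, hM⟩ := (isCompact_Icc (a := (1 : ℝ)) (b := s.re + 1)).exists_bound_of_continuousOn
    (f := Real.Gamma) fun x hx => (Real.differentiableAt_Gamma fun m => by
      have : (0 : ℝ) ≤ m := m.cast_nonneg
      intro h
      have := hx.1
      linarith).continuousAt.continuousWithinAt
  have hdG : DifferentiableOn ℂ Gamma (closedBall s 1) := fun z hz =>
    (differentiableAt_Gamma z fun m h => by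
      have h1 := (hre z hz).1
      rw [h, neg_re, natCast_re] at h1
      have : (0 : ℝ) ≤ m := m.cast_nonneg
      linarith).differentiableWithinAt
  have hC := hdG.deriv_eq_smul_circleIntegral one_pos
  have hlim : Tendsto (fun n : ℕ => ∮ z in C(s, 1), (1 / (z - s) ^ 2) • GammaSeq z n) atTop
      (𝓝 (∮ z in C(s, 1), (1 / (z - s) ^ 2) • Gamma z)) := by
    unfold circleIntegral
    refine intervalIntegral.tendsto_integral_filter_of_dominated_convergence (fun _ => M)
      ?_ ?_ ?_ ?_
    · filter_upwards [eventually_ne_atTop 0] with n hn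
      refine Continuous.aestronglyMeasurable ?_
      rw [continuous_iff_continuousAt]
      intro θ
      have hmem := circleMap_mem_closedBall s zero_le_one θ
      have h1 := (logDeriv_GammaSeq (s := circleMap s 1 θ) (by linarith [(hre _ hmem).1]) hn).1
      have h2 : ContinuousAt (fun θ => GammaSeq (circleMap s 1 θ) n) θ :=
        ContinuousAt.comp (f := fun θ => circleMap s 1 θ) h1.continuousAt
          (continuous_circleMap s 1).continuousAt
      have h3 : ContinuousAt (fun θ => (1 / (circleMap s 1 θ - s) ^ 2)) θ := by
        refine continuousAt_const.div (by fun_prop) ?_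
        simp [circleMap]
      have h4 : ContinuousAt (fun θ => deriv (circleMap s 1) θ) θ := by
        simp only [deriv_circleMap]; fun_prop
      exact h4.smul (h3.smul h2)
    · filter_upwards [eventually_ne_atTop 0] with n hn
      refine Eventually.of_forall fun θ _ => ?_
      have hmem := circleMap_mem_closedBall s zero_le_one θ
      have h1 := hre _ hmem
      have h2 := norm_GammaSeq_le (s := circleMap s 1 θ) (by linarith) hn
      have h3 := (le_abs_self _).trans (hM _ ⟨h1.1, h1.2⟩)
      simpa [circleMap] using! h2.trans h3
    · simp
    · refine Eventually.of_forall fun θ _ => ?_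
      exact tendsto_const_nhds.smul (tendsto_const_nhds.smul (GammaSeq_tendsto_Gamma _))
  rw [hC] at hlim
  have h2pi : (2 * Real.pi * I : ℂ) ≠ 0 := by simp [Real.pi_ne_zero]
  have hlim' := hlim.const_smul (2 * Real.pi * I : ℂ)⁻¹
  rw [inv_smul_smul₀ h2pi] at hlim'
  refine hlim'.congr' ?_
  filter_upwards [eventually_ne_atTop 0] with n hn
  have hd : DifferentiableOn ℂ (fun z => GammaSeq z n) (closedBall s 1) := fun z hz =>
    (logDeriv_GammaSeq (by linarith [(hre z hz).1]) hn).1.differentiableWithinAt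
  rw [hd.deriv_eq_smul_circleIntegral one_pos, inv_smul_smul₀ h2pi]

lemma log_add_one_sub_log {w : ℂ} (hw : 2 ≤ w.re) :
    ‖log (w + 1) - log w - w⁻¹‖ ≤ (‖w‖ ^ 2)⁻¹ := by
  have hw0 : w ≠ 0 := by rintro rfl; norm_num at hw
  have hnw : 2 ≤ ‖w‖ := hw.trans ((le_abs_self _).trans (abs_re_le_norm w))
  have hinv : ‖w⁻¹‖ ≤ 1 / 2 := by
    rw [norm_inv, one_div]; exact inv_anti₀ (by norm_num) hnw
  have hre : 0 < (1 + w⁻¹).re := by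
    have := abs_le.1 ((abs_re_le_norm w⁻¹).trans hinv)
    rw [add_re, one_re]; linarith
  have h1 : log (w + 1) = log w + log (1 + w⁻¹) := by
    rw [← log_mul hw0 (by intro h; rw [h] at hre; simp at hre), mul_add, mul_one,
      mul_inv_cancel₀ hw0]
    have a1 := abs_lt.1 (abs_arg_lt_pi_div_two_iff.2 (Or.inl (by linarith : 0 < w.re)))
    have a2 := abs_lt.1 (abs_arg_lt_pi_div_two_iff.2 (Or.inl hre))
    constructor <;> linarith
  rw [h1, add_sub_cancel_left]
  refine (norm_log_one_add_sub_self_le (by linarith)).trans ?_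
  rw [norm_inv, inv_pow] at *
  have h2 : (1 - ‖w‖⁻¹)⁻¹ ≤ 2 := by
    rw [show (2 : ℝ) = (1 / 2)⁻¹ by norm_num]
    exact inv_anti₀ (by norm_num) (by linarith)
  calc (‖w‖ ^ 2)⁻¹ * (1 - ‖w‖⁻¹)⁻¹ / 2 ≤ (‖w‖ ^ 2)⁻¹ * 2 / 2 := by gcongr
    _ = _ := by ring

/-- Telescoping: the `j`-th error is at most `1 / |s + j|² ≤ 1 / (j + 1) - 1 / (j + 2)`. -/
lemma norm_log_sub_sum_inv_le {s : ℂ} (hs : 2 ≤ s.re) (n : ℕ) :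
    ‖log (s + n) - log s - ∑ j ∈ Finset.range n, (s + j)⁻¹‖ ≤ 1 - 1 / (n + 1) := by
  induction n with
  | zero => simp
  | succ n ih =>
    have hn : (0 : ℝ) ≤ n := n.cast_nonneg
    have h1 := log_add_one_sub_log (w := s + n) (by simp; linarith)
    have h2 : (n + 2 : ℝ) ≤ ‖s + n‖ := by
      refine le_trans ?_ ((le_abs_self _).trans (abs_re_le_norm _))
      simp; linarith
    have h3 : (‖s + n‖ ^ 2)⁻¹ ≤ 1 / (n + 1) - 1 / (n + 1 + 1) := by
      calc (‖s + n‖ ^ 2)⁻¹ ≤ ((n + 2 : ℝ) ^ 2)⁻¹ := by gcongr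
        _ ≤ _ := by
          rw [div_sub_div _ _ (by positivity) (by positivity), inv_eq_one_div,
            div_le_div_iff₀ (by positivity) (by positivity)]
          nlinarith
    rw [Finset.sum_range_succ]
    have : log (s + (n + 1 : ℕ)) - log s - (∑ j ∈ Finset.range n, (s + j)⁻¹ + (s + n)⁻¹)
        = (log (s + n) - log s - ∑ j ∈ Finset.range n, (s + j)⁻¹)
          + (log (s + n + 1) - log (s + n) - (s + n)⁻¹) := by
      push_cast; rw [add_assoc s]; ring
    rw [this]
    refine (norm_add_le _ _).trans ?_
    push_cast
    linarith

lemma tendsto_log_sub_log (s : ℂ) :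
    Tendsto (fun n : ℕ => log n - log (s + (n + 1 : ℕ))) atTop (𝓝 0) := by
  have h1 : Tendsto (fun n : ℕ => 1 + (s + 1) * ((n : ℂ))⁻¹) atTop (𝓝 1) := by
    have : Tendsto (fun n : ℕ => ((n : ℂ))⁻¹) atTop (𝓝 0) :=
      tendsto_inv_atTop_nhds_zero_nat (𝕜 := ℂ)
    simpa using (this.const_mul (s + 1)).const_add 1
  have h2 : Tendsto (fun n : ℕ => log (1 + (s + 1) * ((n : ℂ))⁻¹)) atTop (𝓝 0) := by
    rw [← log_one]
    exact (continuousAt_clog one_mem_slitPlane).tendsto.comp h1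
  have h3 := h2.neg
  rw [neg_zero] at h3
  refine h3.congr' ?_
  filter_upwards [eventually_gt_atTop 0, h1.eventually_ne one_ne_zero] with n hn hne
  have hn' : (0 : ℝ) < n := by exact_mod_cast hn
  have hn0 : (n : ℂ) ≠ 0 := by exact_mod_cast hn.ne'
  have : s + (n + 1 : ℕ) = ((n : ℝ) : ℂ) * (1 + (s + 1) * ((n : ℂ))⁻¹) := by
    push_cast; field_simp; ring
  rw [this, log_ofReal_mul hn' hne, ofReal_log hn'.le]
  push_cast; ring

/-- The logarithmic derivative of Euler's product is `log n - ∑ 1 / (s + j)`, the sum is `log (s + n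
+ 1) - log s` up to `1`, and `log n - log (s + n + 1)` tends to zero. -/
lemma norm_logDeriv_Gamma_sub_log_le {s : ℂ} (hs : 2 ≤ s.re) :
    ‖logDeriv Gamma s - log s‖ ≤ 1 := by
  have hG : Gamma s ≠ 0 := Gamma_ne_zero_of_re_pos (by linarith)
  have h1 : Tendsto (fun n : ℕ => logDeriv (fun z => GammaSeq z n) s) atTop
      (𝓝 (logDeriv Gamma s)) := by
    simp only [logDeriv_apply]
    exact (tendsto_deriv_GammaSeq hs).div (GammaSeq_tendsto_Gamma s) hG
  have h2 : Tendsto (fun n : ℕ => logDeriv (fun z => GammaSeq z n) s - log s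
      - (log n - log (s + (n + 1 : ℕ)))) atTop (𝓝 (logDeriv Gamma s - log s)) := by
    simpa using (h1.sub_const (log s)).sub (tendsto_log_sub_log s)
  refine le_of_tendsto h2.norm ?_
  filter_upwards [eventually_ne_atTop 0] with n hn
  rw [(logDeriv_GammaSeq (by linarith) hn).2.2]
  have h3 := norm_log_sub_sum_inv_le hs (n + 1)
  have : log n - ∑ j ∈ Finset.range (n + 1), (s + j)⁻¹ - log s - (log n - log (s + (n + 1 : ℕ)))
      = log (s + (n + 1 : ℕ)) - log s - ∑ j ∈ Finset.range (n + 1), (s + j)⁻¹ := by ring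
  rw [this]
  refine h3.trans ?_
  have : (0 : ℝ) ≤ 1 / ((n + 1 : ℕ) + 1) := by positivity
  linarith

/-! ### Trigonometric bounds away from the real axis -/

lemma norm_cos_le_cosh (w : ℂ) : ‖cos w‖ ≤ Real.cosh w.im := by
  rw [cos, Real.cosh_eq, norm_div, Complex.norm_ofNat]
  gcongr
  refine (norm_add_le _ _).trans ?_
  rw [norm_exp, norm_exp]
  simp [add_comm]

lemma norm_sin_le_cosh (w : ℂ) : ‖sin w‖ ≤ Real.cosh w.im := by
  rw [sin, Real.cosh_eq, norm_div, Complex.norm_ofNat, norm_mul, norm_I, mul_one]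
  gcongr
  refine (norm_sub_le _ _).trans ?_
  rw [norm_exp, norm_exp]
  simp

lemma abs_sinh_le_norm_cos (w : ℂ) : |Real.sinh w.im| ≤ ‖cos w‖ := by
  rw [cos, Real.sinh_eq, norm_div, Complex.norm_ofNat, abs_div, abs_of_pos (two_pos (α := ℝ))]
  gcongr
  have h := abs_norm_sub_norm_le (exp (w * I)) (-exp (-w * I))
  rw [sub_neg_eq_add, norm_neg, norm_exp, norm_exp, abs_sub_comm] at h
  simpa using h

lemma cosh_le_mul_abs_sinh {y₀ y : ℝ} (hy₀ : 0 < y₀) (hy : y₀ ≤ |y|) :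
    Real.cosh y ≤ (1 + 1 / Real.sinh y₀) * |Real.sinh y| := by
  have hs0 : 0 < Real.sinh y₀ := Real.sinh_pos_iff.2 hy₀
  have h1 : Real.sinh y₀ ≤ |Real.sinh y| := by
    rw [Real.abs_sinh]; exact Real.sinh_le_sinh.2 hy
  have h2 : Real.cosh y - |Real.sinh y| ≤ 1 := by
    rw [Real.abs_sinh, ← Real.cosh_abs, Real.cosh_sub_sinh]
    exact Real.exp_le_one_iff.2 (by simp)
  have h3 : 1 ≤ 1 / Real.sinh y₀ * |Real.sinh y| := by
    rw [div_mul_eq_mul_div, one_mul, one_le_div hs0]; exact h1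
  linarith

lemma norm_sin_div_cos_le {y₀ : ℝ} (hy₀ : 0 < y₀) {w : ℂ} (hw : y₀ ≤ |w.im|) :
    cos w ≠ 0 ∧ ‖sin w / cos w‖ ≤ 1 + 1 / Real.sinh y₀ := by
  have hs0 : 0 < Real.sinh y₀ := Real.sinh_pos_iff.2 hy₀
  have h1 : Real.sinh y₀ ≤ |Real.sinh w.im| := by
    rw [Real.abs_sinh]; exact Real.sinh_le_sinh.2 hw
  have h2 := abs_sinh_le_norm_cos w
  have h3 : 0 < ‖cos w‖ := by linarith
  refine ⟨norm_pos_iff.1 h3, ?_⟩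
  rw [norm_div, div_le_iff₀ h3]
  refine (norm_sin_le_cosh w).trans ((cosh_le_mul_abs_sinh hy₀ hw).trans ?_)
  gcongr

/-! ### The Gamma function on vertical lines -/

/-- The reflection formula at `it`, where `Γ (1 - it)` is the conjugate of `Γ (1 + it)`. -/
lemma norm_Gamma_one_add_mul_I_sq {t : ℝ} (ht : t ≠ 0) :
    ‖Gamma (1 + t * I)‖ ^ 2 = Real.pi * t / Real.sinh (Real.pi * t) := by
  have htI : (t * I : ℂ) ≠ 0 := by simp [ht]
  have h1 := Gamma_mul_Gamma_one_sub (t * I)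
  have h2 : Gamma (1 + t * I) = t * I * Gamma (t * I) := by
    rw [add_comm, Gamma_add_one _ htI]
  have h3 : Gamma (1 - t * I) = (starRingEnd ℂ) (Gamma (1 + t * I)) := by
    rw [← Gamma_conj]; simp [sub_eq_add_neg]
  have h4 : Gamma (1 + t * I) * (starRingEnd ℂ) (Gamma (1 + t * I))
      = Real.pi * t / Real.sinh (Real.pi * t) := by
    rw [← h3, h2, mul_assoc, h1, show (Real.pi * (t * I) : ℂ) = (Real.pi * t : ℂ) * I by ring,
      sin_mul_I]
    have hsinh : sinh (Real.pi * t : ℂ) ≠ 0 := by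
      have : Real.sinh (Real.pi * t) ≠ 0 := by
        rw [Ne, Real.sinh_eq_zero]; simp [ht, Real.pi_ne_zero]
      exact_mod_cast this
    push_cast
    field_simp
  rw [mul_conj, normSq_eq_norm_sq] at h4
  exact_mod_cast h4

/-- In the functional equation `Γ s` comes multiplied by `cos (πs/2)`, of size `cosh (πt/2)`; the
exponentials cancel. The double-angle formula turns this into an identity, and comparing `cosh` with
`|sinh|` gives both the lower and the upper bound. -/
lemma norm_Gamma_mul_cosh_sq {t : ℝ} (ht : t ≠ 0) :
    (‖Gamma (1 + t * I)‖ * Real.cosh (Real.pi * t / 2)) ^ 2 * |Real.sinh (Real.pi * t / 2)|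
      = Real.pi * |t| / 2 * Real.cosh (Real.pi * t / 2) := by
  have hs : Real.sinh (Real.pi * t / 2) ≠ 0 := by
    rw [Ne, Real.sinh_eq_zero]; simp [ht, Real.pi_ne_zero]
  have hc : 0 < Real.cosh (Real.pi * t / 2) := Real.cosh_pos _
  have h2 : Real.sinh (Real.pi * t)
      = 2 * Real.sinh (Real.pi * t / 2) * Real.cosh (Real.pi * t / 2) := by
    rw [← Real.sinh_two_mul]; congr 1; ring
  rw [mul_pow, norm_Gamma_one_add_mul_I_sq ht, h2]
  rcases lt_or_gt_of_ne ht with h | h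
  · have h5 : Real.sinh (Real.pi * t / 2) < 0 := by
      rw [Real.sinh_neg_iff]; have := Real.pi_pos; nlinarith
    rw [abs_of_neg h5, abs_of_neg h]
    field_simp
  · have h5 : 0 < Real.sinh (Real.pi * t / 2) := by
      rw [Real.sinh_pos_iff]; positivity
    rw [abs_of_pos h5, abs_of_pos h]
    field_simp

lemma le_norm_Gamma_mul_cosh {t : ℝ} (ht : t ≠ 0) :
    Real.pi * |t| / 2 ≤ (‖Gamma (1 + t * I)‖ * Real.cosh (Real.pi * t / 2)) ^ 2 := by
  have h := norm_Gamma_mul_cosh_sq ht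
  have hs : 0 < |Real.sinh (Real.pi * t / 2)| := by
    rw [abs_pos, Ne, Real.sinh_eq_zero]; simp [ht, Real.pi_ne_zero]
  have hle : |Real.sinh (Real.pi * t / 2)| ≤ Real.cosh (Real.pi * t / 2) := by
    rw [Real.abs_sinh, ← Real.cosh_abs]; exact (Real.sinh_lt_cosh _).le
  refine le_of_mul_le_mul_right ?_ hs
  rw [h]
  have := Real.pi_pos
  gcongr

lemma norm_Gamma_mul_cosh_le {t t₀ : ℝ} (ht₀ : 0 < t₀) (ht : t₀ ≤ |t|) :
    (‖Gamma (1 + t * I)‖ * Real.cosh (Real.pi * t / 2)) ^ 2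
      ≤ Real.pi * |t| / 2 * (1 + 1 / Real.sinh (Real.pi * t₀ / 2)) := by
  have ht0 : t ≠ 0 := abs_pos.1 (ht₀.trans_le ht)
  have h := norm_Gamma_mul_cosh_sq ht0
  have hpi := Real.pi_pos
  have hs : 0 < |Real.sinh (Real.pi * t / 2)| := by
    rw [abs_pos, Ne, Real.sinh_eq_zero]; simp [ht0, Real.pi_ne_zero]
  have hle := cosh_le_mul_abs_sinh (y₀ := Real.pi * t₀ / 2) (y := Real.pi * t / 2) (by positivity)
    (by rw [abs_div, abs_mul, abs_of_pos hpi, abs_of_pos (two_pos (α := ℝ))]; gcongr)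
  refine le_of_mul_le_mul_right ?_ hs
  rw [h, mul_assoc]
  gcongr

lemma norm_Gamma_one_add_le (n : ℕ) (t : ℝ) (ht : t ≠ 0) :
    ‖Gamma (1 + t * I)‖ ≤ ‖Gamma ((n + 1 : ℕ) + t * I)‖ := by
  induction n with
  | zero => simp
  | succ n ih =>
    have hne : ((n + 1 : ℕ) + t * I : ℂ) ≠ 0 := by
      intro h; have := congrArg Complex.im h; simp at this; exact ht this
    have : ((n + 1 + 1 : ℕ) + t * I : ℂ) = ((n + 1 : ℕ) + t * I : ℂ) + 1 := by push_cast; ring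
    rw [this, Gamma_add_one _ hne, norm_mul]
    refine ih.trans (le_mul_of_one_le_left (norm_nonneg _) ?_)
    refine le_trans ?_ ((le_abs_self _).trans (abs_re_le_norm _))
    simp

/-! ### Growth along horizontal segments -/

/-- `|g|² * exp (-2κu)` is nondecreasing in `u`: its derivative is a positive multiple of `Re (g' /
g) - κ`. -/
lemma norm_mul_exp_le_of_re_logDeriv_ge {g : ℂ → ℂ} {a b t κ : ℝ} (hab : a ≤ b)
    (hd : ∀ u ∈ Icc a b, DifferentiableAt ℂ g (u + t * I))
    (h0 : ∀ u ∈ Icc a b, g (u + t * I) ≠ 0)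
    (hre : ∀ u ∈ Icc a b, κ ≤ (deriv g (u + t * I) / g (u + t * I)).re) :
    ‖g (a + t * I)‖ * Real.exp (κ * (b - a)) ≤ ‖g (b + t * I)‖ := by
  set N : ℝ → ℝ := fun u => ‖g (u + t * I)‖ ^ 2 * Real.exp (-(2 * κ) * u)
  have hN : ∀ u ∈ Icc a b, HasDerivAt N
      (2 * ‖g (u + t * I)‖ ^ 2 * Real.exp (-(2 * κ) * u)
        * ((deriv g (u + t * I) / g (u + t * I)).re - κ)) u := by
    intro u hu
    have h1 : HasDerivAt (fun u : ℝ => (u + t * I : ℂ)) 1 u :=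
      (hasDerivAt_id u).ofReal_comp.add_const _
    have h2 : HasDerivAt (fun u : ℝ => g (u + t * I)) (deriv g (u + t * I)) u := by
      have := (hd u hu).hasDerivAt.comp_of_eq u h1 rfl
      rw [mul_one] at this
      exact this
    have h3 := h2.norm_sq
    have h4 : HasDerivAt (fun u : ℝ => Real.exp (-(2 * κ) * u))
        (Real.exp (-(2 * κ) * u) * (-(2 * κ) * 1)) u := ((hasDerivAt_id u).const_mul _).exp
    refine (h3.mul h4).congr_deriv ?_
    have h5 : inner ℝ (g (u + t * I)) (deriv g (u + t * I))
        = ‖g (u + t * I)‖ ^ 2 * (deriv g (u + t * I) / g (u + t * I)).re := by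
      have hg := h0 u hu
      rw [Complex.inner, ← re_ofReal_mul]
      congr 1
      rw [ofReal_pow, ← Complex.mul_conj']
      field_simp
    rw [h5]; ring
  have hmono : MonotoneOn N (Icc a b) := by
    refine monotoneOn_of_deriv_nonneg (convex_Icc a b)
      (fun u hu => (hN u hu).continuousAt.continuousWithinAt)
      (fun u hu => (hN u (interior_subset hu)).differentiableAt.differentiableWithinAt)
      fun u hu => ?_
    have hu' := interior_subset hu
    rw [(hN u hu').deriv]
    have := hre u hu'
    exact mul_nonneg (by positivity) (by linarith)
  have h := hmono (left_mem_Icc.2 hab) (right_mem_Icc.2 hab) hab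
  simp only [N] at h
  rw [← sq_le_sq₀ (by positivity) (by positivity), mul_pow, ← Real.exp_nat_mul]
  have h6 : Real.exp ((2 : ℕ) * (κ * (b - a)))
      = Real.exp (-(2 * κ) * a) * Real.exp (2 * κ * b) := by
    rw [← Real.exp_add]; congr 1; push_cast; ring
  rw [h6, ← mul_assoc]
  calc _ ≤ ‖g (b + t * I)‖ ^ 2 * Real.exp (-(2 * κ) * b) * Real.exp (2 * κ * b) := by gcongr
    _ = _ := by rw [mul_assoc, ← Real.exp_add]; simp

lemma norm_le_mul_exp_of_re_logDeriv_le {g : ℂ → ℂ} {a b t κ : ℝ} (hab : a ≤ b)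
    (hd : ∀ u ∈ Icc a b, DifferentiableAt ℂ g (u + t * I))
    (h0 : ∀ u ∈ Icc a b, g (u + t * I) ≠ 0)
    (hre : ∀ u ∈ Icc a b, (deriv g (u + t * I) / g (u + t * I)).re ≤ κ) :
    ‖g (b + t * I)‖ ≤ ‖g (a + t * I)‖ * Real.exp (κ * (b - a)) := by
  have h := norm_mul_exp_le_of_re_logDeriv_ge (g := fun z => (g z)⁻¹) (κ := -κ) hab
    (fun u hu => (hd u hu).inv (h0 u hu)) (fun u hu => inv_ne_zero (h0 u hu)) (fun u hu => by
      have h1 : deriv (fun z => (g z)⁻¹) (u + t * I) / (g (u + t * I))⁻¹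
          = -(deriv g (u + t * I) / g (u + t * I)) := by
        have := h0 u hu
        have hinv : HasDerivAt (fun z => (g z)⁻¹) _ (u + t * I) := (hd u hu).hasDerivAt.inv this
        rw [hinv.deriv]
        field_simp
      rw [h1, neg_re]
      exact neg_le_neg (hre u hu))
  have ha : 0 < ‖g (a + t * I)‖ := norm_pos_iff.2 (h0 a (left_mem_Icc.2 hab))
  have hb : 0 < ‖g (b + t * I)‖ := norm_pos_iff.2 (h0 b (right_mem_Icc.2 hab))
  rw [norm_inv, norm_inv, neg_mul, Real.exp_neg, ← mul_inv] at h
  exact (inv_le_inv₀ (by positivity) hb).1 h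

/-! ### The reflected zeta function in a right half-plane -/

lemma exists_norm_LSeries_le {f : ℕ → ℂ} (hf : LSeriesSummable f 2) :
    ∃ M : ℝ, 0 < M ∧ ∀ s : ℂ, 2 ≤ s.re → ‖LSeries f s‖ ≤ M := by
  refine ⟨(∑' n, ‖LSeries.term f 2 n‖) + 1, ?_, fun s hs => ?_⟩
  · have : 0 ≤ ∑' n, ‖LSeries.term f 2 n‖ := tsum_nonneg fun _ => norm_nonneg _
    linarith
  · have h1 : ∀ n, ‖LSeries.term f s n‖ ≤ ‖LSeries.term f 2 n‖ := fun n =>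
      LSeries.norm_term_le_of_re_le_re f (by simpa using hs) n
    have h2 : Summable fun n => ‖LSeries.term f s n‖ :=
      Summable.of_nonneg_of_le (fun _ => norm_nonneg _) h1 hf.norm
    have h3 := (norm_tsum_le_tsum_norm h2).trans (h2.tsum_le_tsum h1 hf.norm)
    exact h3.trans (by linarith)

lemma exists_norm_logDeriv_zeta_le :
    ∃ M : ℝ, 0 < M ∧ ∀ s : ℂ, 2 ≤ s.re → ‖logDeriv riemannZeta s‖ ≤ M := by
  obtain ⟨M, hM, h⟩ := exists_norm_LSeries_le
    (ArithmeticFunction.LSeriesSummable_vonMangoldt (s := 2) (by norm_num))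
  refine ⟨M, hM, fun s hs => ?_⟩
  have h1 := h s hs
  rw [ArithmeticFunction.LSeries_vonMangoldt_eq_deriv_riemannZeta_div (by linarith), neg_div,
    norm_neg] at h1
  exact h1

/-- `1 / ζ` is the Dirichlet series of the Möbius function, bounded for `Re s ≥ 2`. -/
lemma exists_le_norm_zeta : ∃ c : ℝ, 0 < c ∧ ∀ s : ℂ, 2 ≤ s.re → c ≤ ‖riemannZeta s‖ := by
  obtain ⟨M, hM, h⟩ := exists_norm_LSeries_le
    (ArithmeticFunction.LSeriesSummable_moebius_iff.2 (by norm_num : 1 < (2 : ℂ).re))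
  refine ⟨M⁻¹, by positivity, fun s hs => ?_⟩
  have h1 := LSeries_one_mul_Lseries_moebius (s := s) (by linarith)
  rw [LSeries_one_eq_riemannZeta (by linarith)] at h1
  have h2 : ‖riemannZeta s‖ * ‖LSeries (fun n => (ArithmeticFunction.moebius n : ℂ)) s‖ = 1 := by
    rw [← norm_mul, h1, norm_one]
  rw [inv_le_iff_one_le_mul₀ hM, ← h2]
  gcongr
  exact h s hs

/-- The function `s ↦ ζ (1 - s)`. -/
noncomputable def reflZeta (s : ℂ) : ℂ := riemannZeta (1 - s)

lemma ne_of_im_neg {s : ℂ} (hs : s.im < 0) (r : ℝ) : s ≠ r := by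
  rintro rfl; simp at hs

lemma reflZeta_eq {s : ℂ} (hs : s.im < 0) :
    reflZeta s = 2 * (2 * Real.pi : ℂ) ^ (-s) * Gamma s * cos (Real.pi * s / 2) * riemannZeta s :=
  riemannZeta_one_sub (fun n => by simpa using ne_of_im_neg hs (-n))
    (by simpa using ne_of_im_neg hs 1)

lemma half_pi_mul_im (s : ℂ) : (Real.pi * s / 2 : ℂ).im = Real.pi * s.im / 2 := by
  rw [show (Real.pi * s / 2 : ℂ) = ((Real.pi / 2 : ℝ) : ℂ) * s by push_cast; ring, im_ofReal_mul]
  ring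

lemma pi_div_eight_le_abs {s : ℂ} (hs : s.im ≤ -(1 / 4)) :
    Real.pi / 8 ≤ |(Real.pi * s / 2 : ℂ).im| := by
  have := Real.pi_pos
  rw [half_pi_mul_im, abs_of_nonpos (by nlinarith)]
  nlinarith

lemma logDeriv_reflZeta {s : ℂ} (hre : 2 ≤ s.re) (him : s.im ≤ -(1 / 4)) :
    reflZeta s ≠ 0 ∧ logDeriv reflZeta s = -log (2 * Real.pi) + logDeriv Gamma s
      - Real.pi / 2 * (sin (Real.pi * s / 2) / cos (Real.pi * s / 2)) + logDeriv riemannZeta s := by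
  have him0 : s.im < 0 := by linarith
  have h2pi : (2 * Real.pi : ℂ) ≠ 0 := by simp [Real.pi_ne_zero]
  have hG : Gamma s ≠ 0 := Gamma_ne_zero_of_re_pos (by linarith)
  have hcos : cos (Real.pi * s / 2) ≠ 0 :=
    (norm_sin_div_cos_le (by positivity) (pi_div_eight_le_abs him)).1
  have hz : riemannZeta s ≠ 0 := riemannZeta_ne_zero_of_one_le_re (by linarith)
  have hpow : 2 * (2 * Real.pi : ℂ) ^ (-s) ≠ 0 :=
    mul_ne_zero two_ne_zero (by rw [Ne, cpow_eq_zero_iff]; simp [Real.pi_ne_zero])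
  have hdpow : HasDerivAt (fun z : ℂ => 2 * (2 * Real.pi : ℂ) ^ (-z))
      (2 * ((2 * Real.pi : ℂ) ^ (-s) * log (2 * Real.pi) * -1)) s :=
    (((hasDerivAt_id s).neg).const_cpow (Or.inl h2pi)).const_mul _
  have hdG : DifferentiableAt ℂ Gamma s :=
    differentiableAt_Gamma s fun m => by simpa using ne_of_im_neg him0 (-m)
  have hdcos : HasDerivAt (fun z : ℂ => cos (Real.pi * z / 2))
      (-sin (Real.pi * s / 2) * (Real.pi * 1 / 2)) s :=
    (((hasDerivAt_id s).const_mul (Real.pi : ℂ)).div_const 2).ccos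
  have hdz : DifferentiableAt ℂ riemannZeta s :=
    differentiableAt_riemannZeta (by simpa using ne_of_im_neg him0 1)
  constructor
  · rw [reflZeta_eq him0]
    exact mul_ne_zero (mul_ne_zero (mul_ne_zero hpow hG) hcos) hz
  have heq : reflZeta =ᶠ[𝓝 s] fun z => 2 * (2 * Real.pi : ℂ) ^ (-z) * Gamma z
      * cos (Real.pi * z / 2) * riemannZeta z := by
    filter_upwards [(isOpen_lt continuous_im continuous_const).mem_nhds him0] with z hz
    exact reflZeta_eq hz
  have h1 : logDeriv reflZeta s = logDeriv (fun z => 2 * (2 * Real.pi : ℂ) ^ (-z) * Gamma z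
      * cos (Real.pi * z / 2) * riemannZeta z) s := by
    rw [logDeriv_apply, logDeriv_apply, heq.deriv_eq, heq.eq_of_nhds]
  rw [h1, logDeriv_mul (f := fun z => 2 * (2 * Real.pi : ℂ) ^ (-z) * Gamma z
      * cos (Real.pi * z / 2)) s (mul_ne_zero (mul_ne_zero hpow hG) hcos) hz
      ((hdpow.differentiableAt.mul hdG).mul hdcos.differentiableAt) hdz,
    logDeriv_mul (f := fun z => 2 * (2 * Real.pi : ℂ) ^ (-z) * Gamma z) s (mul_ne_zero hpow hG)
      hcos (hdpow.differentiableAt.mul hdG) hdcos.differentiableAt,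
    logDeriv_mul (f := fun z => 2 * (2 * Real.pi : ℂ) ^ (-z)) s hpow hG hdpow.differentiableAt hdG]
  have h2 : logDeriv (fun z : ℂ => 2 * (2 * Real.pi : ℂ) ^ (-z)) s = -log (2 * Real.pi) := by
    rw [logDeriv_apply, hdpow.deriv, div_eq_iff hpow]; ring
  have h3 : logDeriv (fun z : ℂ => cos (Real.pi * z / 2)) s
      = -(Real.pi / 2 * (sin (Real.pi * s / 2) / cos (Real.pi * s / 2))) := by
    rw [logDeriv_apply, hdcos.deriv]; ring
  rw [h2, h3]
  ring

lemma exists_norm_logDeriv_reflZeta_sub_log_le :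
    ∃ C : ℝ, 0 < C ∧ ∀ s : ℂ, 2 ≤ s.re → s.im ≤ -(1 / 4) →
      ‖logDeriv reflZeta s - log s‖ ≤ C := by
  obtain ⟨M, hM, h⟩ := exists_norm_logDeriv_zeta_le
  set κ : ℝ := 1 + 1 / Real.sinh (Real.pi / 8)
  refine ⟨‖log (2 * Real.pi)‖ + 1 + ‖(Real.pi / 2 : ℂ)‖ * κ + M, ?_, fun s hre him => ?_⟩
  · have : 0 < Real.sinh (Real.pi / 8) := Real.sinh_pos_iff.2 (by positivity)
    positivity
  · rw [(logDeriv_reflZeta hre him).2]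
    have h1 := norm_logDeriv_Gamma_sub_log_le hre
    have h2 := (norm_sin_div_cos_le (by positivity) (pi_div_eight_le_abs him)).2
    have h3 := h s hre
    have : -log (2 * Real.pi) + logDeriv Gamma s
        - Real.pi / 2 * (sin (Real.pi * s / 2) / cos (Real.pi * s / 2)) + logDeriv riemannZeta s
        - log s = -log (2 * Real.pi) + (logDeriv Gamma s - log s)
        + -(Real.pi / 2 * (sin (Real.pi * s / 2) / cos (Real.pi * s / 2)))
        + logDeriv riemannZeta s := by ring
    rw [this]
    refine norm_add_le_of_le (norm_add_le_of_le (norm_add_le_of_le ?_ h1) ?_) h3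
    · rw [norm_neg]
    · rw [norm_neg, norm_mul]
      gcongr

/-- Supplies the starting line from which the lower bound is carried to the right by integrating the
logarithmic derivative. The constant `π / 8` is `π|t| / 2` at `|t| = 1/4`. -/
lemma exists_le_norm_reflZeta {n : ℕ} (hn : 2 ≤ n) :
    ∃ c : ℝ, 0 < c ∧ ∀ t : ℝ, t ≤ -(1 / 4) → c ≤ ‖reflZeta (n + t * I)‖ := by
  obtain ⟨cz, hcz, hz⟩ := exists_le_norm_zeta
  have hs0 : 0 < Real.sinh (Real.pi / 8) := Real.sinh_pos_iff.2 (by positivity)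
  set κ : ℝ := 1 + 1 / Real.sinh (Real.pi / 8)
  have hκ : 0 < κ := by positivity
  refine ⟨2 * (2 * Real.pi) ^ (-(n : ℝ)) * (Real.sqrt (Real.pi / 8) / κ) * cz, by positivity,
    fun t ht => ?_⟩
  set s : ℂ := n + t * I with hs
  have hre : s.re = n := by simp [hs]
  have him : s.im = t := by simp [hs]
  have ht0 : t ≠ 0 := by linarith
  rw [reflZeta_eq (by rw [him]; linarith)]
  have h1 : ‖2 * (2 * Real.pi : ℂ) ^ (-s)‖ = 2 * (2 * Real.pi) ^ (-(n : ℝ)) := by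
    have := norm_cpow_eq_rpow_re_of_pos (x := 2 * Real.pi) (by positivity) (-s)
    rw [neg_re, hre] at this
    rw [norm_mul, Complex.norm_ofNat, ← this]
    push_cast; rfl
  have h2 : Real.sqrt (Real.pi / 8) / κ ≤ ‖Gamma s‖ * ‖cos (Real.pi * s / 2)‖ := by
    rw [div_le_iff₀ hκ]
    have h3 := norm_Gamma_one_add_le (n - 1) t ht0
    rw [show n - 1 + 1 = n by omega] at h3
    have h4 := cosh_le_mul_abs_sinh (by positivity) (pi_div_eight_le_abs (s := s) (by linarith))
    have h5 := abs_sinh_le_norm_cos (Real.pi * s / 2)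
    have h6 : Real.sqrt (Real.pi / 8)
        ≤ ‖Gamma (1 + t * I)‖ * Real.cosh (Real.pi * t / 2) := by
      refine Real.sqrt_le_iff.2 ⟨mul_nonneg (norm_nonneg _) (Real.cosh_pos _).le,
        le_trans ?_ (le_norm_Gamma_mul_cosh ht0)⟩
      rw [abs_of_nonpos (by linarith)]
      nlinarith [Real.pi_pos]
    rw [half_pi_mul_im, him] at h4 h5
    calc Real.sqrt (Real.pi / 8)
        ≤ ‖Gamma (1 + t * I)‖ * Real.cosh (Real.pi * t / 2) := h6
      _ ≤ ‖Gamma s‖ * (κ * ‖cos (Real.pi * s / 2)‖) := by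
        refine mul_le_mul h3 (h4.trans ?_) (Real.cosh_pos _).le (norm_nonneg _)
        gcongr
      _ = _ := by ring
  rw [norm_mul, mul_assoc _ (Gamma s), norm_mul, h1, norm_mul (Gamma s)]
  gcongr
  exact hz s (by rw [hre]; exact_mod_cast hn)

/-! ### Derivatives of the reflected zeta function in a right half-plane -/

lemma analyticOnNhd_reflZeta : AnalyticOnNhd ℂ reflZeta {s | s.im < 0} := by
  refine DifferentiableOn.analyticOnNhd (fun s hs => ?_) (isOpen_lt continuous_im continuous_const)
  have h1 : (1 : ℂ) - s ≠ 1 := fun h => by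
    have := ne_of_im_neg (s := s) hs 0
    simp_all
  exact ((differentiableAt_riemannZeta h1).comp s
    (differentiableAt_id.const_sub 1)).differentiableWithinAt

/-- On every `{s | σ ≤ Re s, Im s ≤ -η}` with `η > 1 / 4` and `σ` large, `g` grows
exponentially and `g' / g` differs from `log` by a bounded quantity. -/
def LogDerivLikeLog (g : ℂ → ℂ) : Prop :=
  ∀ η > (1 / 4 : ℝ), ∃ σ C c : ℝ, 1 ≤ σ ∧ 0 < C ∧ 0 < c ∧ ∀ s : ℂ, σ ≤ s.re → s.im ≤ -η →
    g s ≠ 0 ∧ ‖logDeriv g s - log s‖ ≤ C ∧ c * Real.exp s.re ≤ ‖g s‖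

lemma le_re_of_norm_sub_log_le {q s : ℂ} {C : ℝ} (hs : Real.exp (C + 1) ≤ s.re)
    (h : ‖q - log s‖ ≤ C) : 1 ≤ q.re := by
  have h1 := (abs_le.1 ((abs_re_le_norm (q - log s)).trans h)).1
  rw [sub_re, log_re] at h1
  have h2 : C + 1 ≤ Real.log ‖s‖ :=
    (Real.le_log_iff_exp_le ((Real.exp_pos _).trans_le (hs.trans (re_le_norm s)))).2
      (hs.trans (re_le_norm s))
  linarith

lemma logDerivLikeLog_reflZeta : LogDerivLikeLog reflZeta := by
  intro η hη
  obtain ⟨C, hC, h⟩ := exists_norm_logDeriv_reflZeta_sub_log_le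
  obtain ⟨n, hn⟩ := exists_nat_ge (max 2 (Real.exp (C + 1)))
  have hn2 : 2 ≤ n := by exact_mod_cast (le_max_left _ _).trans hn
  have hn2' : (2 : ℝ) ≤ n := by exact_mod_cast hn2
  obtain ⟨c, hc, hb⟩ := exists_le_norm_reflZeta hn2
  refine ⟨n, C, c * Real.exp (-n), by linarith, hC, by positivity, fun s hre him => ?_⟩
  have him' : s.im ≤ -(1 / 4) := by linarith
  refine ⟨(logDeriv_reflZeta (by linarith) him').1, h s (by linarith) him', ?_⟩
  have hu : ∀ u ∈ Icc (n : ℝ) s.re, 2 ≤ (u + s.im * I : ℂ).re ∧ (u + s.im * I : ℂ).im ≤ -(1 / 4) :=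
    fun u hu => by
      have := hu.1
      constructor
      · simp; linarith
      · simp; linarith
  have key := norm_mul_exp_le_of_re_logDeriv_ge (g := reflZeta) (t := s.im) (κ := 1) hre
    (fun u hu' => (analyticOnNhd_reflZeta _ (by
      have := (hu u hu').2; simp only [mem_ofPred_eq]; linarith)).differentiableAt)
    (fun u hu' => (logDeriv_reflZeta (hu u hu').1 (hu u hu').2).1) (fun u hu' => by
      refine le_re_of_norm_sub_log_le (s := u + s.im * I) ?_ (h _ (hu u hu').1 (hu u hu').2)
      have := (le_max_right _ _).trans hn
      have := hu'.1
      simp; linarith)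
  rw [re_add_im, ofReal_natCast] at key
  refine le_trans ?_ key
  rw [mul_assoc, ← Real.exp_add, one_mul, neg_add_eq_sub]
  gcongr
  exact hb _ him'

/-- Let `Q = g' / g`, so `g' = Q * g` and the logarithmic derivative of `g'` is `Q + Q' / Q`. Since
`Q - log` is bounded, Cauchy's estimate bounds `Q'`; far to the right `|Q| ≥ 1`. So `Q' / Q` is
bounded and `|g'| ≥ |g|`. -/
lemma LogDerivLikeLog.deriv {g : ℂ → ℂ} (hg : AnalyticOnNhd ℂ g {s | s.im < 0})
    (h : LogDerivLikeLog g) : LogDerivLikeLog (deriv g) := by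
  intro η hη
  -- The hypothesis is used at the midpoint of `1/4` and `η`, leaving room for Cauchy discs of
  -- radius `r`. This loss at each differentiation is why the property is quantified over all `η >
  -- 1/4`.
  obtain ⟨σ, C, c, hσ, hC, hc, h⟩ := h ((η + 1 / 4) / 2) (by linarith)
  set r : ℝ := min 1 ((η - 1 / 4) / 2) with hr
  have hr0 : 0 < r := lt_min one_pos (by linarith)
  -- The threshold `exp (C + 1)` forces `Re Q ≥ log |s| - C ≥ 1`. The bound `C / r + 1` for `Q'`
  -- adds Cauchy's estimate for `Q - log` and `|1 / s| ≤ 1`.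
  refine ⟨max (σ + 1) (Real.exp (C + 1)), C + (C / r + 1), c, ?_, by positivity, hc,
    fun s hre him => ?_⟩
  · linarith [le_max_left (σ + 1) (Real.exp (C + 1))]
  have hre1 : σ + 1 ≤ s.re := (le_max_left _ _).trans hre
  have hball : ∀ z ∈ closedBall s r, σ ≤ z.re ∧ z.im ≤ -((η + 1 / 4) / 2) := by
    intro z hz
    rw [mem_closedBall, dist_eq] at hz
    have h1 := abs_le.1 ((abs_re_le_norm (z - s)).trans hz)
    have h2 := abs_le.1 ((abs_im_le_norm (z - s)).trans hz)
    rw [sub_re] at h1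
    rw [sub_im] at h2
    have := min_le_left 1 ((η - 1 / 4) / 2)
    have := min_le_right 1 ((η - 1 / 4) / 2)
    constructor <;> linarith
  have hs := hball s (mem_closedBall_self hr0.le)
  have hgd : ∀ z ∈ closedBall s r, DifferentiableAt ℂ (logDeriv g) z := fun z hz => by
    have hz' := hball z hz
    have hz0 : z ∈ {s : ℂ | s.im < 0} := by simp only [mem_ofPred_eq]; linarith
    exact (hg.deriv z hz0).differentiableAt.div (hg z hz0).differentiableAt (h z hz'.1 hz'.2).1
  have hlog : ∀ z ∈ closedBall s r, z ∈ slitPlane := fun z hz =>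
    Or.inl (by linarith [(hball z hz).1])
  have hF : ∀ z ∈ closedBall s r, DifferentiableAt ℂ (fun z => logDeriv g z - log z) z :=
    fun z hz => (hgd z hz).sub (differentiableAt_log (hlog z hz))
  have hsmem := mem_closedBall_self (x := s) hr0.le
  have hQ' : ‖_root_.deriv (logDeriv g) s‖ ≤ C / r + 1 := by
    have h1 : ‖_root_.deriv (fun z => logDeriv g z - log z) s‖ ≤ C / r := by
      refine norm_deriv_le_of_forall_mem_sphere_norm_le hr0 ?_ fun z hz => ?_
      · refine DifferentiableOn.diffContOnCl fun z hz => ?_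
        exact (hF z (closure_ball_subset_closedBall hz)).differentiableWithinAt
      · have hz' := hball z (sphere_subset_closedBall hz)
        exact (h z hz'.1 hz'.2).2.1
    have h2 : HasDerivAt (fun z => logDeriv g z - log z) (_root_.deriv (logDeriv g) s - s⁻¹) s :=
      (hgd s hsmem).hasDerivAt.sub (hasDerivAt_log (hlog s hsmem))
    rw [h2.deriv] at h1
    have h3 : ‖s⁻¹‖ ≤ 1 := by
      rw [norm_inv]
      exact inv_le_one_of_one_le₀ (by linarith [re_le_norm s])
    calc ‖_root_.deriv (logDeriv g) s‖
        = ‖(_root_.deriv (logDeriv g) s - s⁻¹) + s⁻¹‖ := by rw [sub_add_cancel]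
      _ ≤ C / r + 1 := norm_add_le_of_le h1 h3
  obtain ⟨hg0, hQlog, hgc⟩ := h s hs.1 hs.2
  have hQ1 : 1 ≤ ‖logDeriv g s‖ :=
    (le_re_of_norm_sub_log_le ((le_max_right _ _).trans hre) hQlog).trans (re_le_norm _)
  have hQ0 : logDeriv g s ≠ 0 := norm_pos_iff.1 (by linarith)
  have hder : ∀ z, g z ≠ 0 → _root_.deriv g z = logDeriv g z * g z := fun z hz => by
    rw [logDeriv_apply, div_mul_cancel₀ _ hz]
  have hs0 : s ∈ {s : ℂ | s.im < 0} := by simp only [mem_ofPred_eq]; linarith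
  refine ⟨by rw [hder s hg0]; exact mul_ne_zero hQ0 hg0, ?_, ?_⟩
  · have heq : _root_.deriv g =ᶠ[𝓝 s] fun z => logDeriv g z * g z := by
      filter_upwards [(hg s hs0).continuousAt.eventually_ne hg0] with z hz
      exact hder z hz
    have h1 : logDeriv (_root_.deriv g) s = logDeriv (logDeriv g) s + logDeriv g s := by
      rw [← logDeriv_mul s hQ0 hg0 (hgd s hsmem) (hg s hs0).differentiableAt, logDeriv_apply,
        logDeriv_apply, heq.deriv_eq, heq.eq_of_nhds]
    rw [h1, add_sub_assoc, add_comm]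
    refine norm_add_le_of_le hQlog ?_
    rw [logDeriv_apply, norm_div]
    exact (div_le_self (norm_nonneg _) hQ1).trans hQ'
  · rw [hder s hg0, norm_mul]
    exact hgc.trans (le_mul_of_one_le_left (norm_nonneg _) hQ1)

lemma logDerivLikeLog_iteratedDeriv (k : ℕ) : LogDerivLikeLog (iteratedDeriv k reflZeta) := by
  induction k with
  | zero => simpa using logDerivLikeLog_reflZeta
  | succ k ih =>
    rw [iteratedDeriv_succ]
    exact ih.deriv (by
      rw [iteratedDeriv_eq_iterate]; exact analyticOnNhd_reflZeta.iterated_deriv k)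

/-! ### Derivatives of zeta in a left half-plane -/

lemma iteratedDeriv_reflZeta (k : ℕ) (s : ℂ) :
    iteratedDeriv k reflZeta s = (-1) ^ k * zetaD k (1 - s) := by
  have := congrFun (iteratedDeriv_comp_const_sub (n := k) (f := riemannZeta) (s := (1 : ℂ))) s
  exact this

lemma deriv_zetaD_sub (k : ℕ) (a s : ℂ) :
    deriv (fun z => zetaD k z - a) s = zetaD (k + 1) s := by
  rw [deriv_sub_const, zetaD, iteratedDeriv_succ]
  rfl

lemma exists_left_half_plane (k : ℕ) (a : ℂ) :
    ∃ A C : ℝ, 1 ≤ A ∧ 0 < C ∧ ∀ s : ℂ, s.re ≤ -A → 1 ≤ s.im →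
      zetaD k s - a ≠ 0 ∧
        ‖deriv (fun z => zetaD k z - a) s / (zetaD k s - a)‖ ≤ C * Real.log (2 + ‖s‖) := by
  obtain ⟨σ, C, c, hσ, hC, hc, h⟩ := logDerivLikeLog_iteratedDeriv k 1 (by norm_num)
  -- Once `exp (Re w) ≥ M` one has `|ζ^(k)| ≥ 2|a| + 1`, so subtracting `a` at most halves the
  -- modulus.
  set M : ℝ := (2 * ‖a‖ + 1) / c
  have hM : 0 < M := by positivity
  refine ⟨max σ (max 1 (Real.log M)), 2 * (C + Real.pi + 1), le_max_of_le_right (le_max_left _ _),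
    by positivity, fun s hre him => ?_⟩
  set w : ℂ := 1 - s with hw
  have hwre : w.re = 1 - s.re := by simp [hw]
  have hwim : w.im = -s.im := by simp [hw]
  have hm1 := le_max_left σ (max 1 (Real.log M))
  have hm2 := (le_max_right 1 (Real.log M)).trans (le_max_right σ _)
  have hm3 := (le_max_left 1 (Real.log M)).trans (le_max_right σ _)
  obtain ⟨h0, hQ, hlow⟩ := h w (by rw [hwre]; linarith) (by rw [hwim]; linarith)
  have hws : 1 - w = s := by simp [hw]
  have hnorm : ‖iteratedDeriv k reflZeta w‖ = ‖zetaD k s‖ := by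
    rw [iteratedDeriv_reflZeta, hws]; simp
  have hQeq : logDeriv (iteratedDeriv k reflZeta) w = -(zetaD (k + 1) s / zetaD k s) := by
    rw [logDeriv_apply, ← iteratedDeriv_succ, iteratedDeriv_reflZeta, iteratedDeriv_reflZeta, hws,
      pow_succ]
    rw [mul_assoc, mul_div_mul_left _ _ (by simp), neg_one_mul, neg_div]
  have hbig : 2 * ‖a‖ + 1 ≤ ‖zetaD k s‖ := by
    rw [← hnorm]
    refine le_trans ?_ hlow
    rw [← div_le_iff₀' hc]
    exact (Real.log_le_iff_le_exp hM).1 (by rw [hwre]; linarith)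
  have hz0 : zetaD k s ≠ 0 := norm_pos_iff.1 (by linarith [norm_nonneg a])
  have hfa : ‖zetaD k s‖ ≤ 2 * ‖zetaD k s - a‖ := by
    have := norm_sub_norm_le (zetaD k s) a
    linarith
  have hf0 : zetaD k s - a ≠ 0 := norm_pos_iff.1 (by linarith [norm_nonneg a])
  refine ⟨hf0, ?_⟩
  rw [deriv_zetaD_sub]
  have h1 : ‖zetaD (k + 1) s / (zetaD k s - a)‖ ≤ 2 * ‖zetaD (k + 1) s / zetaD k s‖ := by
    rw [norm_div, norm_div, div_le_iff₀ (norm_pos_iff.2 hf0), mul_div_assoc', div_mul_eq_mul_div,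
      le_div_iff₀ (norm_pos_iff.2 hz0)]
    nlinarith [norm_nonneg (zetaD (k + 1) s)]
  have hs1 : 1 ≤ ‖s‖ := him.trans ((le_abs_self _).trans (abs_im_le_norm s))
  have hlog1 : 1 ≤ Real.log (2 + ‖s‖) := by
    rw [Real.le_log_iff_exp_le (by positivity)]
    linarith [Real.exp_one_lt_d9]
  have hw0 : 1 ≤ ‖w‖ := by
    refine le_trans ?_ (re_le_norm w)
    rw [hwre]; linarith
  have hw1 : ‖log w‖ ≤ Real.log (2 + ‖s‖) + Real.pi := by
    refine (norm_le_abs_re_add_abs_im _).trans (add_le_add ?_ ?_)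
    · rw [log_re, abs_of_nonneg (Real.log_nonneg hw0)]
      refine Real.log_le_log (by linarith) ((norm_sub_le 1 s).trans ?_)
      rw [norm_one]; linarith
    · rw [log_im]; exact abs_arg_le_pi w
  have h2 : ‖zetaD (k + 1) s / zetaD k s‖ ≤ C + (Real.log (2 + ‖s‖) + Real.pi) := by
    rw [← norm_neg, ← hQeq, ← sub_add_cancel (logDeriv _ w) (log w)]
    exact norm_add_le_of_le hQ hw1
  have := Real.pi_pos
  nlinarith

/-! ### The zeta function to the right of the imaginary axis -/

/-- The fractional part of a real number `t > 1`, and zero for `t ≤ 1`. -/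
noncomputable def fractIoi (t : ℝ) : ℂ :=
  (Ioi (1 : ℝ)).indicator (fun t => ((Int.fract t : ℝ) : ℂ)) t

lemma norm_fractIoi_le (t : ℝ) : ‖fractIoi t‖ ≤ 1 := by
  rw [fractIoi]
  refine (norm_indicator_le_norm_self _ _).trans ?_
  rw [norm_real, Real.norm_of_nonneg (Int.fract_nonneg t)]
  exact (Int.fract_lt_one t).le

lemma measurable_fractIoi : Measurable fractIoi :=
  Measurable.indicator (measurable_ofReal.comp measurable_fract) measurableSet_Ioi

lemma locallyIntegrable_fractIoi : MeasureTheory.LocallyIntegrable fractIoi := by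
  refine MeasureTheory.LocallyIntegrable.mono
    (f := fun _ => (1 : ℝ)) (MeasureTheory.locallyIntegrable_const _)
    measurable_fractIoi.aestronglyMeasurable (MeasureTheory.ae_of_all _ fun t => ?_)
  simpa using norm_fractIoi_le t

lemma differentiableOn_mellin_fractIoi :
    DifferentiableOn ℂ (fun s => mellin fractIoi (-s)) {s | 0 < s.re} := by
  intro s hs
  have hs' : 0 < s.re := hs
  refine DifferentiableAt.differentiableWithinAt ?_
  refine DifferentiableAt.comp (g := mellin fractIoi) s ?_ differentiableAt_id.neg
  -- `fractIoi` is bounded at infinity and vanishes near `0`, so any exponent `b` below `-s.re` is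
  -- admissible.
  refine mellin_differentiableAt_of_isBigO_rpow (a := 0) (b := -s.re - 1)
    (locallyIntegrable_fractIoi.locallyIntegrableOn _) ?_ ?_ ?_ ?_
  · refine IsBigO.of_bound 1 (Eventually.of_forall fun t => ?_)
    simpa using norm_fractIoi_le t
  · simpa using hs'
  · refine IsBigO.of_bound 1 ?_
    filter_upwards [nhdsWithin_le_nhds (Iio_mem_nhds (zero_lt_one' ℝ))] with t ht
    have : fractIoi t = 0 := indicator_of_notMem (by simpa using le_of_lt ht) _
    rw [this, norm_zero]
    positivity
  · simp

lemma mellin_fractIoi_eq (s : ℂ) :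
    mellin fractIoi (-s) = ∫ t in Ioi (1 : ℝ), ((Int.fract t : ℝ) : ℂ) * (t : ℂ) ^ (-(s + 1)) := by
  have h1 : ∀ t : ℝ, (t : ℂ) ^ (-s - 1) • fractIoi t
      = (Ioi (1 : ℝ)).indicator
        (fun t : ℝ => ((Int.fract t : ℝ) : ℂ) * (t : ℂ) ^ (-(s + 1))) t := by
    intro t
    rw [fractIoi, smul_eq_mul, mul_comm, indicator_apply, indicator_apply, ite_mul, zero_mul,
      show -s - 1 = -(s + 1) by ring]
  rw [mellin]
  simp_rw [h1]
  rw [MeasureTheory.setIntegral_indicator measurableSet_Ioi,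
    inter_eq_self_of_subset_right (Ioi_subset_Ioi zero_le_one)]

lemma norm_fract_mul_cpow_le (s : ℂ) {t : ℝ} (ht : 1 < t) :
    ‖((Int.fract t : ℝ) : ℂ) * (t : ℂ) ^ (-(s + 1))‖ ≤ t ^ (-s.re - 1) := by
  rw [norm_mul, norm_cpow_eq_rpow_re_of_pos (by linarith), norm_real,
    Real.norm_of_nonneg (Int.fract_nonneg t)]
  have : (-(s + 1)).re = -s.re - 1 := by simp; ring
  rw [this]
  exact mul_le_of_le_one_left (by positivity) (Int.fract_lt_one t).le

lemma norm_mellin_fractIoi_le {s : ℂ} (hs : 0 < s.re) : ‖mellin fractIoi (-s)‖ ≤ 1 / s.re := by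
  rw [mellin_fractIoi_eq]
  have h1 := integral_Ioi_rpow_of_lt (a := -s.re - 1) (c := 1) (by linarith) one_pos
  have h2 : ∫ t in Ioi (1 : ℝ), t ^ (-s.re - 1) = 1 / s.re := by
    rw [h1, Real.one_rpow]
    have : -s.re - 1 + 1 = -s.re := by ring
    rw [this, neg_div_neg_eq]
  rw [← h2]
  refine MeasureTheory.norm_integral_le_of_norm_le
    (integrableOn_Ioi_rpow_of_lt (by linarith) one_pos) ?_
  exact (MeasureTheory.ae_restrict_iff' measurableSet_Ioi).2
    (MeasureTheory.ae_of_all _ fun t ht => norm_fract_mul_cpow_le s ht)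

/-- Partial summation, with `⌊t⌋ = t - {t}`. The remaining integral converges for `Re s > 0`. -/
lemma riemannZeta_eq_sub_mellin {s : ℂ} (hs : 1 < s.re) :
    riemannZeta s = s / (s - 1) - s * mellin fractIoi (-s) := by
  have hs1 : s - 1 ≠ 0 := by
    intro h
    rw [sub_eq_zero] at h
    rw [h] at hs; simp at hs
  have hO : (fun n : ℕ => ∑ k ∈ Finset.Icc 1 n, ‖(1 : ℕ → ℂ) k‖) =O[atTop]
      fun n : ℕ => (n : ℝ) ^ (1 : ℝ) := by
    simpa using isBigO_refl (fun n : ℕ => (n : ℝ)) atTop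
  rw [← LSeries_one_eq_riemannZeta hs, LSeries_eq_mul_integral' 1 zero_le_one hs hO,
    mellin_fractIoi_eq]
  have h1 : ∀ t ∈ Ioi (1 : ℝ), (∑ k ∈ Finset.Icc 1 ⌊t⌋₊, (1 : ℕ → ℂ) k) * (t : ℂ) ^ (-(s + 1))
      = (t : ℂ) ^ (-s) - ((Int.fract t : ℝ) : ℂ) * (t : ℂ) ^ (-(s + 1)) := by
    intro t ht
    have ht0 : (0 : ℝ) < t := zero_lt_one.trans ht
    have htc : (t : ℂ) ≠ 0 := ofReal_ne_zero.2 ht0.ne'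
    have hfl : (⌊t⌋₊ : ℝ) = t - Int.fract t := by
      rw [natCast_floor_eq_intCast_floor ht0.le, Int.self_sub_fract]
    have h2 : ∑ k ∈ Finset.Icc 1 ⌊t⌋₊, (1 : ℕ → ℂ) k = (t : ℂ) - ((Int.fract t : ℝ) : ℂ) := by
      rw [← ofReal_sub, ← hfl]; simp
    have h3 : (t : ℂ) ^ (-s) = t * (t : ℂ) ^ (-(s + 1)) := by
      rw [show -s = 1 + -(s + 1) by ring, cpow_add _ _ htc, cpow_one]
    rw [h2, h3, sub_mul]
  have hi1 : MeasureTheory.IntegrableOn (fun t : ℝ => (t : ℂ) ^ (-s)) (Ioi 1) :=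
    integrableOn_Ioi_cpow_of_lt (by simpa using hs) one_pos
  have hi2 : MeasureTheory.IntegrableOn
      (fun t : ℝ => ((Int.fract t : ℝ) : ℂ) * (t : ℂ) ^ (-(s + 1))) (Ioi 1) := by
    refine MeasureTheory.Integrable.mono'
      (integrableOn_Ioi_rpow_of_lt (a := -s.re - 1) (by linarith) one_pos) ?_ ?_
    · refine Measurable.aestronglyMeasurable ?_
      exact (measurable_ofReal.comp measurable_fract).mul (measurable_ofReal.pow_const _)
    · exact (MeasureTheory.ae_restrict_iff' measurableSet_Ioi).2
        (MeasureTheory.ae_of_all _ fun t ht => norm_fract_mul_cpow_le s ht)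
  rw [MeasureTheory.setIntegral_congr_fun measurableSet_Ioi h1, MeasureTheory.integral_sub hi1 hi2,
    integral_Ioi_cpow_of_lt (by simpa using hs) one_pos, ofReal_one, one_cpow]
  have h4 : -s + 1 ≠ 0 := by
    intro h; apply hs1; rw [← neg_eq_zero, ← h]; ring
  rw [mul_sub]
  congr 1
  rw [mul_div_assoc', div_eq_div_iff h4 hs1]
  ring

/-- The formula with the fractional part extends from `Re s > 1` to `Re s > 0` by the identity
theorem applied to `(s - 1) ζ(s)`. Then `|1 / (s - 1)| ≤ 4` and the integral is at most `2`. -/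
lemma norm_riemannZeta_le {s : ℂ} (hre : 1 / 2 ≤ s.re) (him : 1 / 4 ≤ |s.im|) :
    ‖riemannZeta s‖ ≤ 6 * ‖s‖ := by
  have hU : IsOpen {s : ℂ | 0 < s.re} := isOpen_lt continuous_const continuous_re
  have heq : EqOn riemannZeta₁ (fun s => s - s * (s - 1) * mellin fractIoi (-s))
      {s : ℂ | 0 < s.re} := by
    refine AnalyticOnNhd.eqOn_of_preconnected_of_eventuallyEq (z₀ := 2)
      (differentiable_riemannZeta₁.differentiableOn.analyticOnNhd hU)
      (DifferentiableOn.analyticOnNhd ?_ hU) (convex_halfSpace_re_gt 0).isPreconnected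
      (by simp) ?_
    · exact differentiableOn_id.sub
        ((differentiableOn_id.mul (differentiableOn_id.sub_const 1)).mul
          differentiableOn_mellin_fractIoi)
    · filter_upwards [(isOpen_lt continuous_const continuous_re).mem_nhds
        (show (1 : ℝ) < (2 : ℂ).re by simp)] with z hz
      have hz1 : z ≠ 1 := by
        rintro rfl
        simp at hz
      have hz2 : z - 1 ≠ 0 := sub_ne_zero.2 hz1
      have h1 := riemannZeta_eq_inv_sub_mul hz1
      rw [riemannZeta_eq_sub_mellin hz, eq_inv_mul_iff_mul_eq₀ hz2] at h1
      rw [← h1]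
      field_simp
  have hs1 : s ≠ 1 := by
    rintro rfl
    norm_num at him
  have hs2 : s - 1 ≠ 0 := sub_ne_zero.2 hs1
  have hz : riemannZeta s = s * ((s - 1)⁻¹ - mellin fractIoi (-s)) := by
    rw [riemannZeta_eq_inv_sub_mul hs1, heq (show 0 < s.re by linarith)]
    field_simp
  have h1 : ‖(s - 1)⁻¹‖ ≤ 4 := by
    rw [norm_inv, inv_le_comm₀ (norm_pos_iff.2 hs2) (by norm_num)]
    have := abs_im_le_norm (s - 1)
    rw [sub_im, one_im, sub_zero] at this
    linarith
  have h2 : ‖mellin fractIoi (-s)‖ ≤ 2 := by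
    refine (norm_mellin_fractIoi_le (by linarith)).trans ?_
    rw [div_le_iff₀ (by linarith)]
    linarith
  rw [hz, norm_mul, mul_comm]
  gcongr
  exact (norm_sub_le _ _).trans (by linarith)

/-! ### Polynomial growth in vertical strips -/

/-- On `S`, the function `F` is at most a power of `2 + |Im s|`. -/
def PolyBounded (S : Set ℂ) (F : ℂ → ℝ) : Prop :=
  ∃ D : ℕ, ∀ s ∈ S, F s ≤ (2 + |s.im|) ^ D

lemma PolyBounded.mono {S : Set ℂ} {F G : ℂ → ℝ} (hG : PolyBounded S G)
    (h : ∀ s ∈ S, F s ≤ G s) : PolyBounded S F := by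
  obtain ⟨D, hD⟩ := hG
  exact ⟨D, fun s hs => (h s hs).trans (hD s hs)⟩

lemma PolyBounded.mul {S : Set ℂ} {F G : ℂ → ℝ} (hF : PolyBounded S F) (hG : PolyBounded S G)
    (h0 : ∀ s ∈ S, 0 ≤ G s) : PolyBounded S fun s => F s * G s := by
  obtain ⟨D, hD⟩ := hF
  obtain ⟨D', hD'⟩ := hG
  refine ⟨D + D', fun s hs => ?_⟩
  rw [pow_add]
  exact mul_le_mul (hD s hs) (hD' s hs) (h0 s hs) (by positivity)

lemma PolyBounded.pow {S : Set ℂ} {F : ℂ → ℝ} (hF : PolyBounded S F)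
    (h0 : ∀ s ∈ S, 0 ≤ F s) (n : ℕ) : PolyBounded S fun s => F s ^ n := by
  obtain ⟨D, hD⟩ := hF
  refine ⟨D * n, fun s hs => ?_⟩
  rw [pow_mul]
  exact pow_le_pow_left₀ (h0 s hs) (hD s hs) n

/-- The base `2 + |Im s|` is at least `2`, so constants are absorbed into the exponent. -/
lemma polyBounded_affine (S : Set ℂ) {c E : ℝ} (hc : 0 ≤ c) (hE : 0 ≤ E) :
    PolyBounded S fun s => c * (E + |s.im|) := by
  obtain ⟨n, hn⟩ := pow_unbounded_of_one_lt (c * (E + 1)) one_lt_two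
  refine ⟨n + 1, fun s _ => ?_⟩
  have h0 := abs_nonneg s.im
  calc c * (E + |s.im|) ≤ c * (E + 1) * (2 + |s.im|) := by
        rw [mul_assoc]
        gcongr
        nlinarith
    _ ≤ 2 ^ n * (2 + |s.im|) := by gcongr
    _ ≤ (2 + |s.im|) ^ n * (2 + |s.im|) := by gcongr; linarith
    _ = _ := (pow_succ _ _).symm

lemma norm_le_add_abs_im {s : ℂ} {E : ℝ} (h : |s.re| ≤ E) : ‖s‖ ≤ E + |s.im| :=
  (norm_le_abs_re_add_abs_im s).trans (by linarith)

lemma exists_norm_Gamma_two_add_mul_cosh_le : ∃ K : ℝ, 0 ≤ K ∧ ∀ t : ℝ, 1 / 4 ≤ |t| →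
    ‖Gamma (2 + t * I)‖ * Real.cosh (Real.pi * t / 2) ≤ (1 + |t|) * (K * (1 + |t|)) := by
  have hs0 : 0 < Real.sinh (Real.pi * (1 / 4) / 2) := Real.sinh_pos_iff.2 (by positivity)
  set κ : ℝ := 1 + 1 / Real.sinh (Real.pi * (1 / 4) / 2) with hκ
  have hκ1 : 0 < κ := by positivity
  refine ⟨Real.pi / 2 * κ + 1, by positivity, fun t ht => ?_⟩
  have h1 := norm_Gamma_mul_cosh_le (by norm_num) ht
  have h2 : Gamma (2 + t * I) = (1 + t * I) * Gamma (1 + t * I) := by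
    rw [← Gamma_add_one _ (fun h => by simpa using congrArg re h)]
    congr 1; ring
  have h3 : ‖(1 + t * I : ℂ)‖ ≤ 1 + |t| := by
    have := norm_add_le (1 : ℂ) (t * I)
    simpa using this
  have h4 : ‖Gamma (1 + t * I)‖ * Real.cosh (Real.pi * t / 2)
      ≤ (Real.pi / 2 * κ + 1) * (1 + |t|) := by
    set y := ‖Gamma (1 + t * I)‖ * Real.cosh (Real.pi * t / 2)
    have : y ≤ y ^ 2 + 1 := by nlinarith [sq_nonneg (y - 1), sq_nonneg y]
    have hp : 0 ≤ Real.pi / 2 * κ := by positivity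
    have : Real.pi * |t| / 2 * κ = Real.pi / 2 * κ * |t| := by ring
    nlinarith [abs_nonneg t]
  rw [h2, norm_mul, mul_assoc]
  exact mul_le_mul h3 h4 (mul_nonneg (norm_nonneg _) (Real.cosh_pos _).le) (by positivity)

/-- The case `Re s = 2` follows from the reflection formula; to the right `Re (Γ' / Γ) ≤ 1 + log
|s|`, so a bounded horizontal move costs a power of `|Im s|`. -/
lemma polyBounded_Gamma_mul_cosh_of_two_le (E : ℝ) :
    PolyBounded {s | 2 ≤ s.re ∧ s.re ≤ E ∧ 1 / 4 ≤ |s.im|}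
      fun s => ‖Gamma s‖ * Real.cosh (Real.pi * s.im / 2) := by
  obtain ⟨K, hK, h⟩ := exists_norm_Gamma_two_add_mul_cosh_le
  obtain ⟨n, hn⟩ := exists_nat_ge E
  have hbd := ((polyBounded_affine {s : ℂ | 2 ≤ s.re ∧ s.re ≤ E ∧ 1 / 4 ≤ |s.im|} zero_le_one
    zero_le_one).mul (polyBounded_affine _ hK zero_le_one) (fun s _ => by positivity)).mul
    ((polyBounded_affine _ (Real.exp_pos 1).le (Nat.cast_nonneg n)).pow
      (fun s _ => by positivity) n) (fun s _ => by positivity)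
  refine hbd.mono fun s hs => ?_
  obtain ⟨hre, hE, him⟩ := hs
  have hn' : (2 : ℝ) ≤ n := by linarith
  have hu : ∀ u ∈ Icc (2 : ℝ) s.re, 2 ≤ (u + s.im * I : ℂ).re := fun u hu => by simpa using hu.1
  have hb : 1 ≤ n + |s.im| := by linarith [abs_nonneg s.im]
  have key := norm_le_mul_exp_of_re_logDeriv_le (g := Gamma) (t := s.im)
    (κ := 1 + Real.log (n + |s.im|)) hre
    (fun u hu' => differentiableAt_Gamma _ fun m h => by
      have h1 := hu u hu'
      rw [h, neg_re, natCast_re] at h1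
      linarith [Nat.cast_nonneg (α := ℝ) m])
    (fun u hu' => Gamma_ne_zero_of_re_pos (by linarith [hu u hu']))
    (fun u hu' => by
      have h1 := (re_le_norm _).trans (norm_logDeriv_Gamma_sub_log_le (hu u hu'))
      rw [sub_re, log_re, logDeriv_apply] at h1
      have h2 : ‖(u + s.im * I : ℂ)‖ ≤ n + |s.im| := by
        have := norm_le_add_abs_im (s := u + s.im * I) (E := n) (by
          have := hu'.1; have := hu'.2
          simp only [add_re, ofReal_re, mul_re, I_re, mul_zero, ofReal_im, I_im, mul_one, sub_self,
            add_zero]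
          rw [abs_of_nonneg (by linarith)]
          linarith)
        simpa using this
      have h3 : 0 < ‖(u + s.im * I : ℂ)‖ := by linarith [re_le_norm (u + s.im * I), hu u hu']
      linarith [Real.log_le_log h3 h2])
  rw [re_add_im] at key
  have h5 : Real.exp ((1 + Real.log (n + |s.im|)) * (s.re - 2))
      ≤ (Real.exp 1 * (n + |s.im|)) ^ n := by
    have h6 : Real.exp 1 * (n + |s.im|) = Real.exp (1 + Real.log (n + |s.im|)) := by
      rw [Real.exp_add, Real.exp_log (by linarith)]
    rw [h6, ← Real.exp_nat_mul, mul_comm]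
    have := Real.log_nonneg hb
    refine Real.exp_le_exp.2 (mul_le_mul_of_nonneg_right (by linarith) (by linarith))
  have h7 := h s.im him
  calc ‖Gamma s‖ * Real.cosh (Real.pi * s.im / 2)
      ≤ (‖Gamma ((2 : ℝ) + s.im * I)‖ * Real.exp ((1 + Real.log (n + |s.im|)) * (s.re - 2)))
        * Real.cosh (Real.pi * s.im / 2) := by
        gcongr
    _ = (‖Gamma (2 + s.im * I)‖ * Real.cosh (Real.pi * s.im / 2))
        * Real.exp ((1 + Real.log (n + |s.im|)) * (s.re - 2)) := by
        push_cast; ring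
    _ ≤ ((1 + |s.im|) * (K * (1 + |s.im|))) * (Real.exp 1 * (n + |s.im|)) ^ n := by gcongr
    _ = _ := by rw [one_mul]

lemma polyBounded_Gamma_mul_cosh (E : ℝ) :
    PolyBounded {s | 1 / 2 ≤ s.re ∧ s.re ≤ E ∧ 1 / 4 ≤ |s.im|}
      fun s => ‖Gamma s‖ * Real.cosh (Real.pi * s.im / 2) := by
  obtain ⟨D, hD⟩ := polyBounded_Gamma_mul_cosh_of_two_le (E + 2)
  refine ⟨D + 1, fun s hs => ?_⟩
  obtain ⟨hre, hE, him⟩ := hs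
  have h1 := hD (s + 2) ⟨by simp; linarith, by simpa using hE, by simpa using him⟩
  have hs0 : s ≠ 0 := by rintro rfl; norm_num at hre
  have hs1 : s + 1 ≠ 0 := fun h => by
    have := congrArg re h
    simp at this; linarith
  have h2 : Gamma (s + 2) = (s + 1) * (s * Gamma s) := by
    rw [← Gamma_add_one s hs0, ← Gamma_add_one _ hs1]; congr 1; ring
  have h3 : 1 / 2 ≤ ‖s‖ := hre.trans (re_le_norm s)
  have h4 : 1 ≤ ‖s + 1‖ := by
    refine le_trans ?_ (re_le_norm _)
    simp; linarith
  have h5 : ‖Gamma s‖ ≤ 2 * ‖Gamma (s + 2)‖ := by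
    rw [h2, norm_mul, norm_mul]
    have : 1 / 2 * ‖Gamma s‖ ≤ ‖s‖ * ‖Gamma s‖ := by gcongr
    nlinarith [mul_le_mul_of_nonneg_right h4
      (mul_nonneg (norm_nonneg s) (norm_nonneg (Gamma s)))]
  simp only [add_im, im_ofNat, add_zero] at h1
  have hc := Real.cosh_pos (Real.pi * s.im / 2)
  calc ‖Gamma s‖ * Real.cosh (Real.pi * s.im / 2)
      ≤ 2 * ‖Gamma (s + 2)‖ * Real.cosh (Real.pi * s.im / 2) := by gcongr
    _ ≤ 2 * (2 + |s.im|) ^ D := by rw [mul_assoc]; gcongr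
    _ ≤ (2 + |s.im|) * (2 + |s.im|) ^ D := by gcongr; linarith [abs_nonneg s.im]
    _ = _ := (pow_succ' _ _).symm

lemma polyBounded_reflZeta (E : ℝ) :
    PolyBounded {s | 1 / 2 ≤ s.re ∧ s.re ≤ E ∧ s.im ≤ -(1 / 4)} fun s => ‖reflZeta s‖ := by
  rcases lt_or_ge E 0 with hE | hE
  · exact ⟨0, fun s hs => absurd (hs.1.trans hs.2.1) (by linarith)⟩
  have habs : ∀ s : ℂ, s.im ≤ -(1 / 4) → 1 / 4 ≤ |s.im| := fun s hs => by
    rw [abs_of_nonpos (by linarith)]; linarith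
  obtain ⟨D, hD⟩ := polyBounded_Gamma_mul_cosh E
  have hG : PolyBounded {s | 1 / 2 ≤ s.re ∧ s.re ≤ E ∧ s.im ≤ -(1 / 4)}
      fun s => ‖Gamma s‖ * Real.cosh (Real.pi * s.im / 2) :=
    ⟨D, fun s hs => hD s ⟨hs.1, hs.2.1, habs s hs.2.2⟩⟩
  refine (hG.mul (polyBounded_affine _ (by norm_num : (0 : ℝ) ≤ 12) hE)
    fun s _ => by positivity).mono fun s hs => ?_
  obtain ⟨hre, hEs, him⟩ := hs
  have h1 : ‖2 * (2 * Real.pi : ℂ) ^ (-s)‖ ≤ 2 := by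
    have h := norm_cpow_eq_rpow_re_of_pos (x := 2 * Real.pi) (by positivity) (-s)
    push_cast at h
    rw [norm_mul, Complex.norm_ofNat, h]
    have : (2 * Real.pi) ^ (-s).re ≤ 1 :=
      Real.rpow_le_one_of_one_le_of_nonpos (by linarith [Real.pi_gt_three])
        (by rw [neg_re]; linarith)
    linarith
  have h2 : ‖cos (Real.pi * s / 2)‖ ≤ Real.cosh (Real.pi * s.im / 2) := by
    rw [← half_pi_mul_im]; exact norm_cos_le_cosh _
  have h3 := norm_riemannZeta_le hre (habs s him)
  have h4 : ‖s‖ ≤ E + |s.im| := norm_le_add_abs_im (by rwa [abs_of_nonneg (by linarith)])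
  have hc := Real.cosh_pos (Real.pi * s.im / 2)
  rw [reflZeta_eq (by linarith), norm_mul, norm_mul, norm_mul]
  calc ‖2 * (2 * Real.pi : ℂ) ^ (-s)‖ * ‖Gamma s‖ * ‖cos (Real.pi * s / 2)‖ * ‖riemannZeta s‖
      ≤ 2 * ‖Gamma s‖ * Real.cosh (Real.pi * s.im / 2) * (6 * (E + |s.im|)) := by
        gcongr
        exact h3.trans (by gcongr)
    _ = _ := by ring

lemma polyBounded_riemannZeta (E : ℝ) :
    PolyBounded {s | |s.re| ≤ E ∧ 1 / 4 ≤ s.im} fun s => ‖riemannZeta s‖ := by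
  rcases lt_or_ge E 0 with hE | hE
  · exact ⟨0, fun s hs => absurd ((abs_nonneg _).trans hs.1) (by linarith)⟩
  obtain ⟨D, hD⟩ := polyBounded_reflZeta (E + 1)
  obtain ⟨D', hD'⟩ := polyBounded_affine {s | |s.re| ≤ E ∧ 1 / 4 ≤ s.im}
    (by norm_num : (0 : ℝ) ≤ 6) hE
  refine ⟨max D D', fun s hs => ?_⟩
  have hX : 1 ≤ 2 + |s.im| := by linarith [abs_nonneg s.im]
  obtain ⟨hre, him⟩ := id hs
  rcases le_total (1 / 2) s.re with h | h
  · calc ‖riemannZeta s‖ ≤ 6 * ‖s‖ := norm_riemannZeta_le h (him.trans (le_abs_self _))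
      _ ≤ 6 * (E + |s.im|) := by gcongr; exact norm_le_add_abs_im hre
      _ ≤ (2 + |s.im|) ^ D' := hD' s hs
      _ ≤ _ := pow_le_pow_right₀ hX (le_max_right _ _)
  · have h1 := hD (1 - s) ⟨by simp; linarith, by simp; linarith [(abs_le.1 hre).1],
      by simpa using him⟩
    simp only [reflZeta, sub_sub_cancel, sub_im, one_im, zero_sub, abs_neg] at h1
    exact h1.trans (pow_le_pow_right₀ hX (le_max_left _ _))

/-- Cauchy's estimate on discs of radius `1/4`, on which `Im z ≥ 3/4` and `2 + Im z ≤ 4 Im s`,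
reduces the derivative to `ζ` itself. -/
lemma exists_norm_zetaD_sub_le (k : ℕ) (a : ℂ) (E : ℝ) :
    ∃ D : ℕ, ∀ s : ℂ, 1 ≤ s.im → |s.re| ≤ E → ‖zetaD k s - a‖ ≤ D * s.im ^ D := by
  obtain ⟨D, hD⟩ := polyBounded_riemannZeta (E + 1 / 4)
  obtain ⟨N, hN⟩ := exists_nat_ge (k.factorial * 4 ^ D * 4 ^ k + ‖a‖)
  refine ⟨max N D, fun s him hre => ?_⟩
  have h1 : ∀ z ∈ closedBall s (1 / 4), |z.re| ≤ E + 1 / 4 ∧ 3 / 4 ≤ z.im ∧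
      z.im ≤ s.im + 1 / 4 := by
    intro z hz
    rw [mem_closedBall, dist_eq] at hz
    have h1 := (abs_re_le_norm (z - s)).trans hz
    have h2 := abs_le.1 ((abs_im_le_norm (z - s)).trans hz)
    rw [sub_re] at h1
    rw [sub_im] at h2
    refine ⟨?_, by linarith, by linarith⟩
    have := abs_sub_abs_le_abs_sub z.re s.re
    linarith
  have h2 : ‖zetaD k s‖ ≤ k.factorial * (4 * s.im) ^ D / (1 / 4) ^ k := by
    refine norm_iteratedDeriv_le_of_forall_mem_sphere_norm_le k (by norm_num) ?_ fun z hz => ?_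
    · refine DifferentiableOn.diffContOnCl fun z hz => ?_
      have hz1 := (h1 z (closure_ball_subset_closedBall hz)).2.1
      refine (differentiableAt_riemannZeta ?_).differentiableWithinAt
      rintro rfl
      norm_num at hz1
    · obtain ⟨hz1, hz2, hz3⟩ := h1 z (sphere_subset_closedBall hz)
      refine (hD z ⟨hz1, by linarith⟩).trans ?_
      rw [abs_of_nonneg (by linarith)]
      gcongr
      linarith
  have h3 : 1 ≤ s.im ^ D := one_le_pow₀ him
  have hN' : (N : ℝ) ≤ (max N D : ℕ) := by exact_mod_cast le_max_left N D
  calc ‖zetaD k s - a‖ ≤ k.factorial * (4 * s.im) ^ D / (1 / 4) ^ k + ‖a‖ :=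
        (norm_sub_le _ _).trans (by gcongr)
    _ = k.factorial * 4 ^ D * 4 ^ k * s.im ^ D + ‖a‖ * 1 := by
        rw [mul_pow, one_div, inv_pow, div_inv_eq_mul]; ring
    _ ≤ (k.factorial * 4 ^ D * 4 ^ k + ‖a‖) * s.im ^ D := by
        rw [add_mul]; gcongr
    _ ≤ (max N D : ℕ) * s.im ^ (max N D) := by
        gcongr
        · exact hN.trans hN'
        · exact le_max_right _ _

/-! ### The sum over `a`-points -/

lemma differentiableAt_zetaD (k : ℕ) {s : ℂ} (hs : s ≠ 1) : DifferentiableAt ℂ (zetaD k) s := by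
  have h : AnalyticOnNhd ℂ riemannZeta {1}ᶜ :=
    differentiableOn_riemannZeta.analyticOnNhd isOpen_compl_singleton
  have h1 := h.iterated_deriv k
  rw [← iteratedDeriv_eq_iterate] at h1
  exact (h1 s hs).differentiableAt

lemma exists_landauHypotheses (k : ℕ) (a : ℂ) {B : ℝ} (hB : 2 ≤ B)
    (hne : ∀ s : ℂ, B ≤ s.re → zetaD k s ≠ a)
    (hlow : ∃ c₀ > 0, ∀ t : ℝ, c₀ ≤ ‖zetaD k (B + t * I) - a‖) :
    ∃ A C : ℝ, LandauHypotheses (fun s => zetaD k s - a) A B C := by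
  obtain ⟨A, C, hA, hC, h⟩ := exists_left_half_plane k a
  exact ⟨A, C, fun s hs => ((differentiableAt_zetaD k hs).sub_const a).differentiableWithinAt,
    hA, hB, hC, fun s hre him => (h s hre him).1, fun s hre him => (h s hre him).2,
    fun s hs => sub_ne_zero.2 (hne s hs), hlow, exists_norm_zetaD_sub_le k a⟩

lemma aPoints_eq (k : ℕ) (a : ℂ) (T : ℝ) :
    aPoints k a T = {z | zetaD k z - a = 0 ∧ 1 < z.im ∧ z.im < T} := by
  simp only [aPoints, sub_eq_zero]

/-- Landau's formula is applied with the admissible tuples as index set, not their values; the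
tuples of value `x` then add up to the coefficient at `x`. -/
lemma aPointSum_isBigO {q m k : ℕ} (hq : 0 < q) (hq2 : q ≤ 2) (hqm : q < m) {a c : ℂ} {x : ℝ}
    (hx : 1 < x) {B : ℝ} (hB : 2 ≤ B) (hne : ∀ s : ℂ, B ≤ s.re → zetaD k s ≠ a)
    (hlow : ∃ c₀ > 0, ∀ t : ℝ, c₀ ≤ ‖zetaD k (B + t * I) - a‖)
    (hsum : ∀ s : ℂ, B ≤ s.re →
      (Summable fun p => ‖tupleTerm (logTerm q 2 (k + 1) s) (logTerm q m k s) c p‖) ∧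
      HasSum (tupleTerm (logTerm q 2 (k + 1) s) (logTerm q m k s) c)
        (zetaD (k + 1) s / (zetaD k s - a))) :
    (∀ T : ℝ, (aPoints k a T).Finite) ∧
    ((fun T : ℝ => aPointSum k a x T
        - ((T / (2 * Real.pi) : ℝ) : ℂ) * fiberCoeff q m k c x)
      =O[atTop] fun T : ℝ => Real.log T) ∧
    IsLogDerivCoeff k a (fiberCoeff q m k c) := by
  obtain ⟨A, C, hL⟩ := exists_landauHypotheses k a hB hne hlow
  refine ⟨fun T => by rw [aPoints_eq]; exact hL.finite_zeros T, ?_,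
    ⟨B, fun s hs => ⟨hne s hs.le, hasSum_fiberCoeff hq hq2 hqm (hsum s hs.le).2⟩⟩⟩
  obtain ⟨δ, hδ, hsep⟩ := exists_separation hq hq2 hqm hx
  have hpos : ∀ p : admissible m, 0 < tupleValue q p := fun p =>
    tupleValue_pos hq (by omega) p.2
  have key := hL.sum_zeros_isBigO (ι := admissible m) hx (w := fun p => tupleWeight k c p)
    (N := fun p => tupleValue q p) hpos hδ ?_ (fun p _ => hsep p p.2) ?_
  · simp only [tsum_ite_tupleWeight hq hq2 hqm] at key
    refine key.congr_left fun T => ?_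
    rw [aPointSum, aPoints_eq]
    rfl
  · refine ((hsum B (by simp)).1.subtype (admissible m)).congr fun p => ?_
    rw [Function.comp_apply, tupleTerm_of_admissible p.2, norm_mul,
      norm_cpow_eq_rpow_re_of_pos (hpos p), neg_re, ofReal_re]
  · intro t
    rw [deriv_zetaD_sub]
    have h1 := (hsum (B + t * I) (by simp)).2
    rw [← hasSum_subtype_iff_of_support_subset (s := admissible m)] at h1
    · refine h1.congr_fun fun p => ?_
      rw [Function.comp_apply, tupleTerm_of_admissible p.2]
    · intro p hp
      by_contra hp'
      exact hp (tupleTerm_of_not_admissible hp')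

end ZetaDeriv

/-! ### The theorem, from the cases `a = 0` and `a ≠ 0` -/

theorem theorem2 (x : ℝ) (hx : 1 < x) (k : ℕ) (hk : 1 ≤ k) (a : ℂ) :
    (∀ T : ℝ, (ZetaDeriv.aPoints k a T).Finite) ∧
    (a ≠ 0 →
      (∀ y : ℝ, (ZetaDeriv.factorizations y).Finite) ∧
      ((fun T : ℝ => ZetaDeriv.aPointSum k a x T
          - ((T / (2 * Real.pi) : ℝ) : ℂ) * ZetaDeriv.coeff k a x)
        =O[atTop] fun T : ℝ => Real.log T) ∧
      ZetaDeriv.IsLogDerivCoeff k a (ZetaDeriv.coeff k a) ∧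
      ((¬ ∃ m : ℤ, (m : ℝ) = x) → ZetaDeriv.coeff k a x = 0)) ∧
    (a = 0 →
      (∀ y : ℝ, (ZetaDeriv.dyadicFactorizations y).Finite) ∧
      ((fun T : ℝ => ZetaDeriv.aPointSum k a x T
          - ((T / (2 * Real.pi) : ℝ) : ℂ) * ZetaDeriv.coeffZero k x)
        =O[atTop] fun T : ℝ => Real.log T) ∧
      ZetaDeriv.IsLogDerivCoeff k a (ZetaDeriv.coeffZero k) ∧
      ((∀ n : ℕ, ¬ ∃ m : ℤ, (m : ℝ) = 2 ^ n * x) → ZetaDeriv.coeffZero k x = 0)) := by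
  rcases eq_or_ne a 0 with rfl | ha
  · obtain ⟨B, hB, hne, hlow, hsum⟩ := ZetaDeriv.exists_right_half_plane_zero hk
    obtain ⟨hfin, hO, hcoeff⟩ :=
      ZetaDeriv.aPointSum_isBigO (by norm_num) le_rfl (by norm_num) hx hB hne hlow hsum
    rw [← ZetaDeriv.coeffZero_eq] at hO hcoeff
    refine ⟨hfin, fun h => absurd rfl h, fun _ => ⟨fun y => ?_, hO, hcoeff,
      ZetaDeriv.coeffZero_eq_zero_of_not_dyadic k⟩⟩
    rw [ZetaDeriv.dyadicFactorizations_eq]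
    exact ZetaDeriv.finite_fiber (by norm_num) le_rfl (by norm_num) y
  · obtain ⟨B, hB, hne, hlow, hsum⟩ := ZetaDeriv.exists_right_half_plane_of_ne_zero hk ha
    obtain ⟨hfin, hO, hcoeff⟩ :=
      ZetaDeriv.aPointSum_isBigO (by norm_num) (by norm_num) (by norm_num) hx hB hne hlow hsum
    rw [← ZetaDeriv.coeff_eq] at hO hcoeff
    refine ⟨hfin, fun _ => ⟨fun y => ?_, hO, hcoeff, ZetaDeriv.coeff_eq_zero_of_not_int k a⟩,
      fun h => absurd h ha⟩
    rw [ZetaDeriv.factorizations_eq]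
    exact ZetaDeriv.finite_fiber (by norm_num) (by norm_num) (by norm_num) y
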